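/- **Setting.** Let $T$ be a compact smooth manifold of dimension $p\ge 1$ with a semi-Riemannian metric $h=(h_{\alpha\beta}(t))$, with inverse $h^{\alpha\beta}$, Christoffel symbols $H^\gamma_{\alpha\beta}$ and volume density $\sqrt{|h|}\,dt^1\cdots dt^p$, and let $M$ be a smooth manifold of dimension $n$. The jet bundle $J^1(T,M)$ has coordinates $(t^\alpha,x^i,x^i_\alpha)$, which change by $\tilde t=\tilde t(t)$, $\tilde x=\tilde x(x)$, $\tilde x^k_\gamma=\frac{\partial\tilde x^k}{\partial x^j}\frac{\partial t^\alpha}{\partial\tilde t^\gamma}x^j_\alpha$. Repeated indices are summed. Let $L:J^1(T,M)\to\mathbb R$ be a smooth Kronecker $h$-regular Lagrangian function, that is, $$\tfrac12\frac{\partial^2L}{\partial x^i_\alpha\partial x^j_\beta}=h^{\alpha\beta}(t)\,g_{ij}(t,x,x^k_\gamma)$$ for a symmetric nondegenerate d-tensor $g_{ij}$ of constant signature on $J^1(T,M)$, with inverse $g^{ij}$. An *extremal* of the energy functional $\mathcal E_L(f)=\int_T L(t^\alpha,x^i,x^i_\alpha)\sqrt{|h|}\,dt^1\cdots dt^p$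 is a smooth map $f:T\to M$ such that $\frac{d}{ds}\big|_{s=0}\mathcal E_L(f_s)=0$ for every smooth variation $(f_s)_{s\in\mathbb R}$ of $f=f_0$. A *spray* on $J^1(T,M)$ is a pair $(H,G)$ of systems of smooth local components $H^{(i)}_{(\alpha)\beta}$, $G^{(i)}_{(\alpha)\beta}$ that transform by $$2\tilde H^{(k)}_{(\gamma)\beta}=2H^{(j)}_{(\alpha)\mu}\frac{\partial t^\alpha}{\partial\tilde t^\gamma}\frac{\partial t^\mu}{\partial\tilde t^\beta}\frac{\partial\tilde x^k}{\partial x^j}-\frac{\partial t^\mu}{\partial\tilde t^\beta}\frac{\partial\tilde x^k_\gamma}{\partial t^\mu},\qquad 2\tilde G^{(k)}_{(\gamma)\beta}=2G^{(j)}_{(\alpha)\mu}\frac{\partial t^\alpha}{\partial\tilde t^\gamma}\frac{\partial t^\mu}{\partial\tilde t^\beta}\frac{\partial\tilde x^k}{\partial x^j}-\frac{\partial x^i}{\partial\tilde x^j}\frac{\partial\tilde x^k_\gamma}{\partial x^i}\tilde x^j_\beta .$$ A smooth map $f:T\to M$, locally $t\mapsto x^i(t)$, is a *harmonic map* of $(H,G)$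 (with respect to $h$) if in all coordinates, for all $i$, with $x^i_\alpha=\partial x^i/\partial t^\alpha$, $$h^{\alpha\beta}\Big(\frac{\partial^2x^i}{\partial t^\alpha\partial t^\beta}+2G^{(i)}_{(\alpha)\beta}+2H^{(i)}_{(\alpha)\beta}\Big)=0 .$$ A *nonlinear connection* on $J^1(T,M)$ is a pair of systems of smooth local components $M^{(i)}_{(\alpha)\beta}$, $N^{(i)}_{(\alpha)j}$ with $$\tilde M^{(j)}_{(\beta)\mu}\frac{\partial\tilde t^\mu}{\partial t^\alpha}=M^{(k)}_{(\gamma)\alpha}\frac{\partial\tilde x^j}{\partial x^k}\frac{\partial t^\gamma}{\partial\tilde t^\beta}-\frac{\partial\tilde x^j_\beta}{\partial t^\alpha},\qquad \tilde N^{(j)}_{(\beta)k}\frac{\partial\tilde x^k}{\partial x^i}=N^{(k)}_{(\gamma)i}\frac{\partial\tilde x^j}{\partial x^k}\frac{\partial t^\gamma}{\partial\tilde t^\beta}-\frac{\partial\tilde x^j_\beta}{\partial x^i}.$$ **Theorem.** (0) If $p\ge2$, then $g_{ij}=g_{ij}(t,x)$ does not depend on the $x^k_\gamma$ and $$L=h^{\alpha\beta}(t)g_{ij}(t,x)x^i_\alpha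 x^j_\beta+U^{(\alpha)}_{(i)}(t,x)x^i_\alpha+F(t,x),\qquad U^{(\alpha)}_{(i)}=\frac{\partial L}{\partial x^i_\alpha}\Big|_{x^k_\gamma=0},\quad F=L\big|_{x^k_\gamma=0}.$$ (1) The following components define a spray $(H,G)$: temporal components $H^{(i)}_{(\alpha)\beta}=-\tfrac12H^\gamma_{\alpha\beta}x^i_\gamma$; spatial components, for $p=1$ (writing $t=t^1$, $y^i=x^i_1$), $$G^{(i)}_{(1)1}=\frac{h_{11}g^{ik}}4\Big[\frac{\partial^2L}{\partial x^j\partial y^k}y^j-\frac{\partial L}{\partial x^k}+\frac{\partial^2L}{\partial t\,\partial y^k}+\frac{\partial L}{\partial y^k}H^1_{11}+2h^{11}H^1_{11}g_{kl}y^l\Big],$$ and for $p\ge2$ $$G^{(i)}_{(\alpha)\beta}=\tfrac12\Gamma^i_{jk}x^j_\alpha x^k_\beta+T^{(i)}_{(\alpha)\beta},\qquad T^{(i)}_{(\alpha)\beta}=\frac{h_{\alpha\beta}}p\,\mathcal T^i,$$ where $\Gamma^l_{jk}=\frac{g^{li}}2\big(\frac{\partial g_{ij}}{\partial x^k}+\frac{\partial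 g_{ik}}{\partial x^j}-\frac{\partial g_{jk}}{\partial x^i}\big)$, $U^{(\alpha)}_{(i)j}=\frac{\partial U^{(\alpha)}_{(i)}}{\partial x^j}-\frac{\partial U^{(\alpha)}_{(j)}}{\partial x^i}$ and $$2\mathcal T^l=\frac{g^{li}}2\Big[2h^{\alpha\beta}\frac{\partial g_{ij}}{\partial t^\alpha}x^j_\beta+U^{(\alpha)}_{(i)j}x^j_\alpha+\frac{\partial U^{(\alpha)}_{(i)}}{\partial t^\alpha}+U^{(\alpha)}_{(i)}H^\gamma_{\alpha\gamma}-\frac{\partial F}{\partial x^i}\Big].$$ (2) Every extremal of $\mathcal E_L$ is a harmonic map of the spray $(H,G)$. (3) With $\mathcal G^i=h^{\alpha\beta}G^{(i)}_{(\alpha)\beta}$, the components $$M^{(i)}_{(\alpha)\beta}=2H^{(i)}_{(\alpha)\beta},\qquad N^{(i)}_{(\alpha)j}=\frac{\partial\mathcal G^i}{\partial x^j_\gamma}h_{\alpha\gamma}$$ define a nonlinear connection on $J^1(T,M)$ (the canonical nonlinear connection), and for $p\ge2$ $$N^{(i)}_{(\alpha)j}=\Gamma^i_{jk}x^k_\alpha+\frac{g^{ik}}2\frac{\partial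 g_{jk}}{\partial t^\alpha}+\frac{g^{ik}}4h_{\alpha\gamma}U^{(\gamma)}_{(k)j}.$$ -/

import Mathlib

open Set Filter Topology MeasureTheory
open scoped Manifold ContDiff

noncomputable section

namespace MultiTime

/-- The model space `ℝᵐ`. -/
abbrev Rn (m : ℕ) := EuclideanSpace ℝ (Fin m)

/-- The `a`-th vector of the standard basis of `ℝᵐ`. -/
def stdVec {m : ℕ} (a : Fin m) : Rn m := EuclideanSpace.single a (1 : ℝ)

/-- Local charts with values in `ℝᵐ`. -/
abbrev LChart (m : ℕ) (X : Type*) [TopologicalSpace X] := OpenPartialHomeomorph X (Rn m)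

/-- All charts that are compatible with the smooth structure of `X`. -/
abbrev smoothCharts (m : ℕ) (X : Type*) [TopologicalSpace X] [ChartedSpace (Rn m) X] :
    Set (LChart m X) := IsManifold.maximalAtlas (𝓡 m) ∞ X

/-- The coordinate vector `∂/∂uᵃ` of the chart `e` at the point with coordinates `u`. -/
def coordVec {m : ℕ} {X : Type*} [TopologicalSpace X] [ChartedSpace (Rn m) X]
    (e : LChart m X) (u : Rn m) (a : Fin m) : TangentSpace (𝓡 m) (e.symm u) :=
  mfderiv (𝓡 m) (𝓡 m) e.symm u (stdVec a)

/-- The Jacobian entry `∂ũᵇ/∂uᵃ` at `u` of the change of coordinates from `e` to `e'`. -/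
def coordJac {m : ℕ} {X : Type*} [TopologicalSpace X]
    (e e' : LChart m X) (u : Rn m) (b a : Fin m) : ℝ :=
  (fderiv ℝ (fun v => e' (e.symm v)) u (stdVec a)) b

/-! ### Semi-Riemannian metrics, their Christoffel symbols and volume -/

/-- Semi-Riemannian metrics: smooth symmetric nondegenerate `(0,2)`-tensor fields of constant
index. -/
structure SemiRiemannianMetric (m : ℕ) (X : Type*) [TopologicalSpace X]
    [ChartedSpace (Rn m) X] where
  form : ∀ x : X, LinearMap.BilinForm ℝ (TangentSpace (𝓡 m) x)
  symm : ∀ x v w, form x v w = form x w v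
  nondeg : ∀ x v, (∀ w, form x v w = 0) → v = 0
  constIndex : ∃ ν : ℕ, ∀ x, sigNeg (form x).toQuadraticMap = ν
  smooth : ∀ e ∈ smoothCharts m X, ∀ a b : Fin m,
    ContDiffOn ℝ ∞ (fun u => form (e.symm u) (coordVec e u a) (coordVec e u b)) e.target

section Temporal

variable {p : ℕ} {T : Type*} [TopologicalSpace T] [ChartedSpace (Rn p) T]

/-- The matrix `h_{αβ}` of `h` in the chart `φ`. -/
def hLow (h : SemiRiemannianMetric p T) (φ : LChart p T) (t : Rn p) :
    Matrix (Fin p) (Fin p) ℝ :=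
  Matrix.of fun α β => h.form (φ.symm t) (coordVec φ t α) (coordVec φ t β)

/-- The inverse matrix `h^{αβ}`. -/
def hUp (h : SemiRiemannianMetric p T) (φ : LChart p T) (t : Rn p) :
    Matrix (Fin p) (Fin p) ℝ := (hLow h φ t)⁻¹

/-- The derivative `∂h_{αβ}/∂t^μ`. -/
def dhLow (h : SemiRiemannianMetric p T) (φ : LChart p T) (t : Rn p) (μ α β : Fin p) : ℝ :=
  fderiv ℝ (fun s => hLow h φ s α β) t (stdVec μ)

/-- The Christoffel symbols `H^γ_{αβ}` of `h` in the chart `φ`. -/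
def christoffelH (h : SemiRiemannianMetric p T) (φ : LChart p T) (t : Rn p)
    (γ α β : Fin p) : ℝ :=
  ∑ μ, hUp h φ t γ μ / 2 *
    (dhLow h φ t α μ β + dhLow h φ t β μ α - dhLow h φ t μ α β)

/-- The measure `√|det h_{αβ}| dt¹⋯dtᵖ` on the domain of the chart `φ`, extended by zero to `T`. -/
def chartVolume [MeasurableSpace T] (h : SemiRiemannianMetric p T) (φ : LChart p T) :
    Measure T :=
  (((volume : Measure (Rn p)).restrict φ.target).withDensity
    fun t => ENNReal.ofReal (Real.sqrt |(hLow h φ t).det|)).map φ.symm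

/-- The volume measure `√|h| dt¹⋯dtᵖ` of `(T,h)`: the least measure that dominates
`√|det h_{αβ}| dt¹⋯dtᵖ` on the domain of every chart. By the change of variables formula these
local measures agree on overlaps, so this is the measure that restricts to each of them. -/
def volumeMeasure [MeasurableSpace T] (h : SemiRiemannianMetric p T) : Measure T :=
  ⨆ φ : smoothCharts p T, chartVolume h (φ : LChart p T)

end Temporal

/-! ### The first jet bundle and its coordinates -/

/-- The bundle `J¹(T,M)`: triples of `t ∈ T`, `x ∈ M` and a linear map `T_tT → T_xM`. -/
structure Jet (p n : ℕ) (T M : Type*) [TopologicalSpace T] [ChartedSpace (Rn p) T]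
    [TopologicalSpace M] [ChartedSpace (Rn n) M] where
  time : T
  point : M
  lin : TangentSpace (𝓡 p) time →L[ℝ] TangentSpace (𝓡 n) point

/-- The space of the coordinates `(t^α, x^i, x^i_α)`. -/
abbrev JCoord (p n : ℕ) := Rn p × Rn n × (Fin n → Fin p → ℝ)

/-- The linear map `ℝᵖ → ℝⁿ` with the matrix `y = (x^i_α)`. -/
def matLin {p n : ℕ} (y : Fin n → Fin p → ℝ) : Rn p →L[ℝ] Rn n :=
  LinearMap.toContinuousLinearMap (Matrix.toEuclideanLin (Matrix.of y))

section Partial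

variable {p n : ℕ}

/-- `∂F/∂t^α`. -/
def dT (α : Fin p) (F : JCoord p n → ℝ) (q : JCoord p n) : ℝ :=
  fderiv ℝ F q (stdVec α, 0, 0)

/-- `∂F/∂x^i`. -/
def dX (i : Fin n) (F : JCoord p n → ℝ) (q : JCoord p n) : ℝ :=
  fderiv ℝ F q (0, stdVec i, 0)

/-- `∂F/∂x^i_α`. -/
def dV (i : Fin n) (α : Fin p) (F : JCoord p n → ℝ) (q : JCoord p n) : ℝ :=
  fderiv ℝ F q (0, 0, Pi.single i (Pi.single α 1))

/-- The point `(t^α, x^i, 0)` below `(t^α, x^i, x^i_α)`. -/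
def zeroJet (q : JCoord p n) : JCoord p n := (q.1, q.2.1, 0)

end Partial

variable {p n : ℕ} {T M : Type*} [TopologicalSpace T] [ChartedSpace (Rn p) T]
  [TopologicalSpace M] [ChartedSpace (Rn n) M]

/-- The range of the coordinates `(t^α, x^i, x^i_α)` over the charts `φ` of `T` and `ψ` of `M`. -/
def jetDomain (φ : LChart p T) (ψ : LChart n M) : Set (JCoord p n) :=
  {q | q.1 ∈ φ.target ∧ q.2.1 ∈ ψ.target}

/-- The jet with the coordinates `q = (t^α, x^i, x^i_α)`. -/
def jetOfCoord (φ : LChart p T) (ψ : LChart n M) (q : JCoord p n) : Jet p n T M where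
  time := φ.symm q.1
  point := ψ.symm q.2.1
  lin := ((mfderiv (𝓡 n) (𝓡 n) ψ.symm q.2.1 : Rn n →L[ℝ] TangentSpace (𝓡 n) (ψ.symm q.2.1)).comp
    (matLin q.2.2)).comp
      (mfderiv (𝓡 p) (𝓡 p) φ (φ.symm q.1) : TangentSpace (𝓡 p) (φ.symm q.1) →L[ℝ] Rn p)

/-- The change of coordinates on `J¹(T,M)`:
`x̃^k_γ = (∂x̃^k/∂x^j) (∂t^α/∂t̃^γ) x^j_α`. -/
def jetTransition (φ : LChart p T) (ψ : LChart n M) (φ' : LChart p T) (ψ' : LChart n M)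
    (q : JCoord p n) : JCoord p n :=
  (φ' (φ.symm q.1), ψ' (ψ.symm q.2.1), fun k γ => ∑ j, ∑ α,
    coordJac ψ ψ' q.2.1 k j * coordJac φ' φ (φ' (φ.symm q.1)) α γ * q.2.2 j α)

/-- The coordinate range of the overlap of two pairs of charts, in the first pair. -/
def jetOverlap (φ : LChart p T) (ψ : LChart n M) (φ' : LChart p T) (ψ' : LChart n M) :
    Set (JCoord p n) :=
  {q | q ∈ jetDomain φ ψ ∧ φ.symm q.1 ∈ φ'.source ∧ ψ.symm q.2.1 ∈ ψ'.source}

/-- The `1`-jet of the map `f : T → M` at the point `t`. -/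
def jetProlong (p n : ℕ) {T M : Type*} [TopologicalSpace T] [ChartedSpace (Rn p) T]
    [TopologicalSpace M] [ChartedSpace (Rn n) M] (f : T → M) (t : T) : Jet p n T M :=
  ⟨t, f t, mfderiv (𝓡 p) (𝓡 n) f t⟩

/-! ### Kronecker `h`-regular Lagrangian functions -/

/-- The local expression `L(t^α, x^i, x^i_α)` of a function on `J¹(T,M)`. -/
def locL (L : Jet p n T M → ℝ) (φ : LChart p T) (ψ : LChart n M) (q : JCoord p n) : ℝ :=
  L (jetOfCoord φ ψ q)

/-- Smooth functions on `J¹(T,M)`. -/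
def IsSmoothOnJets (L : Jet p n T M → ℝ) : Prop :=
  ∀ φ ∈ smoothCharts p T, ∀ ψ ∈ smoothCharts n M,
    ContDiffOn ℝ ∞ (locL L φ ψ) (jetDomain φ ψ)

/-- d-tensors `g_{ij}(t^γ, x^k, x^k_γ)` on `J¹(T,M)` that are symmetric, of rank `n` and of
constant signature. -/
structure SpatialDMetric (p n : ℕ) (T M : Type*) [TopologicalSpace T] [ChartedSpace (Rn p) T]
    [TopologicalSpace M] [ChartedSpace (Rn n) M] where
  form : ∀ J : Jet p n T M, LinearMap.BilinForm ℝ (TangentSpace (𝓡 n) J.point)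
  symm : ∀ J v w, form J v w = form J w v
  nondeg : ∀ J v, (∀ w, form J v w = 0) → v = 0
  constIndex : ∃ ν : ℕ, ∀ J, sigNeg (form J).toQuadraticMap = ν
  smooth : ∀ φ ∈ smoothCharts p T, ∀ ψ ∈ smoothCharts n M, ∀ i j : Fin n,
    ContDiffOn ℝ ∞ (fun q => form (jetOfCoord φ ψ q)
      (coordVec ψ q.2.1 i) (coordVec ψ q.2.1 j)) (jetDomain φ ψ)

/-- The matrix `g_{ij}(t^γ, x^k, x^k_γ)`. -/
def gLow (g : SpatialDMetric p n T M) (φ : LChart p T) (ψ : LChart n M) (q : JCoord p n) :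
    Matrix (Fin n) (Fin n) ℝ :=
  Matrix.of fun i j => g.form (jetOfCoord φ ψ q) (coordVec ψ q.2.1 i) (coordVec ψ q.2.1 j)

/-- The inverse matrix `g^{ij}`. -/
def gUp (g : SpatialDMetric p n T M) (φ : LChart p T) (ψ : LChart n M) (q : JCoord p n) :
    Matrix (Fin n) (Fin n) ℝ := (gLow g φ ψ q)⁻¹

/-- `L` is a Kronecker `h`-regular Lagrangian function with spatial d-metric `g`:
`½ ∂²L/∂x^i_α∂x^j_β = h^{αβ} g_{ij}` in all coordinates. -/
structure IsKroneckerRegular (h : SemiRiemannianMetric p T) (g : SpatialDMetric p n T M)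
    (L : Jet p n T M → ℝ) : Prop where
  smooth : IsSmoothOnJets L
  regular : ∀ φ ∈ smoothCharts p T, ∀ ψ ∈ smoothCharts n M, ∀ q ∈ jetDomain φ ψ,
    ∀ (i j : Fin n) (α β : Fin p),
      1 / 2 * dV i α (dV j β (locL L φ ψ)) q = hUp h φ q.1 α β * gLow g φ ψ q i j

/-! ### The energy functional and its extremals -/

/-- `E_L(f) = ∫_T L(t^α, x^i, x^i_α) √|h| dt¹⋯dtᵖ`. -/
def energy [MeasurableSpace T] (h : SemiRiemannianMetric p T) (L : Jet p n T M → ℝ)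
    (f : T → M) : ℝ :=
  ∫ t, L (jetProlong p n f t) ∂(volumeMeasure h)

/-- Extremals (critical points) of `E_L`: the first variation vanishes for every smooth
one-parameter variation of `f`. -/
def IsExtremal [MeasurableSpace T] (h : SemiRiemannianMetric p T) (L : Jet p n T M → ℝ)
    (f : T → M) : Prop :=
  ContMDiff (𝓡 p) (𝓡 n) ∞ f ∧
  ∀ F : ℝ × T → M, ContMDiff (𝓘(ℝ).prod (𝓡 p)) (𝓡 n) ∞ F → (∀ t, F (0, t) = f t) →
    HasDerivAt (fun s : ℝ => energy h L fun t => F (s, t)) 0 0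

/-! ### Sprays, nonlinear connections, harmonic maps -/

/-- Systems of local components `(i) (α) β ↦ A^{(i)}_{(α)β}` on all coordinate domains of
`J¹(T,M)`. -/
abbrev LocalTT (p n : ℕ) (T M : Type*) [TopologicalSpace T] [TopologicalSpace M] :=
  LChart p T → LChart n M → JCoord p n → Fin n → Fin p → Fin p → ℝ

/-- Systems of local components `(i) (α) j ↦ A^{(i)}_{(α)j}` on all coordinate domains of
`J¹(T,M)`. -/
abbrev LocalTX (p n : ℕ) (T M : Type*) [TopologicalSpace T] [TopologicalSpace M] :=
  LChart p T → LChart n M → JCoord p n → Fin n → Fin p → Fin n → ℝ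

/-- Temporal sprays: smooth components with the transformation law
`2H̃^{(k)}_{(γ)β} = 2H^{(j)}_{(α)μ} (∂t^α/∂t̃^γ) (∂t^μ/∂t̃^β) (∂x̃^k/∂x^j)
  - (∂t^μ/∂t̃^β) (∂x̃^k_γ/∂t^μ)`. -/
def IsTemporalSpray (H : LocalTT p n T M) : Prop :=
  (∀ φ ∈ smoothCharts p T, ∀ ψ ∈ smoothCharts n M, ∀ i α β,
    ContDiffOn ℝ ∞ (fun q => H φ ψ q i α β) (jetDomain φ ψ)) ∧
  ∀ φ ∈ smoothCharts p T, ∀ ψ ∈ smoothCharts n M,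
  ∀ φ' ∈ smoothCharts p T, ∀ ψ' ∈ smoothCharts n M,
  ∀ q ∈ jetOverlap φ ψ φ' ψ', ∀ (k : Fin n) (γ β : Fin p),
    2 * H φ' ψ' (jetTransition φ ψ φ' ψ' q) k γ β =
      (∑ j, ∑ α, ∑ μ, 2 * H φ ψ q j α μ * coordJac φ' φ (φ' (φ.symm q.1)) α γ *
        coordJac φ' φ (φ' (φ.symm q.1)) μ β * coordJac ψ ψ' q.2.1 k j)
      - ∑ μ, coordJac φ' φ (φ' (φ.symm q.1)) μ β *
          dT μ (fun r => (jetTransition φ ψ φ' ψ' r).2.2 k γ) q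

/-- Spatial sprays: smooth components with the transformation law
`2G̃^{(k)}_{(γ)β} = 2G^{(j)}_{(α)μ} (∂t^α/∂t̃^γ) (∂t^μ/∂t̃^β) (∂x̃^k/∂x^j)
  - (∂x^i/∂x̃^j) (∂x̃^k_γ/∂x^i) x̃^j_β`. -/
def IsSpatialSpray (G : LocalTT p n T M) : Prop :=
  (∀ φ ∈ smoothCharts p T, ∀ ψ ∈ smoothCharts n M, ∀ i α β,
    ContDiffOn ℝ ∞ (fun q => G φ ψ q i α β) (jetDomain φ ψ)) ∧
  ∀ φ ∈ smoothCharts p T, ∀ ψ ∈ smoothCharts n M,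
  ∀ φ' ∈ smoothCharts p T, ∀ ψ' ∈ smoothCharts n M,
  ∀ q ∈ jetOverlap φ ψ φ' ψ', ∀ (k : Fin n) (γ β : Fin p),
    2 * G φ' ψ' (jetTransition φ ψ φ' ψ' q) k γ β =
      (∑ j, ∑ α, ∑ μ, 2 * G φ ψ q j α μ * coordJac φ' φ (φ' (φ.symm q.1)) α γ *
        coordJac φ' φ (φ' (φ.symm q.1)) μ β * coordJac ψ ψ' q.2.1 k j)
      - ∑ i, ∑ j, coordJac ψ' ψ (ψ' (ψ.symm q.2.1)) i j *
          dX i (fun r => (jetTransition φ ψ φ' ψ' r).2.2 k γ) q *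
          (jetTransition φ ψ φ' ψ' q).2.2 j β

/-- Nonlinear connections on `J¹(T,M)`: smooth components `M^{(i)}_{(α)β}`, `N^{(i)}_{(α)j}` with
`M̃^{(j)}_{(β)μ} ∂t̃^μ/∂t^α = M^{(k)}_{(γ)α} (∂x̃^j/∂x^k) (∂t^γ/∂t̃^β) - ∂x̃^j_β/∂t^α` and
`Ñ^{(j)}_{(β)k} ∂x̃^k/∂x^i = N^{(k)}_{(γ)i} (∂x̃^j/∂x^k) (∂t^γ/∂t̃^β) - ∂x̃^j_β/∂x^i`,
that is, such that `δx^i_α = dx^i_α + M^{(i)}_{(α)β} dt^β + N^{(i)}_{(α)j} dx^j` transforms as a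
d-tensor. -/
def IsNonlinearConnection (Mc : LocalTT p n T M) (Nc : LocalTX p n T M) : Prop :=
  (∀ φ ∈ smoothCharts p T, ∀ ψ ∈ smoothCharts n M,
    (∀ i α β, ContDiffOn ℝ ∞ (fun q => Mc φ ψ q i α β) (jetDomain φ ψ)) ∧
    (∀ i α j, ContDiffOn ℝ ∞ (fun q => Nc φ ψ q i α j) (jetDomain φ ψ))) ∧
  ∀ φ ∈ smoothCharts p T, ∀ ψ ∈ smoothCharts n M,
  ∀ φ' ∈ smoothCharts p T, ∀ ψ' ∈ smoothCharts n M,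
  ∀ q ∈ jetOverlap φ ψ φ' ψ', ∀ (j : Fin n) (β : Fin p),
    (∀ α : Fin p,
      ∑ μ, Mc φ' ψ' (jetTransition φ ψ φ' ψ' q) j β μ * coordJac φ φ' q.1 μ α =
        (∑ k, ∑ γ, Mc φ ψ q k γ α * coordJac ψ ψ' q.2.1 j k *
          coordJac φ' φ (φ' (φ.symm q.1)) γ β)
        - dT α (fun r => (jetTransition φ ψ φ' ψ' r).2.2 j β) q) ∧
    (∀ i : Fin n,
      ∑ k, Nc φ' ψ' (jetTransition φ ψ φ' ψ' q) j β k * coordJac ψ ψ' q.2.1 k i =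
        (∑ k, ∑ γ, Nc φ ψ q k γ i * coordJac ψ ψ' q.2.1 j k *
          coordJac φ' φ (φ' (φ.symm q.1)) γ β)
        - dX i (fun r => (jetTransition φ ψ φ' ψ' r).2.2 j β) q)

/-- The local expression `t ↦ x^i(t)` of `f`. -/
def locMap (φ : LChart p T) (ψ : LChart n M) (f : T → M) (i : Fin n) (t : Rn p) : ℝ :=
  (ψ (f (φ.symm t))) i

/-- `x^i_α = ∂x^i/∂t^α`. -/
def locMap1 (φ : LChart p T) (ψ : LChart n M) (f : T → M) (i : Fin n) (α : Fin p)
    (t : Rn p) : ℝ :=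
  fderiv ℝ (locMap φ ψ f i) t (stdVec α)

/-- `x^i_{αβ} = ∂²x^i/∂t^α∂t^β`. -/
def locMap2 (φ : LChart p T) (ψ : LChart n M) (f : T → M) (i : Fin n) (α β : Fin p)
    (t : Rn p) : ℝ :=
  fderiv ℝ (locMap1 φ ψ f i β) t (stdVec α)

/-- The coordinates `(t^α, x^i(t), x^i_α(t))` of the `1`-jet of `f`. -/
def locJet (φ : LChart p T) (ψ : LChart n M) (f : T → M) (t : Rn p) : JCoord p n :=
  (t, ψ (f (φ.symm t)), fun i α => locMap1 φ ψ f i α t)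

/-- Harmonic maps of the spray `(H,G)` with respect to `h`: smooth maps with
`h^{αβ} (x^i_{αβ} + 2G^{(i)}_{(α)β} + 2H^{(i)}_{(α)β}) = 0` in all coordinates. -/
def IsHarmonicMapOfSpray (h : SemiRiemannianMetric p T) (H G : LocalTT p n T M)
    (f : T → M) : Prop :=
  ContMDiff (𝓡 p) (𝓡 n) ∞ f ∧
  ∀ φ ∈ smoothCharts p T, ∀ ψ ∈ smoothCharts n M, ∀ t ∈ φ.target, f (φ.symm t) ∈ ψ.source →
    ∀ i : Fin n, ∑ α, ∑ β, hUp h φ t α β *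
      (locMap2 φ ψ f i α β t + 2 * G φ ψ (locJet φ ψ f t) i α β
        + 2 * H φ ψ (locJet φ ψ f t) i α β) = 0

/-! ### The canonical spray and the canonical nonlinear connection -/

/-- `H^{(i)}_{(α)β} = -½ H^γ_{αβ} x^i_γ`. -/
def canonicalH (h : SemiRiemannianMetric p T) : LocalTT p n T M :=
  fun φ _ q i α β => -(1 / 2) * ∑ γ, christoffelH h φ q.1 γ α β * q.2.2 i γ

/-- The generalized Christoffel symbols `Γ^l_{jk}` of `g_{ij}`. -/
def christoffelG (g : SpatialDMetric p n T M) (φ : LChart p T) (ψ : LChart n M)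
    (q : JCoord p n) (l j k : Fin n) : ℝ :=
  ∑ i, gUp g φ ψ q l i / 2 *
    (dX k (fun r => gLow g φ ψ r i j) q + dX j (fun r => gLow g φ ψ r i k) q
      - dX i (fun r => gLow g φ ψ r j k) q)

/-- The coefficient `U^{(α)}_{(i)}(t,x)` of `x^i_α` in `L`. -/
def potU (L : Jet p n T M → ℝ) (φ : LChart p T) (ψ : LChart n M) (α : Fin p) (i : Fin n)
    (q : JCoord p n) : ℝ :=
  dV i α (locL L φ ψ) (zeroJet q)

/-- The term `F(t,x)` of `L` of degree zero in the `x^i_α`. -/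
def potF (L : Jet p n T M → ℝ) (φ : LChart p T) (ψ : LChart n M) (q : JCoord p n) : ℝ :=
  locL L φ ψ (zeroJet q)

/-- `U^{(α)}_{(i)j} = ∂U^{(α)}_{(i)}/∂x^j - ∂U^{(α)}_{(j)}/∂x^i`. -/
def curlU (L : Jet p n T M → ℝ) (φ : LChart p T) (ψ : LChart n M) (q : JCoord p n)
    (α : Fin p) (i j : Fin n) : ℝ :=
  dX j (potU L φ ψ α i) q - dX i (potU L φ ψ α j) q

/-- `𝒯^l`, where `2𝒯^l = ½ g^{li} (2 h^{αβ} (∂g_{ij}/∂t^α) x^j_β + U^{(α)}_{(i)j} x^j_α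
  + ∂U^{(α)}_{(i)}/∂t^α + U^{(α)}_{(i)} H^γ_{αγ} - ∂F/∂x^i)`. -/
def traceT (h : SemiRiemannianMetric p T) (g : SpatialDMetric p n T M) (L : Jet p n T M → ℝ)
    (φ : LChart p T) (ψ : LChart n M) (q : JCoord p n) (l : Fin n) : ℝ :=
  1 / 2 * ∑ i, gUp g φ ψ q l i / 2 *
    (2 * (∑ α, ∑ β, ∑ j, hUp h φ q.1 α β * dT α (fun r => gLow g φ ψ r i j) q * q.2.2 j β)
      + (∑ α, ∑ j, curlU L φ ψ q α i j * q.2.2 j α)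
      + (∑ α, dT α (potU L φ ψ α i) q)
      + (∑ α, ∑ γ, potU L φ ψ α i q * christoffelH h φ q.1 γ α γ)
      - dX i (potF L φ ψ) q)

/-- `T^{(l)}_{(α)β} = (h_{αβ}/p) 𝒯^l`. -/
def tensorT (h : SemiRiemannianMetric p T) (g : SpatialDMetric p n T M)
    (L : Jet p n T M → ℝ) : LocalTT p n T M :=
  fun φ ψ q l α β => hLow h φ q.1 α β / (p : ℝ) * traceT h g L φ ψ q l

/-- The spatial components for `p ≥ 2`: `½ Γ^i_{jk} x^j_α x^k_β + T^{(i)}_{(α)β}`. -/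
def canonicalGMulti (h : SemiRiemannianMetric p T) (g : SpatialDMetric p n T M)
    (L : Jet p n T M → ℝ) : LocalTT p n T M :=
  fun φ ψ q i α β =>
    1 / 2 * (∑ j, ∑ k, christoffelG g φ ψ q i j k * q.2.2 j α * q.2.2 k β)
      + tensorT h g L φ ψ q i α β

/-- The spatial components for `p = 1`, where `α = β = 1` and `y^i = x^i_1`:
`(h_{11} g^{ik}/4) (∂²L/∂x^j∂y^k y^j - ∂L/∂x^k + ∂²L/∂t∂y^k + (∂L/∂y^k) H^1_{11}
  + 2 h^{11} H^1_{11} g_{kl} y^l)`. -/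
def canonicalGOne (h : SemiRiemannianMetric p T) (g : SpatialDMetric p n T M)
    (L : Jet p n T M → ℝ) : LocalTT p n T M :=
  fun φ ψ q i α β => ∑ k, hLow h φ q.1 α β * gUp g φ ψ q i k / 4 *
    ((∑ j, dX j (dV k α (locL L φ ψ)) q * q.2.2 j α)
      - dX k (locL L φ ψ) q
      + dT α (dV k α (locL L φ ψ)) q
      + dV k α (locL L φ ψ) q * christoffelH h φ q.1 α α α
      + 2 * hUp h φ q.1 α α * christoffelH h φ q.1 α α α *
          ∑ l, gLow g φ ψ q k l * q.2.2 l α)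

/-- The spatial components `G^{(i)}_{(α)β}` of the canonical spray. -/
def canonicalG (h : SemiRiemannianMetric p T) (g : SpatialDMetric p n T M)
    (L : Jet p n T M → ℝ) : LocalTT p n T M :=
  if p = 1 then canonicalGOne h g L else canonicalGMulti h g L

/-- The `h`-trace `𝒢^i = h^{αβ} G^{(i)}_{(α)β}`. -/
def hTrace (h : SemiRiemannianMetric p T) (G : LocalTT p n T M) (φ : LChart p T)
    (ψ : LChart n M) (i : Fin n) (q : JCoord p n) : ℝ :=
  ∑ α, ∑ β, hUp h φ q.1 α β * G φ ψ q i α β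

/-- Temporal components `M^{(i)}_{(α)β} = 2H^{(i)}_{(α)β}` induced by a temporal spray. -/
def inducedM (H : LocalTT p n T M) : LocalTT p n T M :=
  fun φ ψ q i α β => 2 * H φ ψ q i α β

/-- Spatial components `N^{(i)}_{(α)j} = (∂𝒢^i/∂x^j_γ) h_{αγ}`, `𝒢^i = h^{αβ} G^{(i)}_{(α)β}`,
induced by a spatial spray. -/
def inducedN (h : SemiRiemannianMetric p T) (G : LocalTT p n T M) : LocalTX p n T M :=
  fun φ ψ q i α j => ∑ γ, dV j γ (hTrace h G φ ψ i) q * hLow h φ q.1 α γ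

end MultiTime

end

open MultiTime

noncomputable section

namespace MultiTime

/-! The whole argument turns on the `h`-trace 𝒢^i of the spatial components. Write D_α = ∂/∂t^α +
x^i_α ∂/∂x^i and let `elTerm` be E_k = D_α(∂L/∂x^k_α) − ∂L/∂x^k + (∂L/∂x^k_α) H^γ_{αγ}, which is the
Euler–Lagrange covector of √|h| L, divided by √|h|, without its second derivatives. Then `traceG` is
¼ g^{ik} E_k + ½ h^{αβ} H^γ_{αβ} x^i_γ, and `hTrace_canonicalG` shows that it equals 𝒢^i for every p
≥ 1. After this identification the trace needs no distinction between p = 1 and p ≥ 2.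

Form of L. For p ≥ 2 the symmetry of the third velocity derivatives of L gives h^{αβ} ∂g_{ij}/∂x^k_γ
= h^{γβ} ∂g_{kj}/∂x^i_α. Contracting with h_{βα} for a fixed α ≠ γ makes the right side vanish
(`dV_gLow`). Hence g depends on (t,x) only, and integrating twice along rays in the velocities makes
L quadratic.

Sprays. The temporal law is the transformation law of Christoffel symbols contracted with the
velocities. For the spatial law, the invariance of L and the chain rule show that E_k is a covector
up to 2 g_{kl} times a trace of the derivatives of the new velocities (`elTerm_jetTransition`).
Raising the index, and adding the law of the Christoffel trace, gives the law of 𝒢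
(`traceG_jetTransition`). If p = 1, then G is h_{11} 𝒢 and the law of G follows. If p ≥ 2, the
absence of velocities in g makes Γ transform as a linear connection, so the Γ part of G carries the
whole inhomogeneous term. Its trace can be subtracted from 𝒢, and what remains, 𝒯, is a d-vector.

Nonlinear connection. The law of 𝒢 is an identity on entire velocity fibres and its inhomogeneous
term is quadratic there. Differentiating it in x^i_ε and lowering with h gives the law of N
(`inducedN_jetTransition`). The explicit formula for p ≥ 2 is the derivative of a quadratic
polynomial (`dV_hTrace`).

Extremals. Variations supported in one pair of charts, integration by parts and the fundamental
lemma of the calculus of variations give E_k + 2 g_{kj} h^{αβ} x^j_{αβ} = 0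
(`IsExtremal.elTerm_eq`). Raising the index turns this into the equation of harmonic maps. The
energy can be computed in coordinates because the volume measure restricts to √|h| dt on each chart
domain (`volumeMeasure_restrict_source`). -/

theorem two_le_infty : (2 : WithTop ℕ∞) ≤ ∞ := WithTop.coe_le_coe.2 le_top

theorem one_add_one_le_infty : (1 + 1 : WithTop ℕ∞) ≤ ∞ :=
  one_add_one_eq_two (R := WithTop ℕ∞) ▸ two_le_infty

/-! ### Changes of charts, their Jacobians and second derivatives. -/

section Charts

variable {m : ℕ} {X : Type*} [TopologicalSpace X]

/-- The coordinate range of the overlap of two charts. -/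
def transDom (e e' : LChart m X) : Set (Rn m) := {u | u ∈ e.target ∧ e.symm u ∈ e'.source}

theorem isOpen_transDom (e e' : LChart m X) : IsOpen (transDom e e') :=
  e.isOpen_inter_preimage_symm e'.open_source

theorem trans_mem {e e' : LChart m X} {u : Rn m} (hu : u ∈ transDom e e') :
    e' (e.symm u) ∈ transDom e' e :=
  ⟨e'.map_source hu.2, by rw [e'.left_inv hu.2]; exact e.map_target hu.1⟩

theorem symm_trans {e e' : LChart m X} {u : Rn m} (hu : u ∈ transDom e e') :
    e'.symm (e' (e.symm u)) = e.symm u := e'.left_inv hu.2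

theorem trans_trans {e e' : LChart m X} {u : Rn m} (hu : u ∈ transDom e e') :
    e (e'.symm (e' (e.symm u))) = u := by rw [symm_trans hu, e.right_inv hu.1]

theorem sum_smul_stdVec (u : Rn m) : ∑ a, u a • stdVec a = u := by
  ext i
  simp [stdVec, Pi.single_apply]

@[simp] theorem stdVec_apply (a b : Fin m) : (stdVec a : Rn m) b = if b = a then 1 else 0 := by
  simp [stdVec]

theorem map_eq_sum_stdVec {F : Type*} [NormedAddCommGroup F] [NormedSpace ℝ F]
    (A : Rn m →L[ℝ] F) (u : Rn m) : A u = ∑ a, u a • A (stdVec a) := by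
  conv_lhs => rw [← sum_smul_stdVec u]
  simp

theorem fderiv_trans_apply {e e' : LChart m X} (u v : Rn m) (b : Fin m) :
    fderiv ℝ (fun v => e' (e.symm v)) u v b = ∑ a, coordJac e e' u b a * v a := by
  rw [map_eq_sum_stdVec]
  simp [coordJac, mul_comm]

theorem fderiv_trans_stdVec {e e' : LChart m X} (u : Rn m) (a : Fin m) :
    fderiv ℝ (fun v => e' (e.symm v)) u (stdVec a) = ∑ b, coordJac e e' u b a • stdVec b := by
  rw [← sum_smul_stdVec (fderiv ℝ (fun v => e' (e.symm v)) u (stdVec a))]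
  rfl

variable [ChartedSpace (Rn m) X]

theorem contDiffOn_trans {e e' : LChart m X}
    (he : e ∈ smoothCharts m X) (he' : e' ∈ smoothCharts m X) :
    ContDiffOn ℝ ∞ (fun v => e' (e.symm v)) (transDom e e') := by
  rw [← contMDiffOn_iff_contDiffOn]
  exact (contMDiffOn_of_mem_maximalAtlas he').comp
    ((contMDiffOn_symm_of_mem_maximalAtlas he).mono fun u hu => hu.1) fun u hu => hu.2

theorem contDiffAt_trans {e e' : LChart m X} (he : e ∈ smoothCharts m X)
    (he' : e' ∈ smoothCharts m X) {u : Rn m} (hu : u ∈ transDom e e') :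
    ContDiffAt ℝ ∞ (fun v => e' (e.symm v)) u :=
  (contDiffOn_trans he he').contDiffAt ((isOpen_transDom e e').mem_nhds hu)

/-- On an open set the two changes of coordinates compose to the identity, so the chain rule makes
their derivatives mutually inverse. -/
theorem fderiv_trans_comp {e e' : LChart m X} (he : e ∈ smoothCharts m X)
    (he' : e' ∈ smoothCharts m X) {u : Rn m} (hu : u ∈ transDom e e') (v : Rn m) :
    fderiv ℝ (fun v => e (e'.symm v)) (e' (e.symm u)) (fderiv ℝ (fun v => e' (e.symm v)) u v)
      = v := by
  have h1 := ((contDiffAt_trans he he' hu).differentiableAt (by simp)).hasFDerivAt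
  have h2 := ((contDiffAt_trans he' he (trans_mem hu)).differentiableAt (by simp)).hasFDerivAt
  have h3 := h2.comp u h1
  have h4 : (fun v => e (e'.symm v)) ∘ (fun v => e' (e.symm v)) =ᶠ[𝓝 u] id := by
    filter_upwards [(isOpen_transDom e e').mem_nhds hu] with w hw using trans_trans hw
  have h5 := (h3.congr_of_eventuallyEq h4.symm).unique (hasFDerivAt_id u)
  exact congrArg (fun A : Rn m →L[ℝ] Rn m => A v) h5

theorem coordJac_mul {e e' : LChart m X} (he : e ∈ smoothCharts m X)
    (he' : e' ∈ smoothCharts m X) {u : Rn m} (hu : u ∈ transDom e e') (a c : Fin m) :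
    ∑ b, coordJac e' e (e' (e.symm u)) a b * coordJac e e' u b c = if a = c then 1 else 0 := by
  have := congrArg (fun w : Rn m => w a) (fderiv_trans_comp he he' hu (stdVec c))
  simp only [fderiv_trans_apply, stdVec_apply] at this
  rw [← this]
  simp

theorem coordJac_mul' {e e' : LChart m X} (he : e ∈ smoothCharts m X)
    (he' : e' ∈ smoothCharts m X) {u : Rn m} (hu : u ∈ transDom e e') (a c : Fin m) :
    ∑ b, coordJac e e' u a b * coordJac e' e (e' (e.symm u)) b c = if a = c then 1 else 0 := by
  have := coordJac_mul he' he (trans_mem hu) a c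
  rwa [trans_trans hu] at this

theorem contDiffOn_coordJac {e e' : LChart m X} (he : e ∈ smoothCharts m X)
    (he' : e' ∈ smoothCharts m X) (b a : Fin m) :
    ContDiffOn ℝ ∞ (fun u => coordJac e e' u b a) (transDom e e') := by
  have h1 : ContDiffOn ℝ ∞ (fderiv ℝ (fun v => e' (e.symm v))) (transDom e e') :=
    (contDiffOn_trans he he').fderiv_of_isOpen (isOpen_transDom e e') (by simp)
  have h2 : ContDiffOn ℝ ∞ (fun u => fderiv ℝ (fun v => e' (e.symm v)) u (stdVec a))
    (transDom e e') := h1.clm_apply contDiffOn_const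
  exact (contDiffOn_euclidean.1 h2) b

theorem differentiableAt_coordJac {e e' : LChart m X} (he : e ∈ smoothCharts m X)
    (he' : e' ∈ smoothCharts m X) {u : Rn m} (hu : u ∈ transDom e e') (b a : Fin m) :
    DifferentiableAt ℝ (fun u => coordJac e e' u b a) u :=
  ((contDiffOn_coordJac he he' b a).contDiffAt
    ((isOpen_transDom e e').mem_nhds hu)).differentiableAt (by simp)

/-- Both sides are values of the second derivative of one change of coordinates, which is a
symmetric bilinear map. The Christoffel laws rely on this symmetry of the inhomogeneous terms. -/
theorem fderiv_coordJac_comm {e e' : LChart m X} (he : e ∈ smoothCharts m X)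
    (he' : e' ∈ smoothCharts m X) {u : Rn m} (hu : u ∈ transDom e e') (b a c : Fin m) :
    fderiv ℝ (fun u => coordJac e e' u b a) u (stdVec c)
      = fderiv ℝ (fun u => coordJac e e' u b c) u (stdVec a) := by
  set f := fun v => e' (e.symm v) with hf
  have h0 : ContDiffAt ℝ ∞ f u := contDiffAt_trans he he' hu
  have h1 : DifferentiableAt ℝ (fderiv ℝ f) u :=
    (h0.fderiv_right (m := 1) one_add_one_le_infty).differentiableAt (by simp)
  have key : ∀ a c : Fin m, fderiv ℝ (fun u => coordJac e e' u b a) u (stdVec c)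
      = fderiv ℝ (fderiv ℝ f) u (stdVec c) (stdVec a) b := by
    intro a c
    have h2 : HasFDerivAt (fun w => fderiv ℝ f w (stdVec a))
        ((fderiv ℝ (fderiv ℝ f) u).flip (stdVec a)) u := by
      simpa using h1.hasFDerivAt.clm_apply (hasFDerivAt_const (stdVec a) u)
    have h3 := (EuclideanSpace.proj b : Rn m →L[ℝ] ℝ).hasFDerivAt.comp u h2
    have h4 : HasFDerivAt (fun u => coordJac e e' u b a) _ u := h3
    rw [h4.fderiv]
    rfl
  rw [key, key]
  have := (h0.isSymmSndFDerivAt (by simpa using two_le_infty)).eq (stdVec a) (stdVec c)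
  rw [this]

/-- The derivative of the inverse of a chart as a linear map of `ℝᵐ`. -/
def dsymm (e : LChart m X) (u : Rn m) : Rn m →L[ℝ] Rn m := mfderiv (𝓡 m) (𝓡 m) e.symm u

/-- The derivative of a chart as a linear map of `ℝᵐ`. -/
def dchart (e : LChart m X) (x : X) : Rn m →L[ℝ] Rn m := mfderiv (𝓡 m) (𝓡 m) e x

theorem mdifferentiable_of_mem_smoothCharts {e : LChart m X} (he : e ∈ smoothCharts m X) :
    e.MDifferentiable (𝓡 m) (𝓡 m) :=
  ⟨(contMDiffOn_of_mem_maximalAtlas he).mdifferentiableOn (by simp),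
    (contMDiffOn_symm_of_mem_maximalAtlas he).mdifferentiableOn (by simp)⟩

theorem dchart_dsymm {e : LChart m X} (he : e ∈ smoothCharts m X) {u : Rn m}
    (hu : u ∈ e.target) : (dchart e (e.symm u)).comp (dsymm e u) = ContinuousLinearMap.id ℝ _ :=
  (mdifferentiable_of_mem_smoothCharts he).comp_symm_deriv hu

theorem dsymm_dchart {e : LChart m X} (he : e ∈ smoothCharts m X) {u : Rn m}
    (hu : u ∈ e.target) : (dsymm e u).comp (dchart e (e.symm u)) = ContinuousLinearMap.id ℝ _ := by
  have := (mdifferentiable_of_mem_smoothCharts he).symm_comp_deriv (e.map_target hu)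
  rw [e.right_inv hu] at this
  exact this

/-- Chain rule for a composition that agrees with `e.symm` near `u`. Unlike `mfderiv`, `dsymm` has a
type that does not mention the base point, so points may be rewritten freely. -/
theorem dsymm_trans {e e' : LChart m X} (he : e ∈ smoothCharts m X)
    (he' : e' ∈ smoothCharts m X) {u : Rn m} (hu : u ∈ transDom e e') :
    dsymm e u = (dsymm e' (e' (e.symm u))).comp (fderiv ℝ (fun v => e' (e.symm v)) u) := by
  have h1 : MDifferentiableAt (𝓡 m) (𝓡 m) e'.symm (e' (e.symm u)) :=
    (mdifferentiable_of_mem_smoothCharts he').symm.mdifferentiableAt (trans_mem hu).1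
  have h2 : MDifferentiableAt (𝓡 m) (𝓡 m) (fun v => e' (e.symm v)) u :=
    ((contDiffAt_trans he he' hu).differentiableAt (by simp)).mdifferentiableAt
  have h3 := mfderiv_comp u h1 h2
  have h4 : e'.symm ∘ (fun v => e' (e.symm v)) =ᶠ[𝓝 u] e.symm := by
    filter_upwards [(isOpen_transDom e e').mem_nhds hu] with w hw using symm_trans hw
  rw [h4.mfderiv_eq, mfderiv_eq_fderiv] at h3
  exact h3

theorem dsymm_stdVec_trans {e e' : LChart m X} (he : e ∈ smoothCharts m X)
    (he' : e' ∈ smoothCharts m X) {u : Rn m} (hu : u ∈ transDom e e') (a : Fin m) :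
    dsymm e u (stdVec a) = ∑ b, coordJac e e' u b a • dsymm e' (e' (e.symm u)) (stdVec b) := by
  rw [dsymm_trans he he' hu]
  simp [fderiv_trans_stdVec]

/-- Follows from `dsymm_trans` by inverting both sides, without a second use of the chain rule on
the manifold. -/
theorem dchart_trans {e e' : LChart m X} (he : e ∈ smoothCharts m X)
    (he' : e' ∈ smoothCharts m X) {u : Rn m} (hu : u ∈ transDom e e') :
    dchart e' (e.symm u) = (fderiv ℝ (fun v => e' (e.symm v)) u).comp (dchart e (e.symm u)) := by
  have h1 := dchart_dsymm he' (trans_mem hu).1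
  rw [symm_trans hu] at h1
  have h2 := dsymm_dchart he hu.1
  rw [dsymm_trans he he' hu] at h2
  calc dchart e' (e.symm u) = (dchart e' (e.symm u)).comp (((dsymm e' (e' (e.symm u))).comp
        (fderiv ℝ (fun v => e' (e.symm v)) u)).comp (dchart e (e.symm u))) := by rw [h2]; rfl
    _ = ((dchart e' (e.symm u)).comp (dsymm e' (e' (e.symm u)))).comp
        ((fderiv ℝ (fun v => e' (e.symm v)) u).comp (dchart e (e.symm u))) := rfl
    _ = _ := by rw [h1]; rfl

end Charts

/-! ### Derivatives of determinants and inverse matrices. -/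

section MatrixCalculus

variable {m : ℕ} {E : Type*} [NormedAddCommGroup E] [NormedSpace ℝ E]

theorem contDiffOn_det {G : E → Matrix (Fin m) (Fin m) ℝ} {s : Set E}
    (hG : ∀ a b, ContDiffOn ℝ ∞ (fun u => G u a b) s) : ContDiffOn ℝ ∞ (fun u => (G u).det) s := by
  simp only [Matrix.det_apply']
  exact ContDiffOn.sum fun σ _ => contDiffOn_const.mul (contDiffOn_prod fun i _ => hG _ _)

/-- Cramer's rule: an entry of the inverse is the reciprocal determinant times the determinant of
the matrix with one row replaced by a constant unit row. -/
theorem contDiffOn_inv_apply {G : E → Matrix (Fin m) (Fin m) ℝ} {s : Set E}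
    (hG : ∀ a b, ContDiffOn ℝ ∞ (fun u => G u a b) s) (hd : ∀ u ∈ s, (G u).det ≠ 0)
    (a b : Fin m) : ContDiffOn ℝ ∞ (fun u => (G u)⁻¹ a b) s := by
  simp only [Matrix.inv_def, Ring.inverse_eq_inv', Matrix.smul_apply, smul_eq_mul,
    Matrix.adjugate_apply]
  refine ((contDiffOn_det hG).inv hd).mul (contDiffOn_det fun c d => ?_)
  by_cases hc : c = b
  · subst hc
    simpa using contDiffOn_const
  · simpa [Matrix.updateRow_ne hc] using hG c d

theorem sum_inv_mul_apply {A : Matrix (Fin m) (Fin m) ℝ} (hA : A.det ≠ 0) (a c : Fin m) :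
    ∑ b, A⁻¹ a b * A b c = if a = c then 1 else 0 := by
  have := Matrix.nonsing_inv_mul A (isUnit_iff_ne_zero.2 hA)
  rw [← Matrix.mul_apply, this, Matrix.one_apply]

theorem det_ne_zero_of_forall_sum {A : Matrix (Fin m) (Fin m) ℝ}
    (h : ∀ v : Fin m → ℝ, (∀ b, ∑ a, v a * A a b = 0) → v = 0) : A.det ≠ 0 := by
  intro h0
  obtain ⟨v, hv, hv'⟩ := Matrix.exists_vecMul_eq_zero_iff.2 h0
  exact hv (h v fun b => congrFun hv' b)

/-- Jacobi's formula. -/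
theorem fderiv_det_apply {G : E → Matrix (Fin m) (Fin m) ℝ} {u : E}
    (hG : ∀ a b, DifferentiableAt ℝ (fun u => G u a b) u) (hd : (G u).det ≠ 0) (v : E) :
    fderiv ℝ (fun u => (G u).det) u v
      = (G u).det * ∑ a, ∑ b, (G u)⁻¹ a b * fderiv ℝ (fun w => G w b a) u v := by
  have h1 : HasFDerivAt (fun u => (G u).det)
      (∑ σ : Equiv.Perm (Fin m), ((Equiv.Perm.sign σ : ℤ) : ℝ) •
        ∑ i, (∏ j ∈ Finset.univ.erase i, G u (σ j) j) • fderiv ℝ (fun w => G w (σ i) i) u) u := by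
    simp only [Matrix.det_apply']
    refine HasFDerivAt.fun_sum fun σ _ => HasFDerivAt.const_mul ?_ _
    exact HasFDerivAt.finsetProd fun i _ => (hG _ _).hasFDerivAt
  rw [h1.fderiv]
  simp only [sum_apply, smul_apply, smul_eq_mul, Finset.mul_sum]
  rw [Finset.sum_comm]
  refine Finset.sum_congr rfl fun i _ => ?_
  -- After exchanging sums, the terms in which column `i` is differentiated form the determinant
  -- with that column replaced by its derivative. Cramer's rule evaluates it through the adjugate.
  have h2 : (Matrix.cramer (G u) (fun b => fderiv ℝ (fun w => G w b i) u v)) i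
      = ∑ b, (G u).det * ((G u)⁻¹ i b * fderiv ℝ (fun w => G w b i) u v) := by
    rw [Matrix.cramer_eq_adjugate_mulVec, Matrix.inv_def]
    simp only [Matrix.mulVec, dotProduct, Ring.inverse_eq_inv', Matrix.smul_apply, smul_eq_mul]
    refine Finset.sum_congr rfl fun b _ => ?_
    field_simp
  rw [← h2, Matrix.cramer_apply, Matrix.det_apply']
  refine Finset.sum_congr rfl fun σ _ => ?_
  rw [← Finset.mul_prod_erase Finset.univ _ (Finset.mem_univ i)]
  simp only [Matrix.updateCol_self]
  rw [mul_comm (fderiv ℝ (fun w => G w (σ i) i) u v)]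
  congr 2
  refine Finset.prod_congr rfl fun j hj => ?_
  rw [Matrix.updateCol_ne (Finset.ne_of_mem_erase hj)]

/-- Differentiate G⁻¹G = 1 and multiply by G⁻¹ on the right. The determinant must be nonzero near
the point, since the identity is differentiated. -/
theorem fderiv_inv_apply {G : E → Matrix (Fin m) (Fin m) ℝ} {u : E}
    (hG : ∀ a b, DifferentiableAt ℝ (fun u => G u a b) u)
    (hI : ∀ a b, DifferentiableAt ℝ (fun u => (G u)⁻¹ a b) u)
    (hd : ∀ᶠ w in 𝓝 u, (G w).det ≠ 0) (v : E) (a d : Fin m) :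
    fderiv ℝ (fun u => (G u)⁻¹ a d) u v
      = -∑ b, ∑ c, (G u)⁻¹ a b * fderiv ℝ (fun w => G w b c) u v * (G u)⁻¹ c d := by
  set dI : Matrix (Fin m) (Fin m) ℝ := Matrix.of fun a b => fderiv ℝ (fun u => (G u)⁻¹ a b) u v
    with hdI
  set dG : Matrix (Fin m) (Fin m) ℝ := Matrix.of fun a b => fderiv ℝ (fun u => G u a b) u v
    with hdG
  have h1 : dI * G u + (G u)⁻¹ * dG = 0 := by
    ext i j
    have h2 : HasFDerivAt (fun w => ∑ b, (G w)⁻¹ i b * G w b j)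
        (∑ b, ((G u)⁻¹ i b • fderiv ℝ (fun w => G w b j) u
          + G u b j • fderiv ℝ (fun w => (G w)⁻¹ i b) u)) u :=
      HasFDerivAt.fun_sum fun b _ => (hI i b).hasFDerivAt.mul (hG b j).hasFDerivAt
    have h3 : (fun w => ∑ b, (G w)⁻¹ i b * G w b j) =ᶠ[𝓝 u] fun _ => if i = j then 1 else 0 := by
      filter_upwards [hd] with w hw using sum_inv_mul_apply hw i j
    have h4 := (h2.congr_of_eventuallyEq h3.symm).unique (hasFDerivAt_const _ u)
    have h5 := congrArg (fun A : E →L[ℝ] ℝ => A v) h4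
    simp only [sum_apply, add_apply, smul_apply, smul_eq_mul, zero_apply] at h5
    simp only [Matrix.add_apply, Matrix.mul_apply, hdI, hdG, Matrix.of_apply, Matrix.zero_apply]
    rw [← h5, ← Finset.sum_add_distrib]
    exact Finset.sum_congr rfl fun b _ => by ring
  have h6 : dI = -((G u)⁻¹ * dG * (G u)⁻¹) := by
    have hu : G u * (G u)⁻¹ = 1 := Matrix.mul_nonsing_inv _ (isUnit_iff_ne_zero.2 hd.self_of_nhds)
    calc dI = dI * (G u * (G u)⁻¹) := by rw [hu, mul_one]
      _ = (dI * G u) * (G u)⁻¹ := by rw [mul_assoc]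
      _ = _ := by rw [eq_neg_of_add_eq_zero_left h1, neg_mul]
  have h7 := congrFun (congrFun h6 a) d
  simp only [Matrix.neg_apply, Matrix.mul_apply, Finset.sum_mul] at h7
  rw [Finset.sum_comm] at h7
  exact h7

end MatrixCalculus

/-! ### Algebra of Christoffel symbols and the derivatives they control. -/

section Christoffel

variable {m : ℕ}

/-- The derivative `∂G_{ab}/∂u^μ` of a matrix-valued function. -/
def dMat (G : Rn m → Matrix (Fin m) (Fin m) ℝ) (u : Rn m) (μ a b : Fin m) : ℝ :=
  fderiv ℝ (fun s => G s a b) u (stdVec μ)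

/-- Christoffel symbols of the first kind of an array of derivatives `∂G_{ab}/∂u^μ`. -/
def chrLow (dG : Fin m → Fin m → Fin m → ℝ) (μ a b : Fin m) : ℝ :=
  (dG a μ b + dG b μ a - dG μ a b) / 2

/-- Christoffel symbols of a matrix and an array of derivatives. -/
def chrUp (G : Matrix (Fin m) (Fin m) ℝ) (dG : Fin m → Fin m → Fin m → ℝ) (c a b : Fin m) : ℝ :=
  ∑ μ, G⁻¹ c μ * chrLow dG μ a b

theorem chrLow_comm {dG : Fin m → Fin m → Fin m → ℝ} (hs : ∀ μ a b, dG μ a b = dG μ b a)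
    (μ a b : Fin m) : chrLow dG μ a b = chrLow dG μ b a := by
  simp only [chrLow]; rw [hs μ a b]; ring

theorem chrUp_comm {G : Matrix (Fin m) (Fin m) ℝ} {dG : Fin m → Fin m → Fin m → ℝ}
    (hs : ∀ μ a b, dG μ a b = dG μ b a) (c a b : Fin m) : chrUp G dG c a b = chrUp G dG c b a := by
  simp only [chrUp, chrLow_comm hs _ a b]

/-- The metric is parallel for its own connection. This replaces derivatives of the metric by
Christoffel symbols in the derivatives of the inverse matrix and of the volume density. -/
theorem chrLow_add_chrLow {dG : Fin m → Fin m → Fin m → ℝ} (hs : ∀ μ a b, dG μ a b = dG μ b a)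
    (μ a b : Fin m) : chrLow dG a μ b + chrLow dG b μ a = dG μ a b := by
  simp only [chrLow]; rw [hs μ b a, hs b a μ, hs a b μ]; ring

/-- Pure algebra: `J` and `D` stand for the first and second derivatives of a change of coordinates.
The statement is abstract so that it serves both the metric on `T` and the matrices g_{ij} on slices
of the jet space over `M`. -/
theorem chrLow_trans {Gt : Matrix (Fin m) (Fin m) ℝ} {J : Matrix (Fin m) (Fin m) ℝ}
    {dG dGt D : Fin m → Fin m → Fin m → ℝ}
    (hGt : ∀ a b, Gt a b = Gt b a) (hD : ∀ c a b, D c a b = D c b a)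
    (hdG : ∀ μ a b, dG μ a b = (∑ ν, ∑ c, ∑ d, dGt ν c d * J ν μ * J c a * J d b)
      + ∑ c, ∑ d, Gt c d * (D c a μ * J d b + J c a * D d b μ)) (μ a b : Fin m) :
    chrLow dG μ a b = ∑ ν, J ν μ *
      ((∑ c, ∑ d, chrLow dGt ν c d * J c a * J d b) + ∑ d, Gt ν d * D d a b) := by
  -- The inhomogeneous part of each derivative of the metric is a sum of two such terms. Of the six
  -- terms in the Christoffel combination four cancel by symmetry, and two equal ones remain.
  set Eb : Fin m → Fin m → Fin m → ℝ := fun μ a b => ∑ c, ∑ d, Gt c d * J c μ * D d a b with hEb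
  have hE : ∀ μ a b, ∑ c, ∑ d, Gt c d * (D c a μ * J d b + J c a * D d b μ)
      = Eb b a μ + Eb a b μ := by
    intro μ a b
    simp only [hEb, mul_add, Finset.sum_add_distrib]
    congr 1
    · rw [Finset.sum_comm]
      refine Finset.sum_congr rfl fun c _ => Finset.sum_congr rfl fun d _ => ?_
      rw [hGt d c]; ring
    · refine Finset.sum_congr rfl fun c _ => Finset.sum_congr rfl fun d _ => ?_
      ring
  have hEs : ∀ μ a b, Eb μ a b = Eb μ b a := by
    intro μ a b
    simp only [hEb, hD _ a b]
  have h1 : ∑ ν, ∑ c, ∑ d, dGt ν c d * J ν a * J c μ * J d b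
      = ∑ ν, ∑ c, ∑ d, dGt c ν d * J ν μ * J c a * J d b := by
    rw [Finset.sum_comm]
    exact Finset.sum_congr rfl fun c _ => Finset.sum_congr rfl fun ν _ =>
      Finset.sum_congr rfl fun d _ => by ring
  have h2 : ∑ ν, ∑ c, ∑ d, dGt ν c d * J ν b * J c μ * J d a
      = ∑ ν, ∑ c, ∑ d, dGt d ν c * J ν μ * J c a * J d b := by
    rw [Finset.sum_comm]
    refine Finset.sum_congr rfl fun ν _ => ?_
    rw [Finset.sum_comm]
    exact Finset.sum_congr rfl fun c _ => Finset.sum_congr rfl fun d _ => by ring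
  have h3 : ∑ ν, J ν μ * ((∑ c, ∑ d, chrLow dGt ν c d * J c a * J d b) + ∑ d, Gt ν d * D d a b)
      = ((∑ ν, ∑ c, ∑ d, dGt c ν d * J ν μ * J c a * J d b)
        + (∑ ν, ∑ c, ∑ d, dGt d ν c * J ν μ * J c a * J d b)
        - ∑ ν, ∑ c, ∑ d, dGt ν c d * J ν μ * J c a * J d b) / 2 + Eb μ a b := by
    simp only [mul_add, Finset.sum_add_distrib]
    congr 1
    · simp only [← Finset.sum_add_distrib, ← Finset.sum_sub_distrib, Finset.sum_div,
        Finset.mul_sum, chrLow]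
      exact Finset.sum_congr rfl fun c _ => Finset.sum_congr rfl fun ν _ =>
        Finset.sum_congr rfl fun d _ => by ring
    · simp only [hEb, Finset.mul_sum]
      exact Finset.sum_congr rfl fun c _ => Finset.sum_congr rfl fun d _ => by ring
  rw [h3, chrLow, hdG, hdG, hdG, hE, hE, hE, h1, h2, hEs b a μ, hEs a b μ, hEs μ b a]
  rw [hEs b μ a, hEs a μ b]
  ring

/-- The transformation law of the Christoffel symbols. -/
theorem chrUp_trans {G Gt : Matrix (Fin m) (Fin m) ℝ} {J : Matrix (Fin m) (Fin m) ℝ}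
    {dG dGt D : Fin m → Fin m → Fin m → ℝ}
    (hGt : ∀ a b, Gt a b = Gt b a) (hD : ∀ c a b, D c a b = D c b a)
    (hdG : ∀ μ a b, dG μ a b = (∑ ν, ∑ c, ∑ d, dGt ν c d * J ν μ * J c a * J d b)
      + ∑ c, ∑ d, Gt c d * (D c a μ * J d b + J c a * D d b μ))
    (hinv : ∀ c ν, ∑ k, ∑ μ, J c k * G⁻¹ k μ * J ν μ = Gt⁻¹ c ν) (hd : Gt.det ≠ 0)
    (c a b : Fin m) :
    ∑ k, J c k * chrUp G dG k a b
      = (∑ d, ∑ e, chrUp Gt dGt c d e * J d a * J e b) + D c a b := by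
  simp only [chrUp, chrLow_trans hGt hD hdG]
  set R : Fin m → ℝ := fun ν => (∑ c, ∑ d, chrLow dGt ν c d * J c a * J d b)
    + ∑ d, Gt ν d * D d a b with hR
  -- The law of the inverse matrix absorbs `J` on both sides, leaving the new inverse applied to the
  -- new lowered symbols plus the second-derivative term.
  have h1 : ∑ k, J c k * ∑ μ, G⁻¹ k μ * ∑ ν, J ν μ * R ν = ∑ ν, Gt⁻¹ c ν * R ν := by
    simp only [← hinv, Finset.mul_sum, Finset.sum_mul]
    calc _ = ∑ k, ∑ ν, ∑ μ, J c k * (G⁻¹ k μ * (J ν μ * R ν)) :=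
          Finset.sum_congr rfl fun k _ => Finset.sum_comm
      _ = ∑ ν, ∑ k, ∑ μ, J c k * (G⁻¹ k μ * (J ν μ * R ν)) := Finset.sum_comm
      _ = _ := Finset.sum_congr rfl fun _ _ => Finset.sum_congr rfl fun _ _ =>
        Finset.sum_congr rfl fun _ _ => by ring
  rw [h1]
  simp only [hR, mul_add, Finset.sum_add_distrib]
  congr 1
  · simp only [Finset.mul_sum, Finset.sum_mul]
    rw [Finset.sum_comm]
    refine Finset.sum_congr rfl fun d _ => ?_
    rw [Finset.sum_comm]
    exact Finset.sum_congr rfl fun _ _ => Finset.sum_congr rfl fun _ _ => by ring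
  · simp only [Finset.mul_sum]
    rw [Finset.sum_comm]
    calc _ = ∑ d, (∑ ν, Gt⁻¹ c ν * Gt ν d) * D d a b := by
          simp only [Finset.sum_mul, mul_assoc]
      _ = _ := by simp [sum_inv_mul_apply hd]

/-- In matrix form G = Jᵀ G̃ J, hence G̃⁻¹ = J G⁻¹ Jᵀ. -/
theorem inv_trans {G Gt J : Matrix (Fin m) (Fin m) ℝ} (hJ : J.det ≠ 0)
    (hG : ∀ a b, G a b = ∑ c, ∑ d, Gt c d * J c a * J d b) (c ν : Fin m) :
    ∑ k, ∑ μ, J c k * G⁻¹ k μ * J ν μ = Gt⁻¹ c ν := by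
  have h1 : G = J.transpose * Gt * J := by
    ext a b
    rw [hG, Finset.sum_comm]
    simp only [Matrix.mul_apply, Matrix.transpose_apply, Finset.sum_mul]
    exact Finset.sum_congr rfl fun d _ => Finset.sum_congr rfl fun c _ => by ring
  have hu := isUnit_iff_ne_zero.2 hJ
  have h2 : J * G⁻¹ * J.transpose = Gt⁻¹ := by
    have hu' : IsUnit J.transpose.det := by rwa [Matrix.det_transpose]
    rw [h1, Matrix.mul_inv_rev, Matrix.mul_inv_rev, ← mul_assoc, Matrix.mul_nonsing_inv _ hu,
      one_mul, mul_assoc, Matrix.nonsing_inv_mul _ hu', mul_one]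
  rw [← h2]
  simp only [Matrix.mul_apply, Matrix.transpose_apply, Finset.sum_mul]
  exact Finset.sum_comm

theorem dMat_comm {G : Rn m → Matrix (Fin m) (Fin m) ℝ} (hs : ∀ u a b, G u a b = G u b a)
    (u : Rn m) (μ a b : Fin m) : dMat G u μ a b = dMat G u μ b a := by
  simp only [dMat, hs _ a b]

/-- The inverse metric is parallel as well: in −G⁻¹(∂G)G⁻¹ each derivative of the metric is a sum of
two lowered Christoffel symbols, and each of these is raised by one of the two inverse factors. -/
theorem dMat_inv_eq {G : Rn m → Matrix (Fin m) (Fin m) ℝ} {u : Rn m}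
    (hs : ∀ u a b, G u a b = G u b a)
    (hG : ∀ a b, DifferentiableAt ℝ (fun u => G u a b) u)
    (hI : ∀ a b, DifferentiableAt ℝ (fun u => (G u)⁻¹ a b) u)
    (hd : ∀ᶠ w in 𝓝 u, (G w).det ≠ 0) (μ a d : Fin m) :
    dMat (fun w => (G w)⁻¹) u μ a d = -(∑ c, chrUp (G u) (dMat G u) a μ c * (G u)⁻¹ c d)
      - ∑ b, (G u)⁻¹ a b * chrUp (G u) (dMat G u) d μ b := by
  have hsym : ∀ a b, (G u)⁻¹ a b = (G u)⁻¹ b a := by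
    intro a b
    have : (G u).transpose = G u := by ext i j; exact hs u j i
    rw [← Matrix.transpose_apply (G u)⁻¹, Matrix.transpose_nonsing_inv, this]
  rw [dMat, fderiv_inv_apply hG hI hd]
  have : ∀ b c, fderiv ℝ (fun w => G w b c) u (stdVec μ)
      = chrLow (dMat G u) b μ c + chrLow (dMat G u) c μ b :=
    fun b c => (chrLow_add_chrLow (dMat_comm hs u) μ b c).symm
  simp only [this, mul_add, add_mul, Finset.sum_add_distrib, neg_add, chrUp]
  rw [← sub_eq_add_neg]
  congr 1
  · congr 1
    simp only [Finset.sum_mul]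
    exact Finset.sum_comm
  · simp only [Finset.mul_sum]
    refine Finset.sum_congr rfl fun b _ => Finset.sum_congr rfl fun c _ => ?_
    rw [hsym c d]; ring

/-- The divergence of the inverse metric. Its first term cancels against the derivative of the
volume density in the Euler–Lagrange expression. -/
theorem sum_dMat_inv {G : Rn m → Matrix (Fin m) (Fin m) ℝ} {u : Rn m}
    (hs : ∀ u a b, G u a b = G u b a)
    (hG : ∀ a b, DifferentiableAt ℝ (fun u => G u a b) u)
    (hI : ∀ a b, DifferentiableAt ℝ (fun u => (G u)⁻¹ a b) u)
    (hd : ∀ᶠ w in 𝓝 u, (G w).det ≠ 0) (d : Fin m) :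
    ∑ a, dMat (fun w => (G w)⁻¹) u a a d
      = -(∑ a, ∑ c, (G u)⁻¹ a d * chrUp (G u) (dMat G u) c a c)
      - ∑ a, ∑ b, (G u)⁻¹ a b * chrUp (G u) (dMat G u) d a b := by
  simp only [dMat_inv_eq hs hG hI hd, Finset.sum_sub_distrib, Finset.sum_neg_distrib]
  congr 1
  congr 1
  rw [Finset.sum_comm]
  refine Finset.sum_congr rfl fun a _ => Finset.sum_congr rfl fun c _ => ?_
  rw [chrUp_comm (dMat_comm hs u), mul_comm]

/-- The logarithmic derivative of the volume density. -/
theorem fderiv_sqrt_abs_det {G : Rn m → Matrix (Fin m) (Fin m) ℝ} {u : Rn m}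
    (hs : ∀ u a b, G u a b = G u b a)
    (hG : ∀ a b, DifferentiableAt ℝ (fun u => G u a b) u) (hd : (G u).det ≠ 0) (μ : Fin m) :
    DifferentiableAt ℝ (fun u => √|(G u).det|) u ∧
    fderiv ℝ (fun u => √|(G u).det|) u (stdVec μ)
      = √|(G u).det| * ∑ c, chrUp (G u) (dMat G u) c μ c := by
  have hdet : DifferentiableAt ℝ (fun u => (G u).det) u := by
    simp only [Matrix.det_apply']
    exact DifferentiableAt.fun_sum fun σ _ =>
      (differentiableAt_const _).mul (HasFDerivAt.finsetProd fun i _ => (hG _ _).hasFDerivAt).differentiableAt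
  -- The metric may be indefinite, so the determinant may have either sign. The derivative has the
  -- same form √|x|/(2x) in both cases.
  have h1 : HasDerivAt (fun x : ℝ => √|x|) (√|(G u).det| / (2 * (G u).det)) (G u).det := by
    rcases lt_or_gt_of_ne hd with h | h
    · have h2 := (Real.hasDerivAt_sqrt (x := -(G u).det) (by linarith)).comp _
        (hasDerivAt_neg (G u).det)
      have h3 : (fun x : ℝ => √|x|) =ᶠ[𝓝 (G u).det] Real.sqrt ∘ Neg.neg := by
        filter_upwards [Iio_mem_nhds h] with x hx
        simp [abs_of_neg (mem_Iio.1 hx)]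
      refine (h2.congr_of_eventuallyEq h3).congr_deriv ?_
      rw [abs_of_neg h]
      have h4 := Real.mul_self_sqrt (show 0 ≤ -(G u).det by linarith)
      have h5 : √(-(G u).det) ≠ 0 := (Real.sqrt_pos.2 (by linarith)).ne'
      field_simp
      linarith [sq (√(-(G u).det))]
    · have h2 := Real.hasDerivAt_sqrt hd
      have h3 : (fun x : ℝ => √|x|) =ᶠ[𝓝 (G u).det] Real.sqrt := by
        filter_upwards [Ioi_mem_nhds h] with x hx
        rw [abs_of_pos (mem_Ioi.1 hx)]
      refine (h2.congr_of_eventuallyEq h3).congr_deriv ?_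
      rw [abs_of_pos h]
      have h4 := Real.mul_self_sqrt h.le
      have h5 : √((G u).det) ≠ 0 := (Real.sqrt_pos.2 h).ne'
      field_simp
      linarith [sq (√((G u).det))]
  have h2 := h1.comp_hasFDerivAt u hdet.hasFDerivAt
  refine ⟨h2.differentiableAt, ?_⟩
  have h3 : fderiv ℝ (fun u => √|(G u).det|) u = _ := h2.fderiv
  -- The two lowered symbols that make up the derivative of the metric contribute equally to the
  -- trace, because the inverse matrix is symmetric.
  have h4 : ∑ a, ∑ b, (G u)⁻¹ a b * fderiv ℝ (fun w => G w b a) u (stdVec μ)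
      = 2 * ∑ c, chrUp (G u) (dMat G u) c μ c := by
    have hsym : ∀ a b, (G u)⁻¹ a b = (G u)⁻¹ b a := by
      intro a b
      have : (G u).transpose = G u := by ext i j; exact hs u j i
      rw [← Matrix.transpose_apply (G u)⁻¹, Matrix.transpose_nonsing_inv, this]
    have : ∀ b c, fderiv ℝ (fun w => G w b c) u (stdVec μ)
        = chrLow (dMat G u) b μ c + chrLow (dMat G u) c μ b :=
      fun b c => (chrLow_add_chrLow (dMat_comm hs u) μ b c).symm
    simp only [this, mul_add, Finset.sum_add_distrib, two_mul, chrUp]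
    congr 1
    rw [Finset.sum_comm]
    exact Finset.sum_congr rfl fun b _ => Finset.sum_congr rfl fun c _ => by rw [hsym]
  rw [h3, smul_apply, fderiv_det_apply hG hd, h4, smul_eq_mul]
  field_simp

end Christoffel

/-! ### Transformation of metric matrices under changes of charts. -/

section MetricTransformation

variable {m : ℕ} {X : Type*} [TopologicalSpace X] [ChartedSpace (Rn m) X]

theorem bilin_sum_smul (B : Rn m →ₗ[ℝ] Rn m →ₗ[ℝ] ℝ) (a b : Fin m → ℝ) (w : Fin m → Rn m) :
    B (∑ c, a c • w c) (∑ d, b d • w d) = ∑ c, ∑ d, B (w c) (w d) * a c * b d := by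
  simp only [map_sum, LinearMap.sum_apply, map_smul, LinearMap.smul_apply, smul_eq_mul]
  simp only [Finset.mul_sum]
  rw [Finset.sum_comm]
  exact Finset.sum_congr rfl fun c _ => Finset.sum_congr rfl fun d _ => by ring

/-- An invertible map sends the standard basis to a basis. A coefficient vector in the left kernel
of the Gram matrix therefore gives a vector orthogonal to everything, which vanishes by
nondegeneracy. -/
theorem det_gram_ne_zero (B : Rn m →ₗ[ℝ] Rn m →ₗ[ℝ] ℝ) (hB : ∀ v, (∀ w, B v w = 0) → v = 0)
    (A A' : Rn m →L[ℝ] Rn m) (h1 : A.comp A' = ContinuousLinearMap.id ℝ _)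
    (h2 : A'.comp A = ContinuousLinearMap.id ℝ _) :
    (Matrix.of fun a b => B (A (stdVec a)) (A (stdVec b))).det ≠ 0 := by
  refine det_ne_zero_of_forall_sum fun v hv => ?_
  have h3 : ∀ u : Rn m, A u = ∑ a, u a • A (stdVec a) := map_eq_sum_stdVec A
  have h4 : A (WithLp.toLp 2 v) = 0 := by
    refine hB _ fun w => ?_
    have h5 : w = A (A' w) := (congrArg (fun C : Rn m →L[ℝ] Rn m => C w) h1).symm
    rw [h5, h3 (A' w), h3 (WithLp.toLp 2 v), bilin_sum_smul, Finset.sum_comm]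
    refine Finset.sum_eq_zero fun d _ => ?_
    rw [← Finset.sum_mul]
    have := hv d
    simp only [Matrix.of_apply] at this
    simp only [mul_comm _ (v _)]
    rw [this, zero_mul]
  have h6 : WithLp.toLp 2 v = (0 : Rn m) := by
    have := congrArg A' h4
    rw [map_zero] at this
    rw [← this]
    exact (congrArg (fun C : Rn m →L[ℝ] Rn m => C (WithLp.toLp 2 v)) h2).symm
  funext i
  exact congrArg (fun w : Rn m => w i) h6

theorem fderiv_comp_trans {F : Rn m → ℝ} {e e' : LChart m X} (he : e ∈ smoothCharts m X)
    (he' : e' ∈ smoothCharts m X) {u : Rn m} (hu : u ∈ transDom e e')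
    (hF : DifferentiableAt ℝ F (e' (e.symm u))) (μ : Fin m) :
    DifferentiableAt ℝ (fun v => F (e' (e.symm v))) u ∧
    fderiv ℝ (fun v => F (e' (e.symm v))) u (stdVec μ)
      = ∑ ν, fderiv ℝ F (e' (e.symm u)) (stdVec ν) * coordJac e e' u ν μ := by
  have h1 := hF.hasFDerivAt.comp u
    ((contDiffAt_trans he he' hu).differentiableAt (by simp)).hasFDerivAt
  refine ⟨h1.differentiableAt, ?_⟩
  have h2 : fderiv ℝ (fun v => F (e' (e.symm v))) u = _ := h1.fderiv
  rw [h2, ContinuousLinearMap.comp_apply, fderiv_trans_stdVec, map_sum]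
  exact Finset.sum_congr rfl fun ν _ => by rw [map_smul, smul_eq_mul, mul_comm]

/-- The second derivatives `∂²ũᶜ/∂uᵃ∂uᵇ` of a change of coordinates. -/
def coordHess {m : ℕ} {X : Type*} [TopologicalSpace X] (e e' : LChart m X) (u : Rn m)
    (c a b : Fin m) : ℝ :=
  fderiv ℝ (fun v => coordJac e e' v c a) u (stdVec b)

theorem coordHess_comm {e e' : LChart m X} (he : e ∈ smoothCharts m X)
    (he' : e' ∈ smoothCharts m X) {u : Rn m} (hu : u ∈ transDom e e') (c a b : Fin m) :
    coordHess e e' u c a b = coordHess e e' u c b a :=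
  fderiv_coordJac_comm he he' hu c a b

/-- Leibniz rule for the tensor law of the metric, in the shape of the derivative hypothesis of
`chrUp_trans`. The second sum holds the derivatives of the two Jacobian factors. -/
theorem dMat_trans {G Gt : Rn m → Matrix (Fin m) (Fin m) ℝ} {e e' : LChart m X}
    (he : e ∈ smoothCharts m X) (he' : e' ∈ smoothCharts m X) {u : Rn m} (hu : u ∈ transDom e e')
    (hGt : ∀ a b, DifferentiableAt ℝ (fun v => Gt v a b) (e' (e.symm u)))
    (hG : ∀ v ∈ transDom e e', ∀ a b, G v a b
      = ∑ c, ∑ d, Gt (e' (e.symm v)) c d * coordJac e e' v c a * coordJac e e' v d b)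
    (μ a b : Fin m) :
    dMat G u μ a b = (∑ ν, ∑ c, ∑ d, dMat Gt (e' (e.symm u)) ν c d * coordJac e e' u ν μ
        * coordJac e e' u c a * coordJac e e' u d b)
      + ∑ c, ∑ d, Gt (e' (e.symm u)) c d * (coordHess e e' u c a μ * coordJac e e' u d b
        + coordJac e e' u c a * coordHess e e' u d b μ) := by
  have h0 : (fun v => G v a b) =ᶠ[𝓝 u] fun v => ∑ c, ∑ d, Gt (e' (e.symm v)) c d
      * coordJac e e' v c a * coordJac e e' v d b := by
    filter_upwards [(isOpen_transDom e e').mem_nhds hu] with v hv using hG v hv a b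
  have h1 := fun c d => ((fderiv_comp_trans he he' hu (hGt c d) μ).1.hasFDerivAt.mul
      (differentiableAt_coordJac he he' hu c a).hasFDerivAt).mul
      (differentiableAt_coordJac he he' hu d b).hasFDerivAt
  have h2 := HasFDerivAt.fun_sum (u := Finset.univ) fun c _ =>
    HasFDerivAt.fun_sum (u := Finset.univ) fun d _ => h1 c d
  rw [dMat, h0.fderiv_eq]
  erw [h2.fderiv]
  simp only [sum_apply, add_apply, smul_apply, smul_eq_mul, Pi.mul_apply]
  have h3 : ∀ c d, fderiv ℝ (fun v => Gt (e' (e.symm v)) c d) u (stdVec μ)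
      = ∑ ν, dMat Gt (e' (e.symm u)) ν c d * coordJac e e' u ν μ :=
    fun c d => (fderiv_comp_trans he he' hu (hGt c d) μ).2
  simp only [h3]
  have h4 : ∑ ν, ∑ c, ∑ d, dMat Gt (e' (e.symm u)) ν c d * coordJac e e' u ν μ
        * coordJac e e' u c a * coordJac e e' u d b
      = ∑ c, ∑ d, (∑ ν, dMat Gt (e' (e.symm u)) ν c d * coordJac e e' u ν μ)
        * coordJac e e' u c a * coordJac e e' u d b := by
    simp only [Finset.sum_mul]
    rw [Finset.sum_comm]
    exact Finset.sum_congr rfl fun c _ => Finset.sum_comm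
  rw [h4, ← Finset.sum_add_distrib]
  refine Finset.sum_congr rfl fun c _ => ?_
  rw [← Finset.sum_add_distrib]
  refine Finset.sum_congr rfl fun d _ => ?_
  simp only [coordHess]
  ring

theorem det_coordJac_ne_zero {e e' : LChart m X}
    (he : e ∈ smoothCharts m X) (he' : e' ∈ smoothCharts m X) {u : Rn m}
    (hu : u ∈ transDom e e') : (Matrix.of (coordJac e e' u)).det ≠ 0 := by
  have h : Matrix.of (coordJac e' e (e' (e.symm u))) * Matrix.of (coordJac e e' u) = 1 := by
    ext a c
    rw [Matrix.mul_apply, Matrix.one_apply]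
    exact coordJac_mul he he' hu a c
  intro h0
  have := congrArg Matrix.det h
  rw [Matrix.det_mul, h0] at this
  simp at this

/-- The transformation law of the Christoffel symbols under a change of charts. -/
theorem chrUp_coord_trans {G Gt : Rn m → Matrix (Fin m) (Fin m) ℝ} {e e' : LChart m X}
    (he : e ∈ smoothCharts m X) (he' : e' ∈ smoothCharts m X) {u : Rn m} (hu : u ∈ transDom e e')
    (hGt : ∀ a b, DifferentiableAt ℝ (fun v => Gt v a b) (e' (e.symm u)))
    (hs : ∀ v a b, Gt v a b = Gt v b a) (hd : (Gt (e' (e.symm u))).det ≠ 0)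
    (hG : ∀ v ∈ transDom e e', ∀ a b, G v a b
      = ∑ c, ∑ d, Gt (e' (e.symm v)) c d * coordJac e e' v c a * coordJac e e' v d b)
    (c a b : Fin m) :
    ∑ k, coordJac e e' u c k * chrUp (G u) (dMat G u) k a b
      = (∑ d, ∑ f, chrUp (Gt (e' (e.symm u))) (dMat Gt (e' (e.symm u))) c d f
          * coordJac e e' u d a * coordJac e e' u f b) + coordHess e e' u c a b :=
  chrUp_trans (J := Matrix.of (coordJac e e' u)) (hs _) (coordHess_comm he he' hu)
    (dMat_trans he he' hu hGt hG)
    (inv_trans (det_coordJac_ne_zero he he' hu) (hG u hu)) hd c a b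

theorem inv_coord_trans {G Gt : Matrix (Fin m) (Fin m) ℝ} {e e' : LChart m X}
    (he : e ∈ smoothCharts m X) (he' : e' ∈ smoothCharts m X) {u : Rn m} (hu : u ∈ transDom e e')
    (hG : ∀ a b, G a b = ∑ c, ∑ d, Gt c d * coordJac e e' u c a * coordJac e e' u d b)
    (c ν : Fin m) :
    ∑ k, ∑ μ, coordJac e e' u c k * G⁻¹ k μ * coordJac e e' u ν μ = Gt⁻¹ c ν :=
  inv_trans (J := Matrix.of (coordJac e e' u)) (det_coordJac_ne_zero he he' hu) hG c ν

end MetricTransformation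

/-! ### The metric on `T`: smoothness, tensor laws, Christoffel symbols, density. -/

section Temporal

variable {p : ℕ} {T : Type*} [TopologicalSpace T] [ChartedSpace (Rn p) T]

/-- The metric at a point as a bilinear form on `ℝᵖ`. -/
def SemiRiemannianMetric.bilin (h : SemiRiemannianMetric p T) (x : T) :
    Rn p →ₗ[ℝ] Rn p →ₗ[ℝ] ℝ := h.form x

theorem hLow_eq (h : SemiRiemannianMetric p T) (φ : LChart p T) (t : Rn p) :
    hLow h φ t = Matrix.of fun α β =>
      h.bilin (φ.symm t) (dsymm φ t (stdVec α)) (dsymm φ t (stdVec β)) := rfl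

theorem hLow_comm (h : SemiRiemannianMetric p T) (φ : LChart p T) (t : Rn p) (α β : Fin p) :
    hLow h φ t α β = hLow h φ t β α := h.symm _ _ _

theorem contDiffOn_hLow (h : SemiRiemannianMetric p T) {φ : LChart p T}
    (hφ : φ ∈ smoothCharts p T) (α β : Fin p) :
    ContDiffOn ℝ ∞ (fun t => hLow h φ t α β) φ.target := h.smooth φ hφ α β

theorem differentiableAt_hLow (h : SemiRiemannianMetric p T) {φ : LChart p T}
    (hφ : φ ∈ smoothCharts p T) {t : Rn p} (ht : t ∈ φ.target) (α β : Fin p) :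
    DifferentiableAt ℝ (fun t => hLow h φ t α β) t :=
  ((contDiffOn_hLow h hφ α β).contDiffAt (φ.open_target.mem_nhds ht)).differentiableAt (by simp)

theorem det_hLow_ne_zero (h : SemiRiemannianMetric p T) {φ : LChart p T}
    (hφ : φ ∈ smoothCharts p T) {t : Rn p} (ht : t ∈ φ.target) : (hLow h φ t).det ≠ 0 :=
  det_gram_ne_zero (h.bilin (φ.symm t)) (h.nondeg (φ.symm t)) _ _ (dsymm_dchart hφ ht)
    (dchart_dsymm hφ ht)

theorem contDiffOn_hUp (h : SemiRiemannianMetric p T) {φ : LChart p T}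
    (hφ : φ ∈ smoothCharts p T) (α β : Fin p) :
    ContDiffOn ℝ ∞ (fun t => hUp h φ t α β) φ.target :=
  contDiffOn_inv_apply (contDiffOn_hLow h hφ) (fun _ ht => det_hLow_ne_zero h hφ ht) α β

theorem differentiableAt_hUp (h : SemiRiemannianMetric p T) {φ : LChart p T}
    (hφ : φ ∈ smoothCharts p T) {t : Rn p} (ht : t ∈ φ.target) (α β : Fin p) :
    DifferentiableAt ℝ (fun t => hUp h φ t α β) t :=
  ((contDiffOn_hUp h hφ α β).contDiffAt (φ.open_target.mem_nhds ht)).differentiableAt (by simp)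

theorem inv_comm_of_comm {m : ℕ} {A : Matrix (Fin m) (Fin m) ℝ} (hA : ∀ a b, A a b = A b a)
    (a b : Fin m) : A⁻¹ a b = A⁻¹ b a := by
  have : A.transpose = A := by ext i j; exact hA j i
  rw [← Matrix.transpose_apply A⁻¹, Matrix.transpose_nonsing_inv, this]

theorem hUp_comm (h : SemiRiemannianMetric p T) (φ : LChart p T) (t : Rn p) (α β : Fin p) :
    hUp h φ t α β = hUp h φ t β α := inv_comm_of_comm (hLow_comm h φ t) α β

theorem hLow_trans (h : SemiRiemannianMetric p T) {φ φ' : LChart p T}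
    (hφ : φ ∈ smoothCharts p T) (hφ' : φ' ∈ smoothCharts p T) {t : Rn p}
    (ht : t ∈ transDom φ φ') (α β : Fin p) :
    hLow h φ t α β = ∑ μ, ∑ ν, hLow h φ' (φ' (φ.symm t)) μ ν * coordJac φ φ' t μ α
      * coordJac φ φ' t ν β := by
  simp only [hLow_eq, Matrix.of_apply, symm_trans ht]
  rw [dsymm_stdVec_trans hφ hφ' ht α, dsymm_stdVec_trans hφ hφ' ht β, bilin_sum_smul]

theorem hUp_trans (h : SemiRiemannianMetric p T) {φ φ' : LChart p T}
    (hφ : φ ∈ smoothCharts p T) (hφ' : φ' ∈ smoothCharts p T) {t : Rn p}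
    (ht : t ∈ transDom φ φ') (α β : Fin p) :
    ∑ μ, ∑ ν, coordJac φ φ' t α μ * hUp h φ t μ ν * coordJac φ φ' t β ν
      = hUp h φ' (φ' (φ.symm t)) α β :=
  inv_coord_trans hφ hφ' ht (hLow_trans h hφ hφ' ht) α β

theorem christoffelH_eq (h : SemiRiemannianMetric p T) (φ : LChart p T) (t : Rn p) :
    christoffelH h φ t = chrUp (hLow h φ t) (dMat (hLow h φ) t) := by
  funext γ α β
  refine Finset.sum_congr rfl fun μ _ => ?_
  simp only [chrLow, hUp, dhLow, dMat]
  ring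

theorem contDiffOn_fderiv_apply {E F : Type*} [NormedAddCommGroup E] [NormedSpace ℝ E]
    [NormedAddCommGroup F] [NormedSpace ℝ F]
    {f : E → F} {s : Set E} (hs : IsOpen s) (hf : ContDiffOn ℝ ∞ f s) (v : E) :
    ContDiffOn ℝ ∞ (fun u => fderiv ℝ f u v) s :=
  (hf.fderiv_of_isOpen hs (by simp)).clm_apply contDiffOn_const

theorem contDiffOn_christoffelH (h : SemiRiemannianMetric p T) {φ : LChart p T}
    (hφ : φ ∈ smoothCharts p T) (γ α β : Fin p) :
    ContDiffOn ℝ ∞ (fun t => christoffelH h φ t γ α β) φ.target := by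
  have h1 : ∀ μ α β, ContDiffOn ℝ ∞ (fun t => dhLow h φ t μ α β) φ.target := fun μ α β =>
    contDiffOn_fderiv_apply φ.open_target (contDiffOn_hLow h hφ α β) _
  exact ContDiffOn.sum fun μ _ => ((contDiffOn_hUp h hφ γ μ).div_const 2).mul
    (((h1 _ _ _).add (h1 _ _ _)).sub (h1 _ _ _))

theorem christoffelH_trans (h : SemiRiemannianMetric p T) {φ φ' : LChart p T}
    (hφ : φ ∈ smoothCharts p T) (hφ' : φ' ∈ smoothCharts p T) {t : Rn p}
    (ht : t ∈ transDom φ φ') (γ α β : Fin p) :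
    ∑ k, coordJac φ φ' t γ k * christoffelH h φ t k α β
      = (∑ μ, ∑ ν, christoffelH h φ' (φ' (φ.symm t)) γ μ ν * coordJac φ φ' t μ α
          * coordJac φ φ' t ν β) + coordHess φ φ' t γ α β := by
  simp only [christoffelH_eq]
  exact chrUp_coord_trans hφ hφ' ht (differentiableAt_hLow h hφ' (trans_mem ht).1)
    (hLow_comm h φ') (det_hLow_ne_zero h hφ' (trans_mem ht).1)
    (fun v hv => hLow_trans h hφ hφ' hv) γ α β

theorem sum_fderiv_hUp (h : SemiRiemannianMetric p T) {φ : LChart p T}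
    (hφ : φ ∈ smoothCharts p T) {t : Rn p} (ht : t ∈ φ.target) (β : Fin p) :
    ∑ α, fderiv ℝ (fun s => hUp h φ s α β) t (stdVec α)
      = -(∑ α, ∑ γ, hUp h φ t α β * christoffelH h φ t γ α γ)
      - ∑ α, ∑ γ, hUp h φ t α γ * christoffelH h φ t β α γ := by
  simp only [christoffelH_eq]
  exact sum_dMat_inv (hLow_comm h φ) (differentiableAt_hLow h hφ ht)
    (differentiableAt_hUp h hφ ht)
    (by filter_upwards [φ.open_target.mem_nhds ht] with w hw using det_hLow_ne_zero h hφ hw) β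

theorem fderiv_volumeDensity (h : SemiRiemannianMetric p T) {φ : LChart p T}
    (hφ : φ ∈ smoothCharts p T) {t : Rn p} (ht : t ∈ φ.target) (α : Fin p) :
    DifferentiableAt ℝ (fun t => √|(hLow h φ t).det|) t ∧
    fderiv ℝ (fun t => √|(hLow h φ t).det|) t (stdVec α)
      = √|(hLow h φ t).det| * ∑ γ, christoffelH h φ t γ α γ := by
  simp only [christoffelH_eq]
  exact fderiv_sqrt_abs_det (hLow_comm h φ) (differentiableAt_hLow h hφ ht)
    (det_hLow_ne_zero h hφ ht) α

end Temporal

/-! ### Coordinate domains of the jet space and partial derivatives. -/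

section JetCharts

variable {p n : ℕ} {T M : Type*} [TopologicalSpace T] [TopologicalSpace M]

theorem isOpen_jetDomain (φ : LChart p T) (ψ : LChart n M) :
    IsOpen (jetDomain φ ψ : Set (JCoord p n)) :=
  (φ.open_target.preimage continuous_fst).inter
    (ψ.open_target.preimage (continuous_fst.comp continuous_snd))

theorem mem_jetOverlap {φ φ' : LChart p T} {ψ ψ' : LChart n M} {q : JCoord p n} :
    q ∈ jetOverlap φ ψ φ' ψ' ↔ q.1 ∈ transDom φ φ' ∧ q.2.1 ∈ transDom ψ ψ' :=
  ⟨fun h => ⟨⟨h.1.1, h.2.1⟩, h.1.2, h.2.2⟩, fun h => ⟨⟨h.1.1, h.2.1⟩, h.1.2, h.2.2⟩⟩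

theorem isOpen_jetOverlap (φ φ' : LChart p T) (ψ ψ' : LChart n M) :
    IsOpen (jetOverlap φ ψ φ' ψ' : Set (JCoord p n)) := by
  have : (jetOverlap φ ψ φ' ψ' : Set (JCoord p n)) =
      {q | q.1 ∈ transDom φ φ' ∧ q.2.1 ∈ transDom ψ ψ'} := by
    ext q; exact mem_jetOverlap
  rw [this]
  exact ((isOpen_transDom φ φ').preimage continuous_fst).inter
    ((isOpen_transDom ψ ψ').preimage (continuous_fst.comp continuous_snd))

theorem jetTransition_mem {φ φ' : LChart p T} {ψ ψ' : LChart n M} {q : JCoord p n}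
    (hq : q ∈ jetOverlap φ ψ φ' ψ') : jetTransition φ ψ φ' ψ' q ∈ jetDomain φ' ψ' :=
  ⟨φ'.map_source hq.2.1, ψ'.map_source hq.2.2⟩

theorem matLin_apply (y : Fin n → Fin p → ℝ) (v : Rn p) (k : Fin n) :
    matLin y v k = ∑ α, y k α * v α := by
  simp [matLin, Matrix.toLpLin_apply, Matrix.mulVec, dotProduct]

theorem sum_smul_single_single (y : Fin n → Fin p → ℝ) :
    ∑ k, ∑ γ, y k γ • (Pi.single k (Pi.single γ 1) : Fin n → Fin p → ℝ) = y := by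
  ext i α
  simp only [Finset.sum_apply, Pi.smul_apply, smul_eq_mul]
  rw [Finset.sum_eq_single i]
  · simp [Pi.single_apply]
  · intro b _ hb
    simp [Pi.single_eq_of_ne hb.symm]
  · simp

/-- The bridge from total derivatives, to which the chain rule applies, to the partial derivatives
`dT`, `dX`, `dV`. -/
theorem fderiv_eq_sum (F : JCoord p n → ℝ) (q w : JCoord p n) :
    fderiv ℝ F q w = (∑ μ, w.1 μ * dT μ F q) + (∑ k, w.2.1 k * dX k F q)
      + ∑ k, ∑ γ, w.2.2 k γ * dV k γ F q := by
  have h1 : w = ContinuousLinearMap.inl ℝ _ _ w.1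
      + ContinuousLinearMap.inr ℝ _ _ (ContinuousLinearMap.inl ℝ _ _ w.2.1)
      + ContinuousLinearMap.inr ℝ _ _ (ContinuousLinearMap.inr ℝ _ _ w.2.2) := by
    simp
  conv_lhs => rw [h1, ← sum_smul_stdVec w.1, ← sum_smul_stdVec w.2.1,
    ← sum_smul_single_single w.2.2]
  simp only [map_add, map_sum, map_smul, smul_eq_mul]
  rfl

/-- The inverse Jacobian `∂t^α/∂t̃^γ` as a function of `t`. -/
def coordJacInv {m : ℕ} {X : Type*} [TopologicalSpace X] (e e' : LChart m X) (u : Rn m)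
    (a c : Fin m) : ℝ := coordJac e' e (e' (e.symm u)) a c

theorem jetTransition_snd_snd (φ φ' : LChart p T) (ψ ψ' : LChart n M) (q : JCoord p n)
    (k : Fin n) (γ : Fin p) : (jetTransition φ ψ φ' ψ' q).2.2 k γ
      = ∑ j, ∑ α, coordJac ψ ψ' q.2.1 k j * coordJacInv φ φ' q.1 α γ * q.2.2 j α := rfl

theorem ContDiffOn.comp_jet_fst {F : Rn p → ℝ} {φ : LChart p T} {ψ : LChart n M}
    (hF : ContDiffOn ℝ ∞ F φ.target) :
    ContDiffOn ℝ ∞ (fun q : JCoord p n => F q.1) (jetDomain φ ψ) :=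
  hF.comp contDiff_fst.contDiffOn fun _ hq => hq.1

end JetCharts

/-! ### The change of jet coordinates and its derivative. -/

section JetTransition

variable {p n : ℕ} {T M : Type*} [TopologicalSpace T] [ChartedSpace (Rn p) T]
  [TopologicalSpace M] [ChartedSpace (Rn n) M]

/-- Writing the derivatives of the old charts through those of the new ones places the two
transition derivatives on either side of the old velocity matrix. Their product is the new velocity
matrix. All invariance statements below rest on this. -/
theorem jetOfCoord_jetTransition {φ φ' : LChart p T} {ψ ψ' : LChart n M} {q : JCoord p n}
    (hφ : φ ∈ smoothCharts p T) (hφ' : φ' ∈ smoothCharts p T)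
    (hψ : ψ ∈ smoothCharts n M) (hψ' : ψ' ∈ smoothCharts n M)
    (hq : q ∈ jetOverlap φ ψ φ' ψ') :
    jetOfCoord φ' ψ' (jetTransition φ ψ φ' ψ' q) = jetOfCoord φ ψ q := by
  obtain ⟨h1, h2⟩ := mem_jetOverlap.1 hq
  -- The linear part of a jet has a type that depends on its two base points. Since every tangent
  -- space is definitionally the model space, equality can be tested on three components with fixed
  -- types.
  have key : ∀ (t t' : T) (x x' : M) (A A' : Rn p →L[ℝ] Rn n), t = t' → x = x' → A = A' →
      (⟨t, x, A⟩ : Jet p n T M) = ⟨t', x', A'⟩ := by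
    rintro _ _ _ _ _ _ rfl rfl rfl; rfl
  refine key _ _ _ _ (((dsymm ψ' (ψ' (ψ.symm q.2.1))).comp
      (matLin (jetTransition φ ψ φ' ψ' q).2.2)).comp (dchart φ' (φ'.symm (φ' (φ.symm q.1)))))
    (((dsymm ψ q.2.1).comp (matLin q.2.2)).comp (dchart φ (φ.symm q.1)))
    (symm_trans h1) (symm_trans h2) ?_
  rw [symm_trans h1, dsymm_trans hψ hψ' h2]
  have h3 := dchart_trans hφ' hφ (trans_mem h1)
  rw [symm_trans h1] at h3
  rw [h3]
  have h4 : matLin (jetTransition φ ψ φ' ψ' q).2.2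
      = (fderiv ℝ (fun v => ψ' (ψ.symm v)) q.2.1).comp ((matLin q.2.2).comp
        (fderiv ℝ (fun v => φ (φ'.symm v)) (φ' (φ.symm q.1)))) := by
    ext v k
    simp only [ContinuousLinearMap.comp_apply, matLin_apply, fderiv_trans_apply,
      jetTransition_snd_snd, coordJacInv, Finset.mul_sum, Finset.sum_mul]
    rw [Finset.sum_comm]
    refine Finset.sum_congr rfl fun j _ => ?_
    rw [Finset.sum_comm]
    exact Finset.sum_congr rfl fun α _ => Finset.sum_congr rfl fun γ _ => by ring
  rw [h4]
  rfl

theorem locL_jetTransition (L : Jet p n T M → ℝ) {φ φ' : LChart p T} {ψ ψ' : LChart n M}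
    {q : JCoord p n} (hφ : φ ∈ smoothCharts p T) (hφ' : φ' ∈ smoothCharts p T)
    (hψ : ψ ∈ smoothCharts n M) (hψ' : ψ' ∈ smoothCharts n M)
    (hq : q ∈ jetOverlap φ ψ φ' ψ') :
    locL L φ' ψ' (jetTransition φ ψ φ' ψ' q) = locL L φ ψ q := by
  rw [locL, jetOfCoord_jetTransition hφ hφ' hψ hψ' hq, locL]

/-- A spatial d-metric at a jet as a bilinear form on `ℝⁿ`. -/
def SpatialDMetric.bilin (g : SpatialDMetric p n T M) (J : Jet p n T M) :
    Rn n →ₗ[ℝ] Rn n →ₗ[ℝ] ℝ := g.form J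

theorem gLow_eq (g : SpatialDMetric p n T M) (φ : LChart p T) (ψ : LChart n M)
    (q : JCoord p n) : gLow g φ ψ q = Matrix.of fun i j =>
      g.bilin (jetOfCoord φ ψ q) (dsymm ψ q.2.1 (stdVec i)) (dsymm ψ q.2.1 (stdVec j)) := rfl

theorem gLow_comm (g : SpatialDMetric p n T M) (φ : LChart p T) (ψ : LChart n M)
    (q : JCoord p n) (i j : Fin n) : gLow g φ ψ q i j = gLow g φ ψ q j i := g.symm _ _ _

theorem det_gLow_ne_zero (g : SpatialDMetric p n T M) {φ : LChart p T} {ψ : LChart n M}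
    (hψ : ψ ∈ smoothCharts n M) {q : JCoord p n} (hq : q ∈ jetDomain φ ψ) :
    (gLow g φ ψ q).det ≠ 0 :=
  det_gram_ne_zero (g.bilin (jetOfCoord φ ψ q)) (g.nondeg (jetOfCoord φ ψ q)) _ _
    (dsymm_dchart hψ hq.2) (dchart_dsymm hψ hq.2)

theorem contDiffOn_gLow (g : SpatialDMetric p n T M) {φ : LChart p T} {ψ : LChart n M}
    (hφ : φ ∈ smoothCharts p T) (hψ : ψ ∈ smoothCharts n M) (i j : Fin n) :
    ContDiffOn ℝ ∞ (fun q => gLow g φ ψ q i j) (jetDomain φ ψ) := g.smooth φ hφ ψ hψ i j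

theorem contDiffOn_gUp (g : SpatialDMetric p n T M) {φ : LChart p T} {ψ : LChart n M}
    (hφ : φ ∈ smoothCharts p T) (hψ : ψ ∈ smoothCharts n M) (i j : Fin n) :
    ContDiffOn ℝ ∞ (fun q => gUp g φ ψ q i j) (jetDomain φ ψ) :=
  contDiffOn_inv_apply (contDiffOn_gLow g hφ hψ) (fun _ hq => det_gLow_ne_zero g hψ hq) i j

theorem gLow_jetTransition (g : SpatialDMetric p n T M) {φ φ' : LChart p T} {ψ ψ' : LChart n M}
    {q : JCoord p n} (hφ : φ ∈ smoothCharts p T) (hφ' : φ' ∈ smoothCharts p T)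
    (hψ : ψ ∈ smoothCharts n M) (hψ' : ψ' ∈ smoothCharts n M)
    (hq : q ∈ jetOverlap φ ψ φ' ψ') (i j : Fin n) :
    gLow g φ ψ q i j = ∑ k, ∑ l, gLow g φ' ψ' (jetTransition φ ψ φ' ψ' q) k l
      * coordJac ψ ψ' q.2.1 k i * coordJac ψ ψ' q.2.1 l j := by
  simp only [gLow_eq, Matrix.of_apply, jetOfCoord_jetTransition hφ hφ' hψ hψ' hq]
  obtain ⟨h1, h2⟩ := mem_jetOverlap.1 hq
  rw [dsymm_stdVec_trans hψ hψ' h2 i, dsymm_stdVec_trans hψ hψ' h2 j, bilin_sum_smul]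
  rfl

theorem gUp_jetTransition (g : SpatialDMetric p n T M) {φ φ' : LChart p T} {ψ ψ' : LChart n M}
    {q : JCoord p n} (hφ : φ ∈ smoothCharts p T) (hφ' : φ' ∈ smoothCharts p T)
    (hψ : ψ ∈ smoothCharts n M) (hψ' : ψ' ∈ smoothCharts n M)
    (hq : q ∈ jetOverlap φ ψ φ' ψ') (i j : Fin n) :
    ∑ k, ∑ l, coordJac ψ ψ' q.2.1 i k * gUp g φ ψ q k l * coordJac ψ ψ' q.2.1 j l
      = gUp g φ' ψ' (jetTransition φ ψ φ' ψ' q) i j :=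
  inv_coord_trans hψ hψ' (mem_jetOverlap.1 hq).2 (gLow_jetTransition g hφ hφ' hψ hψ' hq) i j

/-- The derivative of the inverse Jacobian `∂t^α/∂t̃^γ` with respect to `t^μ`. -/
def coordJacInvDeriv {m : ℕ} {X : Type*} [TopologicalSpace X] (e e' : LChart m X) (u : Rn m)
    (a c b : Fin m) : ℝ := fderiv ℝ (fun v => coordJacInv e e' v a c) u (stdVec b)

theorem differentiableAt_coordJacInv {m : ℕ} {X : Type*} [TopologicalSpace X]
    [ChartedSpace (Rn m) X] {e e' : LChart m X}
    (he : e ∈ smoothCharts m X) (he' : e' ∈ smoothCharts m X) {u : Rn m}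
    (hu : u ∈ transDom e e') (a c : Fin m) :
    DifferentiableAt ℝ (fun v => coordJacInv e e' v a c) u :=
  (fderiv_comp_trans he he' hu (differentiableAt_coordJac he' he (trans_mem hu) a c) a).1

/-- The derivative of the inverse Jacobian is taken in the old coordinates. Contracting with the
inverse Jacobian turns it into a derivative in the new ones, which is a second derivative of the
inverse change of charts. -/
theorem sum_coordJacInvDeriv {m : ℕ} {X : Type*} [TopologicalSpace X]
    [ChartedSpace (Rn m) X] {e e' : LChart m X}
    (he : e ∈ smoothCharts m X) (he' : e' ∈ smoothCharts m X) {u : Rn m}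
    (hu : u ∈ transDom e e') (a c d : Fin m) :
    ∑ b, coordJacInv e e' u b d * coordJacInvDeriv e e' u a c b
      = coordHess e' e (e' (e.symm u)) a c d := by
  have h1 : ∀ b, coordJacInvDeriv e e' u a c b
      = ∑ ν, coordHess e' e (e' (e.symm u)) a c ν * coordJac e e' u ν b := fun b =>
    (fderiv_comp_trans he he' hu (differentiableAt_coordJac he' he (trans_mem hu) a c) b).2
  simp only [h1, Finset.mul_sum]
  rw [Finset.sum_comm]
  have h2 : ∀ ν, ∑ b, coordJac e e' u ν b * coordJacInv e e' u b d = if ν = d then 1 else 0 :=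
    fun ν => coordJac_mul' he he' hu ν d
  calc _ = ∑ ν, coordHess e' e (e' (e.symm u)) a c ν
        * ∑ b, coordJac e e' u ν b * coordJacInv e e' u b d := by
        simp only [Finset.mul_sum]
        exact Finset.sum_congr rfl fun _ _ => Finset.sum_congr rfl fun _ _ => by ring
    _ = _ := by simp [h2]

/-- A new velocity is a sum of products of three factors that depend on x, on t and on the old
velocities respectively. The three Leibniz terms are thus its derivatives in the three groups of
coordinates. -/
theorem hasFDerivAt_jetTransition_snd_snd {φ φ' : LChart p T} {ψ ψ' : LChart n M}
    {q : JCoord p n} (hφ : φ ∈ smoothCharts p T) (hφ' : φ' ∈ smoothCharts p T)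
    (hψ : ψ ∈ smoothCharts n M) (hψ' : ψ' ∈ smoothCharts n M)
    (hq : q ∈ jetOverlap φ ψ φ' ψ') (k : Fin n) (γ : Fin p) :
    DifferentiableAt ℝ (fun r => (jetTransition φ ψ φ' ψ' r).2.2 k γ) q ∧
    ∀ w : JCoord p n, fderiv ℝ (fun r => (jetTransition φ ψ φ' ψ' r).2.2 k γ) q w
      = ∑ j, ∑ α, (fderiv ℝ (fun x => coordJac ψ ψ' x k j) q.2.1 w.2.1
            * coordJacInv φ φ' q.1 α γ * q.2.2 j α
          + coordJac ψ ψ' q.2.1 k j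
            * fderiv ℝ (fun t => coordJacInv φ φ' t α γ) q.1 w.1 * q.2.2 j α
          + coordJac ψ ψ' q.2.1 k j * coordJacInv φ φ' q.1 α γ * w.2.2 j α) := by
  obtain ⟨h1, h2⟩ := mem_jetOverlap.1 hq
  have hB : ∀ j, HasFDerivAt (fun r : JCoord p n => coordJac ψ ψ' r.2.1 k j)
      ((fderiv ℝ (fun x => coordJac ψ ψ' x k j) q.2.1).comp
        ((ContinuousLinearMap.fst ℝ _ _).comp (ContinuousLinearMap.snd ℝ _ _))) q := fun j =>
    HasFDerivAt.comp q (f := fun r : JCoord p n => r.2.1)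
      (differentiableAt_coordJac hψ hψ' h2 k j).hasFDerivAt
      ((ContinuousLinearMap.fst ℝ (Rn n) (Fin n → Fin p → ℝ)).comp
        (ContinuousLinearMap.snd ℝ (Rn p) _)).hasFDerivAt
  have hC : ∀ α, HasFDerivAt (fun r : JCoord p n => coordJacInv φ φ' r.1 α γ)
      ((fderiv ℝ (fun t => coordJacInv φ φ' t α γ) q.1).comp
        (ContinuousLinearMap.fst ℝ _ _)) q := fun α =>
    HasFDerivAt.comp q (f := fun r : JCoord p n => r.1)
      (differentiableAt_coordJacInv hφ hφ' h1 α γ).hasFDerivAt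
      hasFDerivAt_fst
  have hy : ∀ j α, HasFDerivAt (fun r : JCoord p n => r.2.2 j α)
      ((ContinuousLinearMap.proj α).comp ((ContinuousLinearMap.proj j).comp
        ((ContinuousLinearMap.snd ℝ (Rn n) (Fin n → Fin p → ℝ)).comp
          (ContinuousLinearMap.snd ℝ (Rn p) _)))) q := fun j α =>
    ((ContinuousLinearMap.proj (R := ℝ) (φ := fun _ : Fin p => ℝ) α).comp
      ((ContinuousLinearMap.proj (R := ℝ) (φ := fun _ : Fin n => Fin p → ℝ) j).comp
        ((ContinuousLinearMap.snd ℝ (Rn n) (Fin n → Fin p → ℝ)).comp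
          (ContinuousLinearMap.snd ℝ (Rn p) _)))).hasFDerivAt
  have h3 := HasFDerivAt.fun_sum (u := Finset.univ) fun j _ =>
    HasFDerivAt.fun_sum (u := Finset.univ) fun α _ => ((hB j).fun_mul (hC α)).fun_mul (hy j α)
  have h4 : HasFDerivAt (fun r => (jetTransition φ ψ φ' ψ' r).2.2 k γ) _ q := h3
  refine ⟨h4.differentiableAt, fun w => ?_⟩
  rw [h4.fderiv]
  simp only [sum_apply, add_apply, smul_apply, smul_eq_mul]
  refine Finset.sum_congr rfl fun j _ => Finset.sum_congr rfl fun α _ => ?_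
  simp only [ContinuousLinearMap.comp_apply, ContinuousLinearMap.coe_fst',
    ContinuousLinearMap.coe_snd', ContinuousLinearMap.proj_apply]
  ring

theorem dT_jetTransition {φ φ' : LChart p T} {ψ ψ' : LChart n M}
    {q : JCoord p n} (hφ : φ ∈ smoothCharts p T) (hφ' : φ' ∈ smoothCharts p T)
    (hψ : ψ ∈ smoothCharts n M) (hψ' : ψ' ∈ smoothCharts n M)
    (hq : q ∈ jetOverlap φ ψ φ' ψ') (k : Fin n) (γ μ : Fin p) :
    dT μ (fun r => (jetTransition φ ψ φ' ψ' r).2.2 k γ) q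
      = ∑ j, ∑ α, coordJac ψ ψ' q.2.1 k j * coordJacInvDeriv φ φ' q.1 α γ μ * q.2.2 j α := by
  rw [dT, (hasFDerivAt_jetTransition_snd_snd hφ hφ' hψ hψ' hq k γ).2]
  simp [coordJacInvDeriv]

theorem dX_jetTransition {φ φ' : LChart p T} {ψ ψ' : LChart n M}
    {q : JCoord p n} (hφ : φ ∈ smoothCharts p T) (hφ' : φ' ∈ smoothCharts p T)
    (hψ : ψ ∈ smoothCharts n M) (hψ' : ψ' ∈ smoothCharts n M)
    (hq : q ∈ jetOverlap φ ψ φ' ψ') (k : Fin n) (γ : Fin p) (l : Fin n) :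
    dX l (fun r => (jetTransition φ ψ φ' ψ' r).2.2 k γ) q
      = ∑ j, ∑ α, coordHess ψ ψ' q.2.1 k j l * coordJacInv φ φ' q.1 α γ * q.2.2 j α := by
  rw [dX, (hasFDerivAt_jetTransition_snd_snd hφ hφ' hψ hψ' hq k γ).2]
  simp [coordHess]

theorem dV_jetTransition {φ φ' : LChart p T} {ψ ψ' : LChart n M}
    {q : JCoord p n} (hφ : φ ∈ smoothCharts p T) (hφ' : φ' ∈ smoothCharts p T)
    (hψ : ψ ∈ smoothCharts n M) (hψ' : ψ' ∈ smoothCharts n M)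
    (hq : q ∈ jetOverlap φ ψ φ' ψ') (k : Fin n) (γ : Fin p) (i : Fin n) (ε : Fin p) :
    dV i ε (fun r => (jetTransition φ ψ φ' ψ' r).2.2 k γ) q
      = coordJac ψ ψ' q.2.1 k i * coordJacInv φ φ' q.1 ε γ := by
  rw [dV, (hasFDerivAt_jetTransition_snd_snd hφ hφ' hψ hψ' hq k γ).2]
  simp only [map_zero, zero_mul, mul_zero, zero_add]
  rw [Finset.sum_eq_single i, Finset.sum_eq_single ε]
  · simp
  · intro α _ hα; simp [Pi.single_eq_of_ne hα]
  · simp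
  · intro j _ hj; simp [Pi.single_eq_of_ne hj]
  · simp

/-- The chain rule for the change of coordinates on `J¹(T,M)`. -/
theorem fderiv_comp_jetTransition {F : JCoord p n → ℝ} {φ φ' : LChart p T} {ψ ψ' : LChart n M}
    {q : JCoord p n} (hφ : φ ∈ smoothCharts p T) (hφ' : φ' ∈ smoothCharts p T)
    (hψ : ψ ∈ smoothCharts n M) (hψ' : ψ' ∈ smoothCharts n M)
    (hq : q ∈ jetOverlap φ ψ φ' ψ')
    (hF : DifferentiableAt ℝ F (jetTransition φ ψ φ' ψ' q)) :
    DifferentiableAt ℝ (fun r => F (jetTransition φ ψ φ' ψ' r)) q ∧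
    ∀ w, fderiv ℝ (fun r => F (jetTransition φ ψ φ' ψ' r)) q w
      = fderiv ℝ F (jetTransition φ ψ φ' ψ' q)
        (fderiv ℝ (fun v => φ' (φ.symm v)) q.1 w.1, fderiv ℝ (fun v => ψ' (ψ.symm v)) q.2.1 w.2.1,
          fun k γ => fderiv ℝ (fun r => (jetTransition φ ψ φ' ψ' r).2.2 k γ) q w) := by
  obtain ⟨h1, h2⟩ := mem_jetOverlap.1 hq
  have e1 : HasFDerivAt (fun r : JCoord p n => φ' (φ.symm r.1))
      ((fderiv ℝ (fun v => φ' (φ.symm v)) q.1).comp (ContinuousLinearMap.fst ℝ _ _)) q :=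
    HasFDerivAt.comp q (f := fun r : JCoord p n => r.1)
      ((contDiffAt_trans hφ hφ' h1).differentiableAt (by simp)).hasFDerivAt
      hasFDerivAt_fst
  have e2 : HasFDerivAt (fun r : JCoord p n => ψ' (ψ.symm r.2.1))
      ((fderiv ℝ (fun v => ψ' (ψ.symm v)) q.2.1).comp
        ((ContinuousLinearMap.fst ℝ _ _).comp (ContinuousLinearMap.snd ℝ _ _))) q :=
    HasFDerivAt.comp q (f := fun r : JCoord p n => r.2.1)
      ((contDiffAt_trans hψ hψ' h2).differentiableAt (by simp)).hasFDerivAt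
      ((ContinuousLinearMap.fst ℝ (Rn n) (Fin n → Fin p → ℝ)).comp
        (ContinuousLinearMap.snd ℝ (Rn p) _)).hasFDerivAt
  have e3 : HasFDerivAt (fun r => (jetTransition φ ψ φ' ψ' r).2.2)
      (ContinuousLinearMap.pi fun k => ContinuousLinearMap.pi fun γ =>
        fderiv ℝ (fun r => (jetTransition φ ψ φ' ψ' r).2.2 k γ) q) q :=
    hasFDerivAt_pi.2 fun k => hasFDerivAt_pi.2 fun γ =>
      (hasFDerivAt_jetTransition_snd_snd hφ hφ' hψ hψ' hq k γ).1.hasFDerivAt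
  have e4 : HasFDerivAt (jetTransition φ ψ φ' ψ') _ q := e1.prodMk (e2.prodMk e3)
  have e5 := hF.hasFDerivAt.comp q e4
  refine ⟨e5.differentiableAt, fun w => ?_⟩
  have e6 : fderiv ℝ (fun r => F (jetTransition φ ψ φ' ψ' r)) q = _ := e5.fderiv
  rw [e6]
  rfl

end JetTransition

/-! ### The temporal spray and the temporal part of the connection. -/

section TemporalSpray

variable {p n : ℕ} {T M : Type*} [TopologicalSpace T] [ChartedSpace (Rn p) T]
  [TopologicalSpace M] [ChartedSpace (Rn n) M]

/-- The Christoffel law for the inverse change of charts, with its second derivatives rewritten by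
`sum_coordJacInvDeriv`. In this form the inhomogeneous term matches the time derivative of the new
velocities. -/
theorem christoffelH_coordJacInv (h : SemiRiemannianMetric p T) {φ φ' : LChart p T}
    (hφ : φ ∈ smoothCharts p T) (hφ' : φ' ∈ smoothCharts p T) {t : Rn p}
    (ht : t ∈ transDom φ φ') (δ γ β : Fin p) :
    ∑ ε, coordJacInv φ φ' t δ ε * christoffelH h φ' (φ' (φ.symm t)) ε γ β
      = (∑ α, ∑ μ, christoffelH h φ t δ α μ * coordJacInv φ φ' t α γ * coordJacInv φ φ' t μ β)
        + ∑ μ, coordJacInv φ φ' t μ β * coordJacInvDeriv φ φ' t δ γ μ := by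
  have h1 := christoffelH_trans h hφ' hφ (trans_mem ht) δ γ β
  rw [trans_trans ht] at h1
  rw [sum_coordJacInvDeriv hφ hφ' ht]
  exact h1

theorem contDiff_jet_snd_snd (i : Fin n) (α : Fin p) :
    ContDiff ℝ ∞ (fun q : JCoord p n => q.2.2 i α) :=
  ((ContinuousLinearMap.proj (R := ℝ) (φ := fun _ : Fin p => ℝ) α).comp
    ((ContinuousLinearMap.proj (R := ℝ) (φ := fun _ : Fin n => Fin p → ℝ) i).comp
      ((ContinuousLinearMap.snd ℝ (Rn n) (Fin n → Fin p → ℝ)).comp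
        (ContinuousLinearMap.snd ℝ (Rn p) _)))).contDiff

/-- Once every term is collected as a coefficient of (∂x̃^k/∂x^j) x^j_δ, the law is
`christoffelH_coordJacInv`. -/
theorem isTemporalSpray_canonicalH (h : SemiRiemannianMetric p T) :
    IsTemporalSpray (canonicalH h : LocalTT p n T M) := by
  refine ⟨fun φ hφ ψ hψ i α β => contDiffOn_const.mul (ContDiffOn.sum fun γ _ =>
    (ContDiffOn.comp_jet_fst (contDiffOn_christoffelH h hφ γ α β)).mul
      (contDiff_jet_snd_snd i γ).contDiffOn), ?_⟩
  intro φ hφ ψ hψ φ' hφ' ψ' hψ' q hq k γ β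
  obtain ⟨h1, h2⟩ := mem_jetOverlap.1 hq
  simp only [dT_jetTransition hφ hφ' hψ hψ' hq]
  change 2 * (-(1 / 2) * ∑ ε, christoffelH h φ' (φ' (φ.symm q.1)) ε γ β *
      (jetTransition φ ψ φ' ψ' q).2.2 k ε)
    = (∑ j, ∑ α, ∑ μ, 2 * (-(1 / 2) * ∑ δ, christoffelH h φ q.1 δ α μ * q.2.2 j δ)
        * coordJacInv φ φ' q.1 α γ * coordJacInv φ φ' q.1 μ β * coordJac ψ ψ' q.2.1 k j)
      - ∑ μ, coordJacInv φ φ' q.1 μ β * ∑ j, ∑ α, coordJac ψ ψ' q.2.1 k j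
          * coordJacInvDeriv φ φ' q.1 α γ μ * q.2.2 j α
  have e1 : ∑ ε, christoffelH h φ' (φ' (φ.symm q.1)) ε γ β * (jetTransition φ ψ φ' ψ' q).2.2 k ε
      = ∑ j, ∑ δ, coordJac ψ ψ' q.2.1 k j * q.2.2 j δ
        * ∑ ε, coordJacInv φ φ' q.1 δ ε * christoffelH h φ' (φ' (φ.symm q.1)) ε γ β := by
    simp only [jetTransition_snd_snd, Finset.mul_sum]
    rw [Finset.sum_comm]
    refine Finset.sum_congr rfl fun j _ => ?_
    rw [Finset.sum_comm]
    exact Finset.sum_congr rfl fun _ _ => Finset.sum_congr rfl fun _ _ => by ring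
  have e2 : ∑ j, ∑ α, ∑ μ, 2 * (-(1 / 2) * ∑ δ, christoffelH h φ q.1 δ α μ * q.2.2 j δ)
        * coordJacInv φ φ' q.1 α γ * coordJacInv φ φ' q.1 μ β * coordJac ψ ψ' q.2.1 k j
      = -∑ j, ∑ δ, coordJac ψ ψ' q.2.1 k j * q.2.2 j δ * ∑ α, ∑ μ, christoffelH h φ q.1 δ α μ
        * coordJacInv φ φ' q.1 α γ * coordJacInv φ φ' q.1 μ β := by
    simp only [Finset.mul_sum, Finset.sum_mul, ← Finset.sum_neg_distrib]
    refine Finset.sum_congr rfl fun j _ => ?_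
    calc _ = ∑ α, ∑ δ, ∑ μ, 2 * (-(1 / 2) * (christoffelH h φ q.1 δ α μ * q.2.2 j δ))
        * coordJacInv φ φ' q.1 α γ * coordJacInv φ φ' q.1 μ β * coordJac ψ ψ' q.2.1 k j :=
          Finset.sum_congr rfl fun _ _ => Finset.sum_comm
      _ = _ := Finset.sum_comm
      _ = _ := Finset.sum_congr rfl fun _ _ => Finset.sum_congr rfl fun _ _ =>
          Finset.sum_congr rfl fun _ _ => by ring
  have e3 : ∑ μ, coordJacInv φ φ' q.1 μ β * ∑ j, ∑ α, coordJac ψ ψ' q.2.1 k j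
          * coordJacInvDeriv φ φ' q.1 α γ μ * q.2.2 j α
      = ∑ j, ∑ δ, coordJac ψ ψ' q.2.1 k j * q.2.2 j δ
        * ∑ μ, coordJacInv φ φ' q.1 μ β * coordJacInvDeriv φ φ' q.1 δ γ μ := by
    simp only [Finset.mul_sum]
    rw [Finset.sum_comm]
    refine Finset.sum_congr rfl fun j _ => ?_
    rw [Finset.sum_comm]
    exact Finset.sum_congr rfl fun _ _ => Finset.sum_congr rfl fun _ _ => by ring
  rw [e1, e2, e3]
  simp only [christoffelH_coordJacInv h hφ hφ' h1, mul_add, Finset.sum_add_distrib]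
  ring

/-- The law of the temporal components of a nonlinear connection induced by a temporal spray. -/
theorem IsTemporalSpray.inducedM_trans {H : LocalTT p n T M}
    (hH : IsTemporalSpray H) {φ φ' : LChart p T} {ψ ψ' : LChart n M}
    {q : JCoord p n} (hφ : φ ∈ smoothCharts p T) (hφ' : φ' ∈ smoothCharts p T)
    (hψ : ψ ∈ smoothCharts n M) (hψ' : ψ' ∈ smoothCharts n M)
    (hq : q ∈ jetOverlap φ ψ φ' ψ') (j : Fin n) (β α : Fin p) :
    ∑ μ, inducedM H φ' ψ' (jetTransition φ ψ φ' ψ' q) j β μ * coordJac φ φ' q.1 μ α =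
        (∑ k, ∑ γ, inducedM H φ ψ q k γ α * coordJac ψ ψ' q.2.1 j k *
          coordJac φ' φ (φ' (φ.symm q.1)) γ β)
        - dT α (fun r => (jetTransition φ ψ φ' ψ' r).2.2 j β) q := by
  obtain ⟨h1, h2⟩ := mem_jetOverlap.1 hq
  -- Contraction with ∂t̃/∂t cancels one inverse Jacobian. This is the only difference between the
  -- law of a temporal spray and that of the temporal components of a connection.
  have hδ : ∀ ν, ∑ μ, coordJac φ' φ (φ' (φ.symm q.1)) ν μ * coordJac φ φ' q.1 μ α
      = if ν = α then 1 else 0 := fun ν => coordJac_mul hφ hφ' h1 ν α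
  simp only [inducedM, hH.2 φ hφ ψ hψ φ' hφ' ψ' hψ' q hq, sub_mul, Finset.sum_sub_distrib]
  congr 1
  · simp only [Finset.sum_mul]
    rw [Finset.sum_comm]
    refine Finset.sum_congr rfl fun k _ => ?_
    rw [Finset.sum_comm]
    refine Finset.sum_congr rfl fun γ _ => ?_
    rw [Finset.sum_comm]
    calc _ = ∑ ν, 2 * H φ ψ q k γ ν * coordJac φ' φ (φ' (φ.symm q.1)) γ β * coordJac ψ ψ' q.2.1 j k
          * ∑ μ, coordJac φ' φ (φ' (φ.symm q.1)) ν μ * coordJac φ φ' q.1 μ α := by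
          simp only [Finset.mul_sum]
          exact Finset.sum_congr rfl fun _ _ => Finset.sum_congr rfl fun _ _ => by ring
      _ = _ := by simp [hδ]; ring
  · simp only [Finset.sum_mul]
    rw [Finset.sum_comm]
    calc _ = ∑ ν, dT ν (fun r => (jetTransition φ ψ φ' ψ' r).2.2 j β) q
          * ∑ μ, coordJac φ' φ (φ' (φ.symm q.1)) ν μ * coordJac φ φ' q.1 μ α := by
          simp only [Finset.mul_sum]
          exact Finset.sum_congr rfl fun _ _ => Finset.sum_congr rfl fun _ _ => by ring
      _ = _ := by simp [hδ]

end TemporalSpray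

/-! ### Smoothness of partial derivatives and integration along velocity rays. -/

section Derivatives

variable {p n : ℕ}

theorem contDiffOn_dT {F : JCoord p n → ℝ} {s : Set (JCoord p n)} (hs : IsOpen s)
    (hF : ContDiffOn ℝ ∞ F s) (α : Fin p) : ContDiffOn ℝ ∞ (dT α F) s :=
  contDiffOn_fderiv_apply hs hF _

theorem contDiffOn_dX {F : JCoord p n → ℝ} {s : Set (JCoord p n)} (hs : IsOpen s)
    (hF : ContDiffOn ℝ ∞ F s) (i : Fin n) : ContDiffOn ℝ ∞ (dX i F) s :=
  contDiffOn_fderiv_apply hs hF _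

theorem contDiffOn_dV {F : JCoord p n → ℝ} {s : Set (JCoord p n)} (hs : IsOpen s)
    (hF : ContDiffOn ℝ ∞ F s) (i : Fin n) (α : Fin p) : ContDiffOn ℝ ∞ (dV i α F) s :=
  contDiffOn_fderiv_apply hs hF _

theorem differentiableAt_of_contDiffOn {E : Type*} [NormedAddCommGroup E] [NormedSpace ℝ E]
    {F : E → ℝ} {s : Set E} (hs : IsOpen s) (hF : ContDiffOn ℝ ∞ F s) {q : E} (hq : q ∈ s) : DifferentiableAt ℝ F q :=
  (hF.contDiffAt (hs.mem_nhds hq)).differentiableAt (by simp)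

theorem fderiv_fderiv_apply_comm {E : Type*} [NormedAddCommGroup E] [NormedSpace ℝ E]
    {F : E → ℝ} {s : Set E} (hs : IsOpen s) (hF : ContDiffOn ℝ ∞ F s) {q : E} (hq : q ∈ s)
    (v w : E) :
    fderiv ℝ (fun r => fderiv ℝ F r v) q w = fderiv ℝ (fun r => fderiv ℝ F r w) q v := by
  have h0 : ContDiffAt ℝ ∞ F q := hF.contDiffAt (hs.mem_nhds hq)
  have h1 : DifferentiableAt ℝ (fderiv ℝ F) q :=
    (h0.fderiv_right (m := 1) one_add_one_le_infty).differentiableAt (by simp)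
  have key : ∀ v w, fderiv ℝ (fun r => fderiv ℝ F r v) q w = fderiv ℝ (fderiv ℝ F) q w v := by
    intro v w
    have h2 : HasFDerivAt (fun r => fderiv ℝ F r v) ((fderiv ℝ (fderiv ℝ F) q).flip v) q := by
      simpa using h1.hasFDerivAt.clm_apply (hasFDerivAt_const v q)
    rw [h2.fderiv]
    rfl
  rw [key, key]
  exact (h0.isSymmSndFDerivAt (by simpa using two_le_infty)).eq w v

/-- The point with the velocities multiplied by `s`. -/
def scaleJet (q : JCoord p n) (s : ℝ) : JCoord p n := (q.1, q.2.1, s • q.2.2)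

@[simp] theorem scaleJet_one (q : JCoord p n) : scaleJet q 1 = q := by simp [scaleJet]

@[simp] theorem scaleJet_zero (q : JCoord p n) : scaleJet q 0 = zeroJet q := by
  simp [scaleJet, zeroJet]

theorem hasDerivAt_comp_scaleJet {F : JCoord p n → ℝ} {q : JCoord p n} {s : ℝ}
    (hF : DifferentiableAt ℝ F (scaleJet q s)) :
    HasDerivAt (fun s => F (scaleJet q s)) (∑ k, ∑ γ, q.2.2 k γ * dV k γ F (scaleJet q s)) s := by
  have h1 : HasDerivAt (scaleJet q) (0, 0, q.2.2) s := by
    have h2 : HasDerivAt (fun s : ℝ => s • q.2.2) q.2.2 s := by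
      simpa using (hasDerivAt_id s).smul_const q.2.2
    exact (hasDerivAt_const s q.1).prodMk ((hasDerivAt_const s q.2.1).prodMk h2)
  have h3 := hF.hasFDerivAt.comp_hasDerivAt s h1
  rw [fderiv_eq_sum] at h3
  refine h3.congr_deriv ?_
  simp

/-- The function is constant along the ray `scaleJet q`, which joins the zero velocity at s = 0 to
`q` at s = 1. The next two lemmas integrate a constant and an affine derivative along the same ray.
-/
theorem eq_zeroJet_of_dV_eq_zero {F : JCoord p n → ℝ} {q : JCoord p n}
    (hF : ∀ s, DifferentiableAt ℝ F (scaleJet q s)) (h : ∀ s k γ, dV k γ F (scaleJet q s) = 0) :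
    F q = F (zeroJet q) := by
  have h1 : ∀ s, HasDerivAt (fun s => F (scaleJet q s)) 0 s := fun s => by
    simpa [h] using hasDerivAt_comp_scaleJet (hF s)
  have h2 := is_const_of_deriv_eq_zero (fun s => (h1 s).differentiableAt)
    (fun s => (h1 s).deriv) 1 0
  simpa using h2

theorem eq_zeroJet_add_of_dV_eq_const {F : JCoord p n → ℝ} {q : JCoord p n}
    (hF : ∀ s, DifferentiableAt ℝ F (scaleJet q s)) {c : ℝ}
    (h : ∀ s, ∑ k, ∑ γ, q.2.2 k γ * dV k γ F (scaleJet q s) = c) :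
    F q = F (zeroJet q) + c := by
  have h1 : ∀ s, HasDerivAt (fun s => F (scaleJet q s) - s * c) 0 s := fun s => by
    refine ((hasDerivAt_comp_scaleJet (hF s)).sub
      ((hasDerivAt_id s).mul_const c)).congr_deriv ?_
    rw [h]; simp
  have h2 := is_const_of_deriv_eq_zero (fun s => (h1 s).differentiableAt)
    (fun s => (h1 s).deriv) 1 0
  simp at h2
  linarith

theorem eq_zeroJet_add_of_dV_eq_affine {F : JCoord p n → ℝ} {q : JCoord p n}
    (hF : ∀ s, DifferentiableAt ℝ F (scaleJet q s)) {b c : ℝ}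
    (h : ∀ s, ∑ k, ∑ γ, q.2.2 k γ * dV k γ F (scaleJet q s) = b + s * (2 * c)) :
    F q = F (zeroJet q) + b + c := by
  have h1 : ∀ s, HasDerivAt (fun s => F (scaleJet q s) - (s * b + s ^ 2 * c)) 0 s := fun s => by
    refine ((hasDerivAt_comp_scaleJet (hF s)).sub (((hasDerivAt_id s).mul_const b).add
      (((hasDerivAt_id s).pow 2).mul_const c))).congr_deriv ?_
    rw [h]; simp; ring
  have h2 := is_const_of_deriv_eq_zero (fun s => (h1 s).differentiableAt)
    (fun s => (h1 s).deriv) 1 0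
  simp at h2
  linarith

theorem scaleJet_mem {T M : Type*} [TopologicalSpace T] [TopologicalSpace M] {φ : LChart p T}
    {ψ : LChart n M} {q : JCoord p n} (hq : q ∈ jetDomain φ ψ) (s : ℝ) :
    scaleJet q s ∈ jetDomain φ ψ := hq

theorem zeroJet_mem {T M : Type*} [TopologicalSpace T] [TopologicalSpace M] {φ : LChart p T}
    {ψ : LChart n M} {q : JCoord p n} (hq : q ∈ jetDomain φ ψ) :
    zeroJet q ∈ jetDomain φ ψ := hq

end Derivatives

/-! ### Consequences of Kronecker regularity: for p ≥ 2 the Lagrangian is quadratic. -/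

section KroneckerRegular

variable {p n : ℕ} {T M : Type*} [TopologicalSpace T] [ChartedSpace (Rn p) T]
  [TopologicalSpace M] [ChartedSpace (Rn n) M]
  {h : SemiRiemannianMetric p T} {g : SpatialDMetric p n T M} {L : Jet p n T M → ℝ}
  {φ : LChart p T} {ψ : LChart n M}

theorem IsKroneckerRegular.contDiffOn (hL : IsKroneckerRegular h g L)
    (hφ : φ ∈ smoothCharts p T) (hψ : ψ ∈ smoothCharts n M) :
    ContDiffOn ℝ ∞ (locL L φ ψ) (jetDomain φ ψ) := hL.smooth φ hφ ψ hψ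

theorem IsKroneckerRegular.dV_dV (hL : IsKroneckerRegular h g L)
    (hφ : φ ∈ smoothCharts p T) (hψ : ψ ∈ smoothCharts n M) {q : JCoord p n}
    (hq : q ∈ jetDomain φ ψ) (i j : Fin n) (α β : Fin p) :
    dV i α (dV j β (locL L φ ψ)) q = 2 * hUp h φ q.1 α β * gLow g φ ψ q i j := by
  linarith [hL.regular φ hφ ψ hψ q hq i j α β]

/-- The third velocity derivatives of L are symmetric, while regularity factors them as 2 h^{αβ}
∂g_{ij}/∂x^k_γ. Exchanging the pairs (i,α) and (k,γ) therefore moves a time index from one inverse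
metric to the other. This is incompatible with invertibility of h unless the derivative vanishes,
once there are two time indices. -/
theorem IsKroneckerRegular.dV_gLow (hp : 2 ≤ p) (hL : IsKroneckerRegular h g L)
    (hφ : φ ∈ smoothCharts p T) (hψ : ψ ∈ smoothCharts n M) {q : JCoord p n}
    (hq : q ∈ jetDomain φ ψ) (k : Fin n) (γ : Fin p) (i j : Fin n) :
    dV k γ (fun r => gLow g φ ψ r i j) q = 0 := by
  have ho := isOpen_jetDomain (p := p) (n := n) φ ψ
  have h1 : ∀ (k i j : Fin n) (γ α β : Fin p), dV k γ (dV i α (dV j β (locL L φ ψ))) q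
      = 2 * hUp h φ q.1 α β * dV k γ (fun r => gLow g φ ψ r i j) q := by
    intro k i j γ α β
    have h2 : dV i α (dV j β (locL L φ ψ)) =ᶠ[𝓝 q]
        fun r => 2 * hUp h φ r.1 α β * gLow g φ ψ r i j := by
      filter_upwards [ho.mem_nhds hq] with r hr using hL.dV_dV hφ hψ hr i j α β
    have h3 : HasFDerivAt (fun r : JCoord p n => 2 * hUp h φ r.1 α β)
        ((2 : ℝ) • (fderiv ℝ (fun t => hUp h φ t α β) q.1).comp
          (ContinuousLinearMap.fst ℝ _ _)) q :=
      (HasFDerivAt.comp q (f := fun r : JCoord p n => r.1)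
        (differentiableAt_hUp h hφ hq.1 α β).hasFDerivAt hasFDerivAt_fst).const_mul 2
    have h4 := h3.fun_mul
      (differentiableAt_of_contDiffOn ho (contDiffOn_gLow g hφ hψ i j) hq).hasFDerivAt
    rw [dV, h2.fderiv_eq, h4.fderiv]
    simp [dV]
  have h5 : ∀ (k i j : Fin n) (γ α β : Fin p),
      hUp h φ q.1 α β * dV k γ (fun r => gLow g φ ψ r i j) q
        = hUp h φ q.1 γ β * dV i α (fun r => gLow g φ ψ r k j) q := by
    intro k i j γ α β
    have h6 : dV k γ (dV i α (dV j β (locL L φ ψ))) q = dV i α (dV k γ (dV j β (locL L φ ψ))) q :=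
      fderiv_fderiv_apply_comm ho (contDiffOn_dV ho (hL.contDiffOn hφ hψ) j β) hq _ _
    rw [h1, h1] at h6
    linarith
  obtain ⟨α, hα⟩ : ∃ α : Fin p, α ≠ γ := by
    -- The only use of p ≥ 2. With α ≠ γ, contraction with h_{βα} gives δ^α_α = 1 on one side of the
    -- exchange identity and δ^γ_α = 0 on the other.
    have : Nontrivial (Fin p) := Fin.nontrivial_iff_two_le.2 hp
    exact exists_ne γ
  have hd := det_hLow_ne_zero h hφ hq.1
  have h7 : ∀ γ : Fin p, ∑ β, hUp h φ q.1 γ β * hLow h φ q.1 β α = if γ = α then 1 else 0 :=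
    fun γ => sum_inv_mul_apply hd γ α
  calc dV k γ (fun r => gLow g φ ψ r i j) q
      = ∑ β, (hUp h φ q.1 α β * dV k γ (fun r => gLow g φ ψ r i j) q) * hLow h φ q.1 β α := by
        have h8 := h7 α
        rw [if_pos rfl] at h8
        rw [Finset.sum_congr rfl fun β _ => mul_right_comm _ _ _, ← Finset.sum_mul, h8, one_mul]
    _ = ∑ β, (hUp h φ q.1 γ β * hLow h φ q.1 β α) * dV i α (fun r => gLow g φ ψ r k j) q :=
        Finset.sum_congr rfl fun β _ => by rw [h5]; ring
    _ = 0 := by rw [← Finset.sum_mul, h7, if_neg hα.symm, zero_mul]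

theorem IsKroneckerRegular.gLow_zeroJet (hp : 2 ≤ p) (hL : IsKroneckerRegular h g L)
    (hφ : φ ∈ smoothCharts p T) (hψ : ψ ∈ smoothCharts n M) {q : JCoord p n}
    (hq : q ∈ jetDomain φ ψ) : gLow g φ ψ q = gLow g φ ψ (zeroJet q) := by
  ext i j
  exact eq_zeroJet_of_dV_eq_zero (F := fun r => gLow g φ ψ r i j)
    (fun s => differentiableAt_of_contDiffOn
      (isOpen_jetDomain φ ψ) (contDiffOn_gLow g hφ hψ i j) (scaleJet_mem hq s))
    fun s k γ => hL.dV_gLow hp hφ hψ (scaleJet_mem hq s) k γ i j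

theorem IsKroneckerRegular.gLow_scaleJet (hp : 2 ≤ p) (hL : IsKroneckerRegular h g L)
    (hφ : φ ∈ smoothCharts p T) (hψ : ψ ∈ smoothCharts n M) {q : JCoord p n}
    (hq : q ∈ jetDomain φ ψ) (s : ℝ) : gLow g φ ψ (scaleJet q s) = gLow g φ ψ q := by
  rw [hL.gLow_zeroJet hp hφ hψ hq, hL.gLow_zeroJet hp hφ hψ (scaleJet_mem hq s)]
  rfl

/-- For `p ≥ 2` the momenta `∂L/∂x^k_α` are affine in the velocities. -/
theorem IsKroneckerRegular.dV_locL (hp : 2 ≤ p) (hL : IsKroneckerRegular h g L)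
    (hφ : φ ∈ smoothCharts p T) (hψ : ψ ∈ smoothCharts n M) {q : JCoord p n}
    (hq : q ∈ jetDomain φ ψ) (k : Fin n) (α : Fin p) :
    dV k α (locL L φ ψ) q
      = 2 * (∑ β, ∑ j, hUp h φ q.1 α β * gLow g φ ψ q k j * q.2.2 j β) + potU L φ ψ α k q := by
  have ho := isOpen_jetDomain (p := p) (n := n) φ ψ
  rw [add_comm]
  refine eq_zeroJet_add_of_dV_eq_const (F := dV k α (locL L φ ψ))
    (fun s => differentiableAt_of_contDiffOn ho (contDiffOn_dV ho (hL.contDiffOn hφ hψ) k α)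
      (scaleJet_mem hq s)) fun s => ?_
  simp only [hL.dV_dV hφ hψ (scaleJet_mem hq s), hL.gLow_scaleJet hp hφ hψ hq, Finset.mul_sum]
  rw [Finset.sum_comm]
  refine Finset.sum_congr rfl fun β _ => Finset.sum_congr rfl fun j _ => ?_
  rw [gLow_comm, show (scaleJet q s).1 = q.1 from rfl, hUp_comm]
  ring

/-- For `p ≥ 2` the Lagrangian function is quadratic in the velocities. -/
theorem IsKroneckerRegular.locL_eq (hp : 2 ≤ p) (hL : IsKroneckerRegular h g L)
    (hφ : φ ∈ smoothCharts p T) (hψ : ψ ∈ smoothCharts n M) {q : JCoord p n}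
    (hq : q ∈ jetDomain φ ψ) :
    locL L φ ψ q =
        (∑ α, ∑ β, ∑ i, ∑ j, hUp h φ q.1 α β * gLow g φ ψ q i j * q.2.2 i α * q.2.2 j β)
          + (∑ α, ∑ i, potU L φ ψ α i q * q.2.2 i α) + potF L φ ψ q := by
  have ho := isOpen_jetDomain (p := p) (n := n) φ ψ
  have h1 := eq_zeroJet_add_of_dV_eq_affine (F := locL L φ ψ) (q := q)
    (b := ∑ α, ∑ i, potU L φ ψ α i q * q.2.2 i α)
    (c := ∑ α, ∑ β, ∑ i, ∑ j, hUp h φ q.1 α β * gLow g φ ψ q i j * q.2.2 i α * q.2.2 j β)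
    (fun s => differentiableAt_of_contDiffOn ho (hL.contDiffOn hφ hψ) (scaleJet_mem hq s))
    fun s => by
      simp only [hL.dV_locL hp hφ hψ (scaleJet_mem hq s), hL.gLow_scaleJet hp hφ hψ hq, mul_add,
        Finset.sum_add_distrib]
      rw [add_comm]
      congr 1
      · rw [Finset.sum_comm]
        exact Finset.sum_congr rfl fun α _ => Finset.sum_congr rfl fun i _ => mul_comm _ _
      · simp only [Finset.mul_sum]
        rw [Finset.sum_comm]
        refine Finset.sum_congr rfl fun α _ => ?_
        rw [Finset.sum_comm]
        refine Finset.sum_congr rfl fun β _ => Finset.sum_congr rfl fun i _ =>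
          Finset.sum_congr rfl fun j _ => ?_
        change q.2.2 i α * (2 * (hUp h φ q.1 α β * gLow g φ ψ q i j * (s * q.2.2 j β))) = _
        ring
  rw [h1, potF]
  ring

end KroneckerRegular

theorem sum_rotate {ι κ μ : Type*} [Fintype ι] [Fintype κ] [Fintype μ] (f : ι → κ → μ → ℝ) :
    ∑ a, ∑ b, ∑ c, f a b c = ∑ b, ∑ c, ∑ a, f a b c :=
  Finset.sum_comm.trans (Finset.sum_congr rfl fun _ _ => Finset.sum_comm)

theorem hasFDerivAt_jet_snd_snd {p n : ℕ} (q : JCoord p n) (i : Fin n) (α : Fin p) :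
    HasFDerivAt (fun q : JCoord p n => q.2.2 i α)
      ((ContinuousLinearMap.proj (R := ℝ) (φ := fun _ : Fin p => ℝ) α).comp
      ((ContinuousLinearMap.proj (R := ℝ) (φ := fun _ : Fin n => Fin p → ℝ) i).comp
        ((ContinuousLinearMap.snd ℝ (Rn n) (Fin n → Fin p → ℝ)).comp
          (ContinuousLinearMap.snd ℝ (Rn p) _)))) q :=
  ((ContinuousLinearMap.proj (R := ℝ) (φ := fun _ : Fin p => ℝ) α).comp
      ((ContinuousLinearMap.proj (R := ℝ) (φ := fun _ : Fin n => Fin p → ℝ) i).comp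
        ((ContinuousLinearMap.snd ℝ (Rn n) (Fin n → Fin p → ℝ)).comp
          (ContinuousLinearMap.snd ℝ (Rn p) _)))).hasFDerivAt

theorem contDiffOn_zeroJet {p n : ℕ} {T M : Type*} [TopologicalSpace T] [TopologicalSpace M]
    {φ : LChart p T} {ψ : LChart n M} {F : JCoord p n → ℝ}
    (hF : ContDiffOn ℝ ∞ F (jetDomain φ ψ)) :
    ContDiffOn ℝ ∞ (fun q => F (zeroJet q)) (jetDomain φ ψ) :=
  hF.comp (contDiff_fst.prodMk ((contDiff_fst.comp contDiff_snd).prodMk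
    contDiff_const)).contDiffOn fun _ hq => zeroJet_mem hq

/-! ### The first-order Euler–Lagrange term and the trace of the canonical spray. -/

section EulerLagrangeTerm

variable {p n : ℕ} {T M : Type*} [TopologicalSpace T] [ChartedSpace (Rn p) T]
  [TopologicalSpace M] [ChartedSpace (Rn n) M]

/-- The tangent vector `∂/∂t^α + x^i_α ∂/∂x^i`. -/
def totalVec {p n : ℕ} (q : JCoord p n) (α : Fin p) : JCoord p n :=
  (stdVec α, WithLp.toLp 2 fun i => q.2.2 i α, 0)

/-- The part of the Euler–Lagrange expression of `L` that does not contain second derivatives. -/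
def elTerm (h : SemiRiemannianMetric p T) (L : Jet p n T M → ℝ) (φ : LChart p T)
    (ψ : LChart n M) (q : JCoord p n) (k : Fin n) : ℝ :=
  (∑ α, fderiv ℝ (dV k α (locL L φ ψ)) q (totalVec q α)) - dX k (locL L φ ψ) q
    + ∑ α, ∑ γ, dV k α (locL L φ ψ) q * christoffelH h φ q.1 γ α γ

/-- The `h`-trace of the canonical spatial spray, expressed by the Lagrangian function. -/
def traceG (h : SemiRiemannianMetric p T) (g : SpatialDMetric p n T M) (L : Jet p n T M → ℝ)
    (φ : LChart p T) (ψ : LChart n M) (i : Fin n) (q : JCoord p n) : ℝ :=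
  1 / 4 * (∑ k, gUp g φ ψ q i k * elTerm h L φ ψ q k)
    + 1 / 2 * ∑ α, ∑ β, ∑ γ, hUp h φ q.1 α β * christoffelH h φ q.1 γ α β * q.2.2 i γ

theorem fderiv_totalVec (F : JCoord p n → ℝ) (q : JCoord p n) (α : Fin p) :
    fderiv ℝ F q (totalVec q α) = dT α F q + ∑ j, q.2.2 j α * dX j F q := by
  rw [fderiv_eq_sum]
  simp [totalVec]

variable {h : SemiRiemannianMetric p T} {g : SpatialDMetric p n T M} {L : Jet p n T M → ℝ}
  {φ : LChart p T} {ψ : LChart n M}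

/-- The first four terms in the bracket form `elTerm`. In the last one g^{ik} g_{kl} collapses,
leaving the trace of the Christoffel symbols times the velocity. -/
theorem canonicalG_one_eq (hp : p = 1) (hφ : φ ∈ smoothCharts p T)
    (hψ : ψ ∈ smoothCharts n M) {q : JCoord p n} (hq : q ∈ jetDomain φ ψ) (i : Fin n)
    (α β : Fin p) : canonicalG h g L φ ψ q i α β = hLow h φ q.1 α β * traceG h g L φ ψ i q := by
  subst hp
  obtain rfl : α = 0 := Subsingleton.elim _ _
  obtain rfl : β = 0 := Subsingleton.elim _ _
  have h1 : hUp h φ q.1 0 0 * hLow h φ q.1 0 0 = 1 := by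
    have := sum_inv_mul_apply (det_hLow_ne_zero h hφ hq.1) 0 0
    rwa [Fin.sum_univ_one, if_pos rfl] at this
  have h2 : ∀ l, ∑ k, gUp g φ ψ q i k * gLow g φ ψ q k l = if i = l then 1 else 0 := fun l =>
    sum_inv_mul_apply (det_gLow_ne_zero g hψ hq) i l
  have h3 : ∑ k, gUp g φ ψ q i k * ∑ l, gLow g φ ψ q k l * q.2.2 l 0 = q.2.2 i 0 := by
    simp only [Finset.mul_sum, ← mul_assoc]
    rw [Finset.sum_comm]
    simp only [← Finset.sum_mul, h2]
    simp
  have h4 : canonicalG h g L φ ψ q i 0 0 = ∑ k, (hLow h φ q.1 0 0 * (1 / 4)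
      * (gUp g φ ψ q i k * elTerm h L φ ψ q k)
      + 1 / 2 * hLow h φ q.1 0 0 * hUp h φ q.1 0 0 * christoffelH h φ q.1 0 0 0
        * (gUp g φ ψ q i k * ∑ l, gLow g φ ψ q k l * q.2.2 l 0)) := by
    simp only [canonicalG, if_pos, canonicalGOne]
    refine Finset.sum_congr rfl fun k _ => ?_
    simp only [elTerm, fderiv_totalVec, Fin.sum_univ_one]
    have : ∑ j, dX j (dV k 0 (locL L φ ψ)) q * q.2.2 j 0
        = ∑ j, q.2.2 j 0 * dX j (dV k 0 (locL L φ ψ)) q :=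
      Finset.sum_congr rfl fun _ _ => mul_comm _ _
    rw [this]
    ring
  rw [h4, Finset.sum_add_distrib, ← Finset.mul_sum, ← Finset.mul_sum, h3]
  simp only [traceG, Fin.sum_univ_one]
  ring

/-- This explains the factor 1/p in `tensorT`: with it the trace of h_{αβ} 𝒯^i / p is 𝒯^i. -/
theorem sum_hUp_mul_hLow (hφ : φ ∈ smoothCharts p T) {t : Rn p} (ht : t ∈ φ.target) :
    ∑ α, ∑ β, hUp h φ t α β * hLow h φ t α β = p := by
  have h1 : ∀ α, ∑ β, hUp h φ t α β * hLow h φ t β α = 1 := fun α =>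
    (sum_inv_mul_apply (det_hLow_ne_zero h hφ ht) α α).trans (if_pos rfl)
  have h2 : ∀ α, ∑ β, hUp h φ t α β * hLow h φ t α β = 1 := fun α => by
    rw [← h1 α]
    exact Finset.sum_congr rfl fun β _ => by rw [hLow_comm]
  simp [h2]

theorem hTrace_canonicalG_one (hp : p = 1) (hφ : φ ∈ smoothCharts p T)
    (hψ : ψ ∈ smoothCharts n M) {q : JCoord p n} (hq : q ∈ jetDomain φ ψ) (i : Fin n) :
    hTrace h (canonicalG h g L) φ ψ i q = traceG h g L φ ψ i q := by
  simp only [hTrace, canonicalG_one_eq hp hφ hψ hq, ← mul_assoc, ← Finset.sum_mul,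
    sum_hUp_mul_hLow hφ hq.1]
  simp [hp]

theorem hasFDerivAt_hUp_fst (hφ : φ ∈ smoothCharts p T) {q : JCoord p n} (hq : q.1 ∈ φ.target)
    (α β : Fin p) : HasFDerivAt (fun r : JCoord p n => hUp h φ r.1 α β)
      ((fderiv ℝ (fun t => hUp h φ t α β) q.1).comp (ContinuousLinearMap.fst ℝ _ _)) q :=
  HasFDerivAt.comp q (f := fun r : JCoord p n => r.1)
    (differentiableAt_hUp h hφ hq α β).hasFDerivAt hasFDerivAt_fst

theorem IsKroneckerRegular.contDiffOn_potU (hL : IsKroneckerRegular h g L)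
    (hφ : φ ∈ smoothCharts p T) (hψ : ψ ∈ smoothCharts n M) (α : Fin p) (i : Fin n) :
    ContDiffOn ℝ ∞ (potU L φ ψ α i) (jetDomain φ ψ) :=
  contDiffOn_zeroJet (contDiffOn_dV (isOpen_jetDomain φ ψ) (hL.contDiffOn hφ hψ) i α)

theorem IsKroneckerRegular.contDiffOn_potF (hL : IsKroneckerRegular h g L)
    (hφ : φ ∈ smoothCharts p T) (hψ : ψ ∈ smoothCharts n M) :
    ContDiffOn ℝ ∞ (potF L φ ψ) (jetDomain φ ψ) :=
  contDiffOn_zeroJet (hL.contDiffOn hφ hψ)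

/-- The derivatives of the momenta along `∂/∂t^α + x^i_α ∂/∂x^i` for `p ≥ 2`. -/
theorem IsKroneckerRegular.fderiv_dV_locL (hp : 2 ≤ p) (hL : IsKroneckerRegular h g L)
    (hφ : φ ∈ smoothCharts p T) (hψ : ψ ∈ smoothCharts n M) {q : JCoord p n}
    (hq : q ∈ jetDomain φ ψ) (k : Fin n) (α : Fin p) :
    fderiv ℝ (dV k α (locL L φ ψ)) q (totalVec q α)
      = 2 * (∑ β, ∑ j, (fderiv ℝ (fun t => hUp h φ t α β) q.1 (stdVec α) * gLow g φ ψ q k j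
            + hUp h φ q.1 α β * (dT α (fun r => gLow g φ ψ r k j) q
              + ∑ l, q.2.2 l α * dX l (fun r => gLow g φ ψ r k j) q)) * q.2.2 j β)
        + (dT α (potU L φ ψ α k) q + ∑ l, q.2.2 l α * dX l (potU L φ ψ α k) q) := by
  have ho := isOpen_jetDomain (p := p) (n := n) φ ψ
  have h1 : dV k α (locL L φ ψ) =ᶠ[𝓝 q] fun r => 2 * (∑ β, ∑ j, hUp h φ r.1 α β
      * gLow g φ ψ r k j * r.2.2 j β) + potU L φ ψ α k r := by
    filter_upwards [ho.mem_nhds hq] with r hr using hL.dV_locL hp hφ hψ hr k α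
  have h2 := fun j => (differentiableAt_of_contDiffOn ho (contDiffOn_gLow g hφ hψ k j)
    hq).hasFDerivAt
  have h3 := (HasFDerivAt.fun_sum (u := Finset.univ) fun β _ =>
    HasFDerivAt.fun_sum (u := Finset.univ) fun j _ =>
      ((hasFDerivAt_hUp_fst (h := h) hφ hq.1 α β).fun_mul (h2 j)).fun_mul
        (hasFDerivAt_jet_snd_snd q j β)).const_mul 2
  have h4 := h3.fun_add
    (differentiableAt_of_contDiffOn ho (hL.contDiffOn_potU hφ hψ α k) hq).hasFDerivAt
  rw [h1.fderiv_eq, h4.fderiv]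
  simp only [add_apply, smul_apply, smul_eq_mul, sum_apply, fderiv_totalVec]
  congr 2
  refine Finset.sum_congr rfl fun β _ => Finset.sum_congr rfl fun j _ => ?_
  simp only [ContinuousLinearMap.comp_apply, ContinuousLinearMap.coe_fst',
    ContinuousLinearMap.coe_snd', ContinuousLinearMap.proj_apply, totalVec, Pi.zero_apply]
  ring

theorem IsKroneckerRegular.dX_locL (hp : 2 ≤ p) (hL : IsKroneckerRegular h g L)
    (hφ : φ ∈ smoothCharts p T) (hψ : ψ ∈ smoothCharts n M) {q : JCoord p n}
    (hq : q ∈ jetDomain φ ψ) (k : Fin n) :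
    dX k (locL L φ ψ) q
      = (∑ α, ∑ β, ∑ i, ∑ j, hUp h φ q.1 α β * dX k (fun r => gLow g φ ψ r i j) q
          * q.2.2 i α * q.2.2 j β)
        + (∑ α, ∑ i, dX k (potU L φ ψ α i) q * q.2.2 i α) + dX k (potF L φ ψ) q := by
  have ho := isOpen_jetDomain (p := p) (n := n) φ ψ
  have h1 : locL L φ ψ =ᶠ[𝓝 q] fun r =>
      (∑ α, ∑ β, ∑ i, ∑ j, hUp h φ r.1 α β * gLow g φ ψ r i j * r.2.2 i α * r.2.2 j β)
          + (∑ α, ∑ i, potU L φ ψ α i r * r.2.2 i α) + potF L φ ψ r := by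
    filter_upwards [ho.mem_nhds hq] with r hr using hL.locL_eq hp hφ hψ hr
  have h2 := fun i j => (differentiableAt_of_contDiffOn ho (contDiffOn_gLow g hφ hψ i j)
    hq).hasFDerivAt
  have h3 := HasFDerivAt.fun_sum (u := Finset.univ) fun α _ =>
    HasFDerivAt.fun_sum (u := Finset.univ) fun β _ =>
    HasFDerivAt.fun_sum (u := Finset.univ) fun i _ =>
    HasFDerivAt.fun_sum (u := Finset.univ) fun j _ =>
      (((hasFDerivAt_hUp_fst (h := h) hφ hq.1 α β).fun_mul (h2 i j)).fun_mul
        (hasFDerivAt_jet_snd_snd q i α)).fun_mul (hasFDerivAt_jet_snd_snd q j β)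
  have h4 := HasFDerivAt.fun_sum (u := Finset.univ) fun α _ =>
    HasFDerivAt.fun_sum (u := Finset.univ) fun i _ =>
      (differentiableAt_of_contDiffOn ho (hL.contDiffOn_potU hφ hψ α i) hq).hasFDerivAt.fun_mul
        (hasFDerivAt_jet_snd_snd q i α)
  have h5 := (h3.fun_add h4).fun_add
    (differentiableAt_of_contDiffOn ho (hL.contDiffOn_potF hφ hψ) hq).hasFDerivAt
  rw [dX, h1.fderiv_eq, h5.fderiv]
  simp only [add_apply, smul_apply, smul_eq_mul, sum_apply]
  simp only [ContinuousLinearMap.comp_apply, ContinuousLinearMap.coe_fst',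
    ContinuousLinearMap.coe_snd', map_zero]
  simp only [mul_zero, zero_add, add_zero]
  congr 2
  · refine Finset.sum_congr rfl fun α _ => Finset.sum_congr rfl fun β _ =>
      Finset.sum_congr rfl fun i _ => Finset.sum_congr rfl fun j _ => ?_
    simp only [dX]; ring
  · refine Finset.sum_congr rfl fun α _ => Finset.sum_congr rfl fun i _ => ?_
    simp only [dX]; ring

/-- The divergence term of the Euler–Lagrange expression for `p ≥ 2`. -/
theorem sum_fderiv_hUp_mul (hφ : φ ∈ smoothCharts p T) {q : JCoord p n}
    (hq : q ∈ jetDomain φ ψ) (k : Fin n) :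
    (∑ α, ∑ β, ∑ j, fderiv ℝ (fun t => hUp h φ t α β) q.1 (stdVec α) * gLow g φ ψ q k j
        * q.2.2 j β)
      + ∑ α, ∑ γ, (∑ β, ∑ j, hUp h φ q.1 α β * gLow g φ ψ q k j * q.2.2 j β)
          * christoffelH h φ q.1 γ α γ
      = -∑ j, gLow g φ ψ q k j *
          ∑ α, ∑ β, ∑ γ, hUp h φ q.1 α β * christoffelH h φ q.1 γ α β * q.2.2 j γ := by
  have h1 : ∑ α, ∑ β, ∑ j, fderiv ℝ (fun t => hUp h φ t α β) q.1 (stdVec α) * gLow g φ ψ q k j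
        * q.2.2 j β = ∑ β, ∑ j, (∑ α, fderiv ℝ (fun t => hUp h φ t α β) q.1 (stdVec α))
          * (gLow g φ ψ q k j * q.2.2 j β) := by
    rw [Finset.sum_comm]
    refine Finset.sum_congr rfl fun β _ => ?_
    rw [Finset.sum_comm]
    simp only [Finset.sum_mul, mul_assoc]
  have h2 : ∑ α, ∑ γ, (∑ β, ∑ j, hUp h φ q.1 α β * gLow g φ ψ q k j * q.2.2 j β)
          * christoffelH h φ q.1 γ α γ
      = ∑ β, ∑ j, (∑ α, ∑ γ, hUp h φ q.1 α β * christoffelH h φ q.1 γ α γ)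
          * (gLow g φ ψ q k j * q.2.2 j β) := by
    simp only [Finset.sum_mul]
    calc _ = ∑ α, ∑ β, ∑ j, ∑ γ, hUp h φ q.1 α β * gLow g φ ψ q k j * q.2.2 j β
          * christoffelH h φ q.1 γ α γ := Finset.sum_congr rfl fun _ _ => sum_rotate _
      _ = _ := sum_rotate _
      _ = _ := Finset.sum_congr rfl fun _ _ => Finset.sum_congr rfl fun _ _ =>
        Finset.sum_congr rfl fun _ _ => Finset.sum_congr rfl fun _ _ => by ring
  -- The derivative of the density supplies the term with H^γ_{αγ}, which cancels the first term in
  -- the divergence of h^{αβ}. Only the trace h^{αγ} H^β_{αγ} survives.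
  have e : ∀ β, (∑ α, fderiv ℝ (fun t => hUp h φ t α β) q.1 (stdVec α))
      + (∑ α, ∑ γ, hUp h φ q.1 α β * christoffelH h φ q.1 γ α γ)
      = -∑ α, ∑ γ, hUp h φ q.1 α γ * christoffelH h φ q.1 β α γ := fun β => by
    rw [sum_fderiv_hUp h hφ hq.1]; ring
  rw [h1, h2]
  simp only [← Finset.sum_add_distrib, ← add_mul, e]
  simp only [neg_mul, Finset.sum_neg_distrib]
  congr 1
  rw [Finset.sum_comm]
  refine Finset.sum_congr rfl fun j _ => ?_
  have h3 : ∑ α, ∑ β, ∑ γ, hUp h φ q.1 α β * christoffelH h φ q.1 γ α β * q.2.2 j γ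
      = ∑ γ, (∑ α, ∑ β, hUp h φ q.1 α β * christoffelH h φ q.1 γ α β) * q.2.2 j γ := by
    simp only [Finset.sum_mul]
    calc _ = ∑ α, ∑ γ, ∑ β, hUp h φ q.1 α β * christoffelH h φ q.1 γ α β * q.2.2 j γ :=
          Finset.sum_congr rfl fun _ _ => Finset.sum_comm
      _ = _ := Finset.sum_comm
  rw [h3, Finset.mul_sum]
  exact Finset.sum_congr rfl fun β _ => by ring

/-- Substituting the quadratic form of L, the x-derivatives of g assemble into the lowered
Christoffel symbols of g, the derivatives of h and of the density into the last line, and the rest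
is the bracket that defines 𝒯. -/
theorem IsKroneckerRegular.elTerm_eq (hp : 2 ≤ p) (hL : IsKroneckerRegular h g L)
    (hφ : φ ∈ smoothCharts p T) (hψ : ψ ∈ smoothCharts n M) {q : JCoord p n}
    (hq : q ∈ jetDomain φ ψ) (k : Fin n) :
    elTerm h L φ ψ q k = (∑ α, ∑ β, ∑ j, ∑ l, hUp h φ q.1 α β
          * (dX l (fun r => gLow g φ ψ r k j) q + dX j (fun r => gLow g φ ψ r k l) q
            - dX k (fun r => gLow g φ ψ r j l) q) * q.2.2 j α * q.2.2 l β)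
      + (2 * (∑ α, ∑ β, ∑ j, hUp h φ q.1 α β * dT α (fun r => gLow g φ ψ r k j) q * q.2.2 j β)
        + (∑ α, ∑ j, curlU L φ ψ q α k j * q.2.2 j α)
        + (∑ α, dT α (potU L φ ψ α k) q)
        + (∑ α, ∑ γ, potU L φ ψ α k q * christoffelH h φ q.1 γ α γ)
        - dX k (potF L φ ψ) q)
      - 2 * ∑ j, gLow g φ ψ q k j *
          ∑ α, ∑ β, ∑ γ, hUp h φ q.1 α β * christoffelH h φ q.1 γ α β * q.2.2 j γ := by
  have h1 : ∑ α, ∑ β, ∑ j, hUp h φ q.1 α β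
        * (∑ l, q.2.2 l α * dX l (fun r => gLow g φ ψ r k j) q) * q.2.2 j β
      = ∑ α, ∑ β, ∑ j, ∑ l, hUp h φ q.1 α β * dX j (fun r => gLow g φ ψ r k l) q
        * q.2.2 j α * q.2.2 l β := by
    refine Finset.sum_congr rfl fun α _ => Finset.sum_congr rfl fun β _ => ?_
    rw [Finset.sum_comm]
    refine Finset.sum_congr rfl fun j _ => ?_
    simp only [Finset.mul_sum, Finset.sum_mul]
    exact Finset.sum_congr rfl fun l _ => by ring
  -- Exchanging α with β and j with l costs nothing since h is symmetric. It converts one of the two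
  -- copies of ∂g_{kl}/∂x^j coming from D_α into ∂g_{kj}/∂x^l, as Γ requires.
  have h2 : ∑ α, ∑ β, ∑ j, ∑ l, hUp h φ q.1 α β * dX j (fun r => gLow g φ ψ r k l) q
        * q.2.2 j α * q.2.2 l β
      = ∑ α, ∑ β, ∑ j, ∑ l, hUp h φ q.1 α β * dX l (fun r => gLow g φ ψ r k j) q
        * q.2.2 j α * q.2.2 l β := by
    rw [Finset.sum_comm]
    refine Finset.sum_congr rfl fun α _ => Finset.sum_congr rfl fun β _ => ?_
    rw [Finset.sum_comm]
    refine Finset.sum_congr rfl fun j _ => Finset.sum_congr rfl fun l _ => ?_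
    rw [hUp_comm]; ring
  have h3 : ∑ α, ∑ j, curlU L φ ψ q α k j * q.2.2 j α
      = (∑ α, ∑ l, q.2.2 l α * dX l (potU L φ ψ α k) q)
        - ∑ α, ∑ i, dX k (potU L φ ψ α i) q * q.2.2 i α := by
    simp only [curlU, sub_mul, Finset.sum_sub_distrib]
    congr 1
    exact Finset.sum_congr rfl fun _ _ => Finset.sum_congr rfl fun _ _ => mul_comm _ _
  have h4 := sum_fderiv_hUp_mul (h := h) (g := g) hφ hq k
  simp only [elTerm, hL.fderiv_dV_locL hp hφ hψ hq, hL.dX_locL hp hφ hψ hq,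
    hL.dV_locL hp hφ hψ hq]
  simp only [add_mul, mul_add, sub_mul, mul_sub, Finset.sum_add_distrib, Finset.sum_sub_distrib,
    ← Finset.mul_sum, mul_assoc] at h1 h2 h3 h4 ⊢
  linear_combination 2 * h1 + 2 * h4 + h2 - h3

/-- After raising the index, the last term of `elTerm_eq` becomes −½ h^{αβ} H^γ_{αβ} x^i_γ. The
second summand of `traceG` was chosen to cancel it. -/
theorem IsKroneckerRegular.traceG_eq (hp : 2 ≤ p) (hL : IsKroneckerRegular h g L)
    (hφ : φ ∈ smoothCharts p T) (hψ : ψ ∈ smoothCharts n M) {q : JCoord p n}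
    (hq : q ∈ jetDomain φ ψ) (i : Fin n) :
    traceG h g L φ ψ i q = 1 / 2 * (∑ α, ∑ β, hUp h φ q.1 α β
        * ∑ j, ∑ l, christoffelG g φ ψ q i j l * q.2.2 j α * q.2.2 l β)
      + traceT h g L φ ψ q i := by
  have h2 : ∀ l, ∑ k, gUp g φ ψ q i k * gLow g φ ψ q k l = if i = l then 1 else 0 := fun l =>
    sum_inv_mul_apply (det_gLow_ne_zero g hψ hq) i l
  have h3 : ∀ v : Fin n → ℝ, ∑ k, gUp g φ ψ q i k * ∑ l, gLow g φ ψ q k l * v l = v i := by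
    intro v
    simp only [Finset.mul_sum, ← mul_assoc]
    rw [Finset.sum_comm]
    simp only [← Finset.sum_mul, h2]
    simp
  have h4 : ∑ α, ∑ β, hUp h φ q.1 α β
        * ∑ j, ∑ l, christoffelG g φ ψ q i j l * q.2.2 j α * q.2.2 l β
      = 1 / 2 * ∑ k, gUp g φ ψ q i k * ∑ α, ∑ β, ∑ j, ∑ l, hUp h φ q.1 α β
          * (dX l (fun r => gLow g φ ψ r k j) q + dX j (fun r => gLow g φ ψ r k l) q
            - dX k (fun r => gLow g φ ψ r j l) q) * q.2.2 j α * q.2.2 l β := by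
    simp only [christoffelG, Finset.mul_sum, Finset.sum_mul]
    symm
    refine Finset.sum_comm.trans (Finset.sum_congr rfl fun α _ => ?_)
    refine Finset.sum_comm.trans (Finset.sum_congr rfl fun β _ => ?_)
    refine Finset.sum_comm.trans (Finset.sum_congr rfl fun j _ => ?_)
    refine Finset.sum_comm.trans (Finset.sum_congr rfl fun l _ => ?_)
    exact Finset.sum_congr rfl fun k _ => by ring
  have h5 : ∀ k, gUp g φ ψ q i k * elTerm h L φ ψ q k = _ := fun k => by
    rw [hL.elTerm_eq hp hφ hψ hq k, mul_sub, mul_add, mul_left_comm _ 2]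
  rw [traceG, Finset.sum_congr rfl fun k _ => h5 k, Finset.sum_sub_distrib,
    Finset.sum_add_distrib, ← Finset.mul_sum, h3, h4, traceT]
  have h6 : ∀ R : Fin n → ℝ, ∑ k, gUp g φ ψ q i k / 2 * R k
      = 1 / 2 * ∑ k, gUp g φ ψ q i k * R k := fun R => by
    rw [Finset.mul_sum]
    exact Finset.sum_congr rfl fun _ _ => by ring
  rw [h6]
  ring

end EulerLagrangeTerm

/-! ### Ingredients of the transformation law of the Euler–Lagrange term. -/

section TraceTransformation

variable {p n : ℕ} {T M : Type*} [TopologicalSpace T] [ChartedSpace (Rn p) T]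
  [TopologicalSpace M] [ChartedSpace (Rn n) M]
  {h : SemiRiemannianMetric p T} {g : SpatialDMetric p n T M} {L : Jet p n T M → ℝ}
  {φ φ' : LChart p T} {ψ ψ' : LChart n M}

/-- The two formulas for G have one and the same expression as trace. Arguments that involve only 𝒢,
such as those for harmonic maps and for the laws of the nonlinear connection, can thus treat all p
at once. -/
theorem IsKroneckerRegular.hTrace_canonicalG (hp : 1 ≤ p) (hL : IsKroneckerRegular h g L)
    (hφ : φ ∈ smoothCharts p T) (hψ : ψ ∈ smoothCharts n M) {q : JCoord p n}
    (hq : q ∈ jetDomain φ ψ) (i : Fin n) :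
    hTrace h (canonicalG h g L) φ ψ i q = traceG h g L φ ψ i q := by
  rcases hp.eq_or_lt with hp1 | hp2
  · exact hTrace_canonicalG_one hp1.symm hφ hψ hq i
  · have hp0 : (p : ℝ) ≠ 0 := by positivity
    have h1 : ∑ α, ∑ β, hUp h φ q.1 α β * (hLow h φ q.1 α β / p * traceT h g L φ ψ q i)
        = traceT h g L φ ψ q i := by
      have := sum_hUp_mul_hLow (h := h) hφ hq.1
      calc _ = (∑ α, ∑ β, hUp h φ q.1 α β * hLow h φ q.1 α β) / p * traceT h g L φ ψ q i := by
            simp only [Finset.sum_div, Finset.sum_mul]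
            exact Finset.sum_congr rfl fun _ _ => Finset.sum_congr rfl fun _ _ => by ring
        _ = _ := by rw [this, div_self hp0, one_mul]
    rw [hL.traceG_eq hp2 hφ hψ hq]
    simp only [hTrace, canonicalG, if_neg (show p ≠ 1 by omega), canonicalGMulti, tensorT,
      mul_add, Finset.sum_add_distrib, h1]
    congr 1
    simp only [Finset.mul_sum]
    exact Finset.sum_congr rfl fun _ _ => Finset.sum_congr rfl fun _ _ =>
      Finset.sum_congr rfl fun _ _ => Finset.sum_congr rfl fun _ _ => by ring

theorem locL_eventuallyEq (L : Jet p n T M → ℝ) {q : JCoord p n} (hφ : φ ∈ smoothCharts p T)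
    (hφ' : φ' ∈ smoothCharts p T) (hψ : ψ ∈ smoothCharts n M) (hψ' : ψ' ∈ smoothCharts n M)
    (hq : q ∈ jetOverlap φ ψ φ' ψ') :
    locL L φ ψ =ᶠ[𝓝 q] fun r => locL L φ' ψ' (jetTransition φ ψ φ' ψ' r) := by
  filter_upwards [(isOpen_jetOverlap φ φ' ψ ψ').mem_nhds hq] with r hr
  exact (locL_jetTransition L hφ hφ' hψ hψ' hr).symm

theorem dV_comp_jetTransition {F : JCoord p n → ℝ} {q : JCoord p n}
    (hφ : φ ∈ smoothCharts p T) (hφ' : φ' ∈ smoothCharts p T)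
    (hψ : ψ ∈ smoothCharts n M) (hψ' : ψ' ∈ smoothCharts n M)
    (hq : q ∈ jetOverlap φ ψ φ' ψ')
    (hF : DifferentiableAt ℝ F (jetTransition φ ψ φ' ψ' q)) (k : Fin n) (α : Fin p) :
    dV k α (fun r => F (jetTransition φ ψ φ' ψ' r)) q
      = ∑ m, ∑ γ, dV m γ F (jetTransition φ ψ φ' ψ' q) * coordJac ψ ψ' q.2.1 m k
          * coordJacInv φ φ' q.1 α γ := by
  rw [dV, (fderiv_comp_jetTransition hφ hφ' hψ hψ' hq hF).2, fderiv_eq_sum]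
  simp only [map_zero, PiLp.zero_apply, zero_mul, Finset.sum_const_zero, zero_add]
  refine Finset.sum_congr rfl fun m _ => Finset.sum_congr rfl fun γ _ => ?_
  have := dV_jetTransition hφ hφ' hψ hψ' hq m γ k α
  rw [dV] at this
  rw [this]
  ring

theorem dX_comp_jetTransition {F : JCoord p n → ℝ} {q : JCoord p n}
    (hφ : φ ∈ smoothCharts p T) (hφ' : φ' ∈ smoothCharts p T)
    (hψ : ψ ∈ smoothCharts n M) (hψ' : ψ' ∈ smoothCharts n M)
    (hq : q ∈ jetOverlap φ ψ φ' ψ')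
    (hF : DifferentiableAt ℝ F (jetTransition φ ψ φ' ψ' q)) (k : Fin n) :
    dX k (fun r => F (jetTransition φ ψ φ' ψ' r)) q
      = (∑ m, coordJac ψ ψ' q.2.1 m k * dX m F (jetTransition φ ψ φ' ψ' q))
        + ∑ m, ∑ γ, dX k (fun r => (jetTransition φ ψ φ' ψ' r).2.2 m γ) q
          * dV m γ F (jetTransition φ ψ φ' ψ' q) := by
  rw [dX, (fderiv_comp_jetTransition hφ hφ' hψ hψ' hq hF).2, fderiv_eq_sum]
  simp only [map_zero, PiLp.zero_apply, zero_mul, Finset.sum_const_zero, zero_add]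
  rfl

theorem dV_locL_jetTransition (hL : IsKroneckerRegular h g L) {q : JCoord p n}
    (hφ : φ ∈ smoothCharts p T) (hφ' : φ' ∈ smoothCharts p T)
    (hψ : ψ ∈ smoothCharts n M) (hψ' : ψ' ∈ smoothCharts n M)
    (hq : q ∈ jetOverlap φ ψ φ' ψ') (k : Fin n) (α : Fin p) :
    dV k α (locL L φ ψ) q = ∑ m, ∑ γ, dV m γ (locL L φ' ψ') (jetTransition φ ψ φ' ψ' q)
      * coordJac ψ ψ' q.2.1 m k * coordJacInv φ φ' q.1 α γ := by
  rw [dV, (locL_eventuallyEq L hφ hφ' hψ hψ' hq).fderiv_eq]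
  exact dV_comp_jetTransition hφ hφ' hψ hψ' hq (differentiableAt_of_contDiffOn
    (isOpen_jetDomain φ' ψ') (hL.contDiffOn hφ' hψ') (jetTransition_mem hq)) k α

theorem dX_locL_jetTransition (hL : IsKroneckerRegular h g L) {q : JCoord p n}
    (hφ : φ ∈ smoothCharts p T) (hφ' : φ' ∈ smoothCharts p T)
    (hψ : ψ ∈ smoothCharts n M) (hψ' : ψ' ∈ smoothCharts n M)
    (hq : q ∈ jetOverlap φ ψ φ' ψ') (k : Fin n) :
    dX k (locL L φ ψ) q
      = (∑ m, coordJac ψ ψ' q.2.1 m k * dX m (locL L φ' ψ') (jetTransition φ ψ φ' ψ' q))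
        + ∑ m, ∑ γ, dX k (fun r => (jetTransition φ ψ φ' ψ' r).2.2 m γ) q
          * dV m γ (locL L φ' ψ') (jetTransition φ ψ φ' ψ' q) := by
  rw [dX, (locL_eventuallyEq L hφ hφ' hψ hψ' hq).fderiv_eq]
  exact dX_comp_jetTransition hφ hφ' hψ hψ' hq (differentiableAt_of_contDiffOn
    (isOpen_jetDomain φ' ψ') (hL.contDiffOn hφ' hψ') (jetTransition_mem hq)) k

theorem hasFDerivAt_comp_fst {F : Rn p → ℝ} {q : JCoord p n} (hF : DifferentiableAt ℝ F q.1) :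
    HasFDerivAt (fun r : JCoord p n => F r.1)
      ((fderiv ℝ F q.1).comp (ContinuousLinearMap.fst ℝ _ _)) q :=
  HasFDerivAt.comp q (f := fun r : JCoord p n => r.1) hF.hasFDerivAt hasFDerivAt_fst

theorem hasFDerivAt_comp_snd_fst {F : Rn n → ℝ} {q : JCoord p n}
    (hF : DifferentiableAt ℝ F q.2.1) : HasFDerivAt (fun r : JCoord p n => F r.2.1)
      ((fderiv ℝ F q.2.1).comp
        ((ContinuousLinearMap.fst ℝ _ _).comp (ContinuousLinearMap.snd ℝ _ _))) q :=
  HasFDerivAt.comp q (f := fun r : JCoord p n => r.2.1) hF.hasFDerivAt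
    ((ContinuousLinearMap.fst ℝ (Rn n) (Fin n → Fin p → ℝ)).comp
      (ContinuousLinearMap.snd ℝ (Rn p) _)).hasFDerivAt

/-- Leibniz rule for the law of the momenta ∂L/∂x^k_α. The terms with a derivative of a Jacobian are
kept apart, since each of them cancels against another part of the Euler–Lagrange expression. -/
theorem fderiv_totalVec_dV_locL (hL : IsKroneckerRegular h g L) {q : JCoord p n}
    (hφ : φ ∈ smoothCharts p T) (hφ' : φ' ∈ smoothCharts p T)
    (hψ : ψ ∈ smoothCharts n M) (hψ' : ψ' ∈ smoothCharts n M)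
    (hq : q ∈ jetOverlap φ ψ φ' ψ') (k : Fin n) (α : Fin p) :
    fderiv ℝ (dV k α (locL L φ ψ)) q (totalVec q α)
      = ∑ m, ∑ γ, (coordJac ψ ψ' q.2.1 m k * (coordJacInv φ φ' q.1 α γ
            * fderiv ℝ (fun r => dV m γ (locL L φ' ψ') (jetTransition φ ψ φ' ψ' r)) q
              (totalVec q α))
          + dV m γ (locL L φ' ψ') (jetTransition φ ψ φ' ψ' q)
            * ((∑ j, coordHess ψ ψ' q.2.1 m k j * q.2.2 j α) * coordJacInv φ φ' q.1 α γ
              + coordJac ψ ψ' q.2.1 m k * coordJacInvDeriv φ φ' q.1 α γ α)) := by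
  obtain ⟨h1, h2⟩ := mem_jetOverlap.1 hq
  have e1 : dV k α (locL L φ ψ) =ᶠ[𝓝 q] fun r => ∑ m, ∑ γ,
      dV m γ (locL L φ' ψ') (jetTransition φ ψ φ' ψ' r)
        * coordJac ψ ψ' r.2.1 m k * coordJacInv φ φ' r.1 α γ := by
    filter_upwards [(isOpen_jetOverlap φ φ' ψ ψ').mem_nhds hq] with r hr
    exact dV_locL_jetTransition hL hφ hφ' hψ hψ' hr k α
  have e2 : ∀ m γ, DifferentiableAt ℝ
      (fun r => dV m γ (locL L φ' ψ') (jetTransition φ ψ φ' ψ' r)) q := fun m γ =>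
    (fderiv_comp_jetTransition hφ hφ' hψ hψ' hq (differentiableAt_of_contDiffOn
      (isOpen_jetDomain φ' ψ') (contDiffOn_dV (isOpen_jetDomain φ' ψ') (hL.contDiffOn hφ' hψ') m γ)
      (jetTransition_mem hq))).1
  have e3 := HasFDerivAt.fun_sum (u := Finset.univ) fun m _ =>
    HasFDerivAt.fun_sum (u := Finset.univ) fun γ _ =>
      ((e2 m γ).hasFDerivAt.fun_mul
        (hasFDerivAt_comp_snd_fst (differentiableAt_coordJac hψ hψ' h2 m k))).fun_mul
        (hasFDerivAt_comp_fst (differentiableAt_coordJacInv hφ hφ' h1 α γ))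
  rw [e1.fderiv_eq, e3.fderiv]
  simp only [add_apply, smul_apply, smul_eq_mul, sum_apply]
  refine Finset.sum_congr rfl fun m _ => Finset.sum_congr rfl fun γ _ => ?_
  have e4 : fderiv ℝ (fun x => coordJac ψ ψ' x m k) q.2.1 (WithLp.toLp 2 fun i => q.2.2 i α)
      = ∑ j, coordHess ψ ψ' q.2.1 m k j * q.2.2 j α := by
    rw [map_eq_sum_stdVec]
    exact Finset.sum_congr rfl fun j _ => mul_comm _ _
  simp only [ContinuousLinearMap.comp_apply, ContinuousLinearMap.coe_fst',
    ContinuousLinearMap.coe_snd']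
  rw [← e4]
  simp only [totalVec, coordJacInvDeriv]
  ring

/-- The total derivative `∂x̃^l_δ/∂t^α + x^i_α ∂x̃^l_δ/∂x^i` of the new velocities. -/
def totalDerivVel (φ φ' : LChart p T) (ψ ψ' : LChart n M) (q : JCoord p n) (α : Fin p)
    (l : Fin n) (δ : Fin p) : ℝ :=
  fderiv ℝ (fun r => (jetTransition φ ψ φ' ψ' r).2.2 l δ) q (totalVec q α)

/-- The field D_α depends on the coordinates only through its vertical part: its horizontal
components are pushed forward to those of the new field, and the discrepancy is the total derivative
of the new velocities. -/
theorem sum_fderiv_comp_totalVec {F : JCoord p n → ℝ} {q : JCoord p n}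
    (hφ : φ ∈ smoothCharts p T) (hφ' : φ' ∈ smoothCharts p T)
    (hψ : ψ ∈ smoothCharts n M) (hψ' : ψ' ∈ smoothCharts n M)
    (hq : q ∈ jetOverlap φ ψ φ' ψ')
    (hF : DifferentiableAt ℝ F (jetTransition φ ψ φ' ψ' q)) (γ : Fin p) :
    ∑ α, coordJacInv φ φ' q.1 α γ
        * fderiv ℝ (fun r => F (jetTransition φ ψ φ' ψ' r)) q (totalVec q α)
      = fderiv ℝ F (jetTransition φ ψ φ' ψ' q) (totalVec (jetTransition φ ψ φ' ψ' q) γ)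
        + ∑ l, ∑ δ, (∑ α, coordJacInv φ φ' q.1 α γ * totalDerivVel φ φ' ψ ψ' q α l δ)
          * dV l δ F (jetTransition φ ψ φ' ψ' q) := by
  obtain ⟨h1, h2⟩ := mem_jetOverlap.1 hq
  have e1 : ∑ α, coordJacInv φ φ' q.1 α γ • (fderiv ℝ (fun v => φ' (φ.symm v)) q.1 (stdVec α))
      = stdVec γ := by
    ext ν
    simp only [WithLp.ofLp_sum, WithLp.ofLp_smul, Finset.sum_apply, Pi.smul_apply, smul_eq_mul]
    have := coordJac_mul' hφ hφ' h1 ν γ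
    rw [stdVec_apply, ← this]
    exact Finset.sum_congr rfl fun _ _ => mul_comm _ _
  have e2 : ∑ α, coordJacInv φ φ' q.1 α γ • (fderiv ℝ (fun v => ψ' (ψ.symm v)) q.2.1
        (WithLp.toLp 2 fun i => q.2.2 i α))
      = WithLp.toLp 2 fun i => (jetTransition φ ψ φ' ψ' q).2.2 i γ := by
    ext k
    simp only [WithLp.ofLp_sum, WithLp.ofLp_smul, Finset.sum_apply, Pi.smul_apply, smul_eq_mul,
      fderiv_trans_apply, jetTransition_snd_snd, Finset.mul_sum]
    rw [Finset.sum_comm]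
    exact Finset.sum_congr rfl fun _ _ => Finset.sum_congr rfl fun _ _ => by ring
  have e3 : ∀ α, fderiv ℝ (fun r => F (jetTransition φ ψ φ' ψ' r)) q (totalVec q α) = _ :=
    fun α => (fderiv_comp_jetTransition hφ hφ' hψ hψ' hq hF).2 (totalVec q α)
  -- An identity of tangent vectors: the combination of pushed-forward vectors equals the new total
  -- vector plus a vertical one. Applying the derivative of `F` to it gives the claim.
  have e4 : ∑ α, coordJacInv φ φ' q.1 α γ • ((fderiv ℝ (fun v => φ' (φ.symm v)) q.1 (stdVec α),
      fderiv ℝ (fun v => ψ' (ψ.symm v)) q.2.1 (WithLp.toLp 2 fun i => q.2.2 i α),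
        fun k γ => totalDerivVel φ φ' ψ ψ' q α k γ) : JCoord p n)
      = totalVec (jetTransition φ ψ φ' ψ' q) γ
        + (0, 0, fun l δ => ∑ α, coordJacInv φ φ' q.1 α γ * totalDerivVel φ φ' ψ ψ' q α l δ) := by
    refine Prod.ext ?_ (Prod.ext ?_ ?_)
    · simp only [Prod.fst_sum, Prod.smul_fst, Prod.fst_add, e1, totalVec, add_zero]
    · simp only [Prod.fst_sum, Prod.snd_sum, Prod.smul_fst, Prod.smul_snd, Prod.fst_add,
        Prod.snd_add, e2, totalVec, add_zero]
    · ext l δ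
      simp [Prod.snd_sum, totalVec, Finset.sum_apply]
  have e5 := congrArg (fderiv ℝ F (jetTransition φ ψ φ' ψ' q)) e4
  rw [map_sum, map_add] at e5
  simp only [map_smul, smul_eq_mul] at e5
  rw [fderiv_eq_sum F _ (0, 0, _)] at e5
  simp only [PiLp.zero_apply, zero_mul, Finset.sum_const_zero, zero_add] at e5
  simp only [e3]
  exact e5

/-- H^δ_{γδ} is the logarithmic derivative of the volume density, so its law contains the divergence
of the inverse Jacobian. The proof takes a trace in `christoffelH_coordJacInv`. -/
theorem sum_christoffelH_trans (hφ : φ ∈ smoothCharts p T) (hφ' : φ' ∈ smoothCharts p T)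
    {t : Rn p} (ht : t ∈ transDom φ φ') (γ : Fin p) :
    (∑ α, coordJacInvDeriv φ φ' t α γ α)
      + ∑ α, coordJacInv φ φ' t α γ * ∑ δ, christoffelH h φ t δ α δ
      = ∑ δ, christoffelH h φ' (φ' (φ.symm t)) δ γ δ := by
  have hCA : ∀ μ δ, ∑ β, coordJacInv φ φ' t μ β * coordJac φ φ' t β δ = if μ = δ then 1 else 0 :=
    fun μ δ => coordJac_mul hφ hφ' ht μ δ
  have hAC : ∀ β ε, ∑ δ, coordJac φ φ' t β δ * coordJacInv φ φ' t δ ε = if β = ε then 1 else 0 :=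
    fun β ε => coordJac_mul' hφ hφ' ht β ε
  have h1 : ∑ δ, ∑ β, coordJac φ φ' t β δ
        * ∑ ε, coordJacInv φ φ' t δ ε * christoffelH h φ' (φ' (φ.symm t)) ε γ β
      = ∑ δ, christoffelH h φ' (φ' (φ.symm t)) δ γ δ := by
    calc _ = ∑ β, ∑ ε, (∑ δ, coordJac φ φ' t β δ * coordJacInv φ φ' t δ ε)
          * christoffelH h φ' (φ' (φ.symm t)) ε γ β := by
          simp only [Finset.mul_sum, Finset.sum_mul]
          rw [sum_rotate]
          exact Finset.sum_congr rfl fun _ _ => Finset.sum_congr rfl fun _ _ =>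
            Finset.sum_congr rfl fun _ _ => by ring
      _ = _ := by simp [hAC]
  rw [← h1]
  simp only [christoffelH_coordJacInv h hφ hφ' ht, mul_add, Finset.sum_add_distrib]
  rw [add_comm]
  congr 1
  · symm
    calc _ = ∑ δ, ∑ α, ∑ μ, christoffelH h φ t δ α μ * coordJacInv φ φ' t α γ
          * ∑ β, coordJacInv φ φ' t μ β * coordJac φ φ' t β δ := by
          refine Finset.sum_congr rfl fun δ _ => ?_
          simp only [Finset.mul_sum]
          rw [sum_rotate]
          exact Finset.sum_congr rfl fun _ _ => Finset.sum_congr rfl fun _ _ =>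
            Finset.sum_congr rfl fun _ _ => by ring
      _ = _ := by
          simp only [hCA, mul_ite, mul_one, mul_zero, Finset.sum_ite_eq', Finset.mem_univ, if_true,
            Finset.mul_sum]
          rw [Finset.sum_comm]
          exact Finset.sum_congr rfl fun _ _ => Finset.sum_congr rfl fun _ _ => by ring
  · symm
    calc _ = ∑ δ, ∑ μ, coordJacInvDeriv φ φ' t δ γ μ
          * ∑ β, coordJacInv φ φ' t μ β * coordJac φ φ' t β δ := by
          refine Finset.sum_congr rfl fun δ _ => ?_
          simp only [Finset.mul_sum]
          rw [Finset.sum_comm]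
          exact Finset.sum_congr rfl fun _ _ => Finset.sum_congr rfl fun _ _ => by ring
      _ = _ := by simp [hCA]

end TraceTransformation

/-- The new velocities divided by the Jacobian of the change of coordinates on `M`:
`(∂t^α/∂t̃^γ) x^i_α`. -/
def pullVel {p n : ℕ} {T : Type*} [TopologicalSpace T] (φ φ' : LChart p T) (q : JCoord p n) (i : Fin n) (γ : Fin p) : ℝ :=
  ∑ α, coordJacInv φ φ' q.1 α γ * q.2.2 i α

theorem jetTransition_eq_pullVel {p n : ℕ} {T M : Type*} [TopologicalSpace T]
    [TopologicalSpace M] {φ φ' : LChart p T} {ψ ψ' : LChart n M} (q : JCoord p n) (k : Fin n) (γ : Fin p) :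
    (jetTransition φ ψ φ' ψ' q).2.2 k γ
      = ∑ j, coordJac ψ ψ' q.2.1 k j * pullVel φ φ' q j γ := by
  rw [jetTransition_snd_snd]
  simp only [pullVel, Finset.mul_sum, mul_assoc]

/-! ### The transformation law of the trace 𝒢. -/

section TraceLaw

variable {p n : ℕ} {T M : Type*} [TopologicalSpace T] [ChartedSpace (Rn p) T]
  [TopologicalSpace M] [ChartedSpace (Rn n) M]
  {h : SemiRiemannianMetric p T} {g : SpatialDMetric p n T M} {L : Jet p n T M → ℝ}
  {φ φ' : LChart p T} {ψ ψ' : LChart n M}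

/-- The trace `h̃^{γδ} (∂t^α/∂t̃^γ) D_α x̃^l_δ` of the total derivatives of the new velocities. -/
def traceVel (h : SemiRiemannianMetric p T) (φ φ' : LChart p T) (ψ ψ' : LChart n M)
    (q : JCoord p n) (l : Fin n) : ℝ :=
  ∑ γ, ∑ δ, hUp h φ' (φ' (φ.symm q.1)) γ δ
    * ∑ α, coordJacInv φ φ' q.1 α γ * totalDerivVel φ φ' ψ ψ' q α l δ

/-- The second derivatives of x̃ cancel between D_α of the momenta and ∂L/∂x^k, and the derivatives
of ∂t/∂t̃ are absorbed by the Christoffel trace. Only the vertical discrepancy of D_α survives. It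
is paired with the velocity Hessian of L, which by regularity is 2 h ⊗ g. -/
theorem elTerm_jetTransition (hL : IsKroneckerRegular h g L) {q : JCoord p n}
    (hφ : φ ∈ smoothCharts p T) (hφ' : φ' ∈ smoothCharts p T)
    (hψ : ψ ∈ smoothCharts n M) (hψ' : ψ' ∈ smoothCharts n M)
    (hq : q ∈ jetOverlap φ ψ φ' ψ') (k : Fin n) :
    elTerm h L φ ψ q k = ∑ m, coordJac ψ ψ' q.2.1 m k
      * (elTerm h L φ' ψ' (jetTransition φ ψ φ' ψ' q) m
        + 2 * ∑ l, gLow g φ' ψ' (jetTransition φ ψ φ' ψ' q) m l * traceVel h φ φ' ψ ψ' q l) := by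
  obtain ⟨h1, h2⟩ := mem_jetOverlap.1 hq
  set q' := jetTransition φ ψ φ' ψ' q with hq'
  have hmem : q' ∈ jetDomain φ' ψ' := jetTransition_mem hq
  have ho := isOpen_jetDomain (p := p) (n := n) φ' ψ'
  set P : Fin n → Fin p → ℝ := fun m γ => dV m γ (locL L φ' ψ') q' with hP
  -- the derivative of the momenta along the total derivatives
  have e1 : ∑ α, fderiv ℝ (dV k α (locL L φ ψ)) q (totalVec q α)
      = (∑ m, coordJac ψ ψ' q.2.1 m k * ∑ γ, (fderiv ℝ (dV m γ (locL L φ' ψ')) q' (totalVec q' γ)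
          + ∑ l, ∑ δ, (∑ α, coordJacInv φ φ' q.1 α γ * totalDerivVel φ φ' ψ ψ' q α l δ)
            * dV l δ (dV m γ (locL L φ' ψ')) q'))
        + (∑ m, ∑ γ, P m γ * ∑ α, ∑ j, coordHess ψ ψ' q.2.1 m k j * q.2.2 j α
            * coordJacInv φ φ' q.1 α γ)
        + ∑ m, ∑ γ, P m γ * coordJac ψ ψ' q.2.1 m k * ∑ α, coordJacInvDeriv φ φ' q.1 α γ α := by
    simp only [fderiv_totalVec_dV_locL hL hφ hφ' hψ hψ' hq]
    rw [sum_rotate]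
    simp only [Finset.mul_sum]
    rw [← Finset.sum_add_distrib, ← Finset.sum_add_distrib]
    refine Finset.sum_congr rfl fun m _ => ?_
    rw [← Finset.sum_add_distrib, ← Finset.sum_add_distrib]
    refine Finset.sum_congr rfl fun γ _ => ?_
    rw [← sum_fderiv_comp_totalVec hφ hφ' hψ hψ' hq (differentiableAt_of_contDiffOn ho
      (contDiffOn_dV ho (hL.contDiffOn hφ' hψ') m γ) hmem) γ, Finset.mul_sum,
      ← Finset.sum_add_distrib, ← Finset.sum_add_distrib]
    refine Finset.sum_congr rfl fun α _ => ?_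
    simp only [← Finset.mul_sum, ← Finset.sum_mul, hP]
    ring
  have e2 : dX k (locL L φ ψ) q = (∑ m, coordJac ψ ψ' q.2.1 m k * dX m (locL L φ' ψ') q')
      + ∑ m, ∑ γ, P m γ * ∑ α, ∑ j, coordHess ψ ψ' q.2.1 m k j * q.2.2 j α
            * coordJacInv φ φ' q.1 α γ := by
    rw [dX_locL_jetTransition hL hφ hφ' hψ hψ' hq]
    congr 1
    refine Finset.sum_congr rfl fun m _ => Finset.sum_congr rfl fun γ _ => ?_
    rw [dX_jetTransition hφ hφ' hψ hψ' hq, mul_comm, Finset.sum_comm]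
    congr 1
    refine Finset.sum_congr rfl fun α _ => Finset.sum_congr rfl fun j _ => ?_
    rw [coordHess_comm hψ hψ' h2]
    ring
  have e3 : ∑ α, ∑ γ, dV k α (locL L φ ψ) q * christoffelH h φ q.1 γ α γ
      = ∑ m, ∑ γ, P m γ * coordJac ψ ψ' q.2.1 m k
        * ∑ α, coordJacInv φ φ' q.1 α γ * ∑ δ, christoffelH h φ q.1 δ α δ := by
    simp only [dV_locL_jetTransition hL hφ hφ' hψ hψ' hq, ← Finset.mul_sum]
    simp only [Finset.sum_mul]
    rw [sum_rotate]
    refine Finset.sum_congr rfl fun m _ => Finset.sum_congr rfl fun γ _ => ?_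
    rw [Finset.mul_sum]
    exact Finset.sum_congr rfl fun _ _ => by ring
  -- The divergence of the inverse Jacobian and the old Christoffel trace combine into the new
  -- Christoffel trace.
  have e4 : (∑ m, ∑ γ, P m γ * coordJac ψ ψ' q.2.1 m k * ∑ α, coordJacInvDeriv φ φ' q.1 α γ α)
      + (∑ m, ∑ γ, P m γ * coordJac ψ ψ' q.2.1 m k
        * ∑ α, coordJacInv φ φ' q.1 α γ * ∑ δ, christoffelH h φ q.1 δ α δ)
      = ∑ m, coordJac ψ ψ' q.2.1 m k * ∑ γ, ∑ δ, P m γ * christoffelH h φ' q'.1 δ γ δ := by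
    rw [← Finset.sum_add_distrib]
    refine Finset.sum_congr rfl fun m _ => ?_
    rw [← Finset.sum_add_distrib, Finset.mul_sum]
    refine Finset.sum_congr rfl fun γ _ => ?_
    rw [← mul_add, sum_christoffelH_trans hφ hφ' h1, ← Finset.mul_sum, hq']
    simp only [jetTransition]
    ring
  -- Kronecker regularity enters here: the Hessian of L separates its time indices from its space
  -- indices, so the vertical discrepancy appears only through its trace.
  have e5 : ∀ m, ∑ γ, ∑ l, ∑ δ, (∑ α, coordJacInv φ φ' q.1 α γ
        * totalDerivVel φ φ' ψ ψ' q α l δ) * dV l δ (dV m γ (locL L φ' ψ')) q'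
      = 2 * ∑ l, gLow g φ' ψ' q' m l * traceVel h φ φ' ψ ψ' q l := by
    intro m
    rw [Finset.sum_comm, Finset.mul_sum]
    refine Finset.sum_congr rfl fun l _ => ?_
    simp only [traceVel]
    rw [← mul_assoc, Finset.mul_sum]
    refine Finset.sum_congr rfl fun γ _ => ?_
    rw [Finset.mul_sum]
    refine Finset.sum_congr rfl fun δ _ => ?_
    rw [hL.dV_dV hφ' hψ' hmem, gLow_comm g φ' ψ' q' l m, hUp_comm h φ' q'.1 δ γ, hq']
    simp only [jetTransition]
    ring
  rw [elTerm, e1, e2, e3]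
  simp only [Finset.sum_add_distrib, e5]
  simp only [elTerm, mul_add, mul_sub, Finset.sum_add_distrib, Finset.sum_sub_distrib]
  simp only [hP] at e4 ⊢
  linarith [e4]

/-- The inhomogeneous term in the transformation law of spatial sprays. -/
def hessVel (φ φ' : LChart p T) (ψ ψ' : LChart n M) (q : JCoord p n) (k : Fin n)
    (γ β : Fin p) : ℝ :=
  ∑ i, ∑ j, coordHess ψ ψ' q.2.1 k j i * pullVel φ φ' q j γ * pullVel φ φ' q i β

theorem dX_jetTransition_eq_pullVel {q : JCoord p n}
    (hφ : φ ∈ smoothCharts p T) (hφ' : φ' ∈ smoothCharts p T)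
    (hψ : ψ ∈ smoothCharts n M) (hψ' : ψ' ∈ smoothCharts n M)
    (hq : q ∈ jetOverlap φ ψ φ' ψ') (k : Fin n) (γ : Fin p) (i : Fin n) :
    dX i (fun r => (jetTransition φ ψ φ' ψ' r).2.2 k γ) q
      = ∑ j, coordHess ψ ψ' q.2.1 k j i * pullVel φ φ' q j γ := by
  rw [dX_jetTransition hφ hφ' hψ hψ' hq]
  simp only [pullVel, Finset.mul_sum, mul_assoc]

theorem hUp_coordJacInv (h : SemiRiemannianMetric p T) (hφ : φ ∈ smoothCharts p T)
    (hφ' : φ' ∈ smoothCharts p T) {t : Rn p} (ht : t ∈ transDom φ φ') (α β : Fin p) :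
    ∑ μ, ∑ ν, hUp h φ' (φ' (φ.symm t)) μ ν * coordJacInv φ φ' t α μ * coordJacInv φ φ' t β ν
      = hUp h φ t α β := by
  have := hUp_trans h hφ' hφ (trans_mem ht) α β
  rw [trans_trans ht] at this
  rw [← this]
  exact Finset.sum_congr rfl fun _ _ => Finset.sum_congr rfl fun _ _ => by
    simp only [coordJacInv]; ring

theorem hLow_coordJacInv (h : SemiRiemannianMetric p T) (hφ : φ ∈ smoothCharts p T)
    (hφ' : φ' ∈ smoothCharts p T) {t : Rn p} (ht : t ∈ transDom φ φ') (γ β : Fin p) :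
    ∑ α, ∑ μ, hLow h φ t α μ * coordJacInv φ φ' t α γ * coordJacInv φ φ' t μ β
      = hLow h φ' (φ' (φ.symm t)) γ β := by
  have := hLow_trans h hφ' hφ (trans_mem ht) γ β
  rw [trans_trans ht] at this
  exact this.symm

/-- The law of the trace of the temporal components. -/
theorem trace_christoffelH_trans {q : JCoord p n}
    (hφ : φ ∈ smoothCharts p T) (hφ' : φ' ∈ smoothCharts p T)
    (hψ : ψ ∈ smoothCharts n M) (hψ' : ψ' ∈ smoothCharts n M)
    (hq : q ∈ jetOverlap φ ψ φ' ψ') (k : Fin n) :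
    ∑ γ, ∑ β, ∑ ε, hUp h φ' (φ' (φ.symm q.1)) γ β * christoffelH h φ' (φ' (φ.symm q.1)) ε γ β
        * (jetTransition φ ψ φ' ψ' q).2.2 k ε
      = (∑ j, coordJac ψ ψ' q.2.1 k j * ∑ α, ∑ μ, ∑ δ, hUp h φ q.1 α μ
          * christoffelH h φ q.1 δ α μ * q.2.2 j δ)
        + ∑ γ, ∑ β, hUp h φ' (φ' (φ.symm q.1)) γ β
          * ∑ μ, coordJacInv φ φ' q.1 μ γ
            * dT μ (fun r => (jetTransition φ ψ φ' ψ' r).2.2 k β) q := by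
  obtain ⟨h1, h2⟩ := mem_jetOverlap.1 hq
  have e1 : ∀ γ β, ∑ ε, christoffelH h φ' (φ' (φ.symm q.1)) ε γ β
        * (jetTransition φ ψ φ' ψ' q).2.2 k ε
      = (∑ j, coordJac ψ ψ' q.2.1 k j * ∑ α, ∑ μ, coordJacInv φ φ' q.1 α γ
          * coordJacInv φ φ' q.1 μ β * ∑ δ, christoffelH h φ q.1 δ α μ * q.2.2 j δ)
        + ∑ μ, coordJacInv φ φ' q.1 μ β
          * dT μ (fun r => (jetTransition φ ψ φ' ψ' r).2.2 k γ) q := by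
    intro γ β
    -- The untraced law is that of the temporal spray, up to the factor −½. The remaining work is
    -- the contraction with the new h^{γβ}.
    have := (isTemporalSpray_canonicalH (M := M) (n := n) h).2 φ hφ ψ hψ φ' hφ' ψ' hψ' q hq k γ β
    have e2 : ∑ j, ∑ α, ∑ μ, 2 * canonicalH h φ ψ q j α μ * coordJac φ' φ (φ' (φ.symm q.1)) α γ
        * coordJac φ' φ (φ' (φ.symm q.1)) μ β * coordJac ψ ψ' q.2.1 k j
      = -(∑ j, coordJac ψ ψ' q.2.1 k j * ∑ α, ∑ μ, coordJacInv φ φ' q.1 α γ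
          * coordJacInv φ φ' q.1 μ β * ∑ δ, christoffelH h φ q.1 δ α μ * q.2.2 j δ) := by
      rw [← Finset.sum_neg_distrib]
      refine Finset.sum_congr rfl fun j _ => ?_
      rw [← mul_neg, ← Finset.sum_neg_distrib, Finset.mul_sum]
      refine Finset.sum_congr rfl fun α _ => ?_
      rw [← Finset.sum_neg_distrib, Finset.mul_sum]
      refine Finset.sum_congr rfl fun μ _ => ?_
      simp only [canonicalH, coordJacInv]
      ring
    rw [e2] at this
    simp only [canonicalH] at this
    simp only [coordJacInv] at this ⊢
    simp only [jetTransition] at this ⊢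
    linarith
  have e3 : ∀ γ β, ∑ ε, hUp h φ' (φ' (φ.symm q.1)) γ β
        * christoffelH h φ' (φ' (φ.symm q.1)) ε γ β * (jetTransition φ ψ φ' ψ' q).2.2 k ε
      = hUp h φ' (φ' (φ.symm q.1)) γ β * ∑ ε, christoffelH h φ' (φ' (φ.symm q.1)) ε γ β
        * (jetTransition φ ψ φ' ψ' q).2.2 k ε := fun γ β => by
    simp only [Finset.mul_sum, mul_assoc]
  simp only [e3, e1, mul_add, Finset.sum_add_distrib]
  congr 1
  · calc _ = ∑ j, ∑ α, ∑ μ, (∑ γ, ∑ β, hUp h φ' (φ' (φ.symm q.1)) γ β * coordJacInv φ φ' q.1 α γ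
          * coordJacInv φ φ' q.1 μ β) * (coordJac ψ ψ' q.2.1 k j
            * ∑ δ, christoffelH h φ q.1 δ α μ * q.2.2 j δ) := by
          calc _ = ∑ γ, ∑ β, ∑ j, ∑ α, ∑ μ, hUp h φ' (φ' (φ.symm q.1)) γ β
                * coordJacInv φ φ' q.1 α γ * coordJacInv φ φ' q.1 μ β * (coordJac ψ ψ' q.2.1 k j
                * ∑ δ, christoffelH h φ q.1 δ α μ * q.2.2 j δ) := by
                refine Finset.sum_congr rfl fun γ _ => Finset.sum_congr rfl fun β _ => ?_
                rw [Finset.mul_sum]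
                refine Finset.sum_congr rfl fun j _ => ?_
                rw [Finset.mul_sum, Finset.mul_sum]
                refine Finset.sum_congr rfl fun α _ => ?_
                rw [Finset.mul_sum, Finset.mul_sum]
                exact Finset.sum_congr rfl fun μ _ => by ring
            _ = ∑ j, ∑ γ, ∑ β, ∑ α, ∑ μ, hUp h φ' (φ' (φ.symm q.1)) γ β
                * coordJacInv φ φ' q.1 α γ * coordJacInv φ φ' q.1 μ β * (coordJac ψ ψ' q.2.1 k j
                * ∑ δ, christoffelH h φ q.1 δ α μ * q.2.2 j δ) := (sum_rotate _).symm
            _ = _ := by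
                refine Finset.sum_congr rfl fun j _ => ?_
                simp only [Finset.sum_mul]
                calc _ = ∑ γ, ∑ α, ∑ μ, ∑ β, hUp h φ' (φ' (φ.symm q.1)) γ β
                      * coordJacInv φ φ' q.1 α γ * coordJacInv φ φ' q.1 μ β
                      * (coordJac ψ ψ' q.2.1 k j
                        * ∑ δ, christoffelH h φ q.1 δ α μ * q.2.2 j δ) :=
                      Finset.sum_congr rfl fun _ _ => sum_rotate _
                  _ = _ := sum_rotate _
    _ = _ := by
          simp only [hUp_coordJacInv h hφ hφ' h1]
          refine Finset.sum_congr rfl fun j _ => ?_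
          simp only [Finset.mul_sum]
          exact Finset.sum_congr rfl fun _ _ => Finset.sum_congr rfl fun _ _ =>
            Finset.sum_congr rfl fun _ _ => by ring
  · rw [Finset.sum_comm]
    exact Finset.sum_congr rfl fun _ _ => Finset.sum_congr rfl fun _ _ => by rw [hUp_comm]

/-- The total derivative of the new velocities splits into its time part, which also occurs in the
law of the Christoffel trace, and its space part, which is the inhomogeneous term of a spatial
spray. -/
theorem traceVel_eq {q : JCoord p n}
    (hφ : φ ∈ smoothCharts p T) (hφ' : φ' ∈ smoothCharts p T)
    (hψ : ψ ∈ smoothCharts n M) (hψ' : ψ' ∈ smoothCharts n M)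
    (hq : q ∈ jetOverlap φ ψ φ' ψ') (k : Fin n) :
    traceVel h φ φ' ψ ψ' q k
      = (∑ γ, ∑ β, hUp h φ' (φ' (φ.symm q.1)) γ β
          * ∑ μ, coordJacInv φ φ' q.1 μ γ
            * dT μ (fun r => (jetTransition φ ψ φ' ψ' r).2.2 k β) q)
        + ∑ γ, ∑ β, hUp h φ' (φ' (φ.symm q.1)) γ β * hessVel φ φ' ψ ψ' q k γ β := by
  simp only [traceVel, totalDerivVel, fderiv_totalVec, mul_add, Finset.sum_add_distrib]
  congr 1
  rw [Finset.sum_comm]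
  refine Finset.sum_congr rfl fun β _ => Finset.sum_congr rfl fun γ _ => ?_
  rw [hUp_comm]
  congr 1
  simp only [dX_jetTransition_eq_pullVel hφ hφ' hψ hψ' hq, hessVel]
  simp only [Finset.mul_sum]
  rw [sum_rotate]
  refine Finset.sum_congr rfl fun i _ => Finset.sum_congr rfl fun j _ => ?_
  rw [show pullVel φ φ' q i γ = ∑ α, coordJacInv φ φ' q.1 α γ * q.2.2 i α from rfl,
    Finset.mul_sum]
  exact Finset.sum_congr rfl fun _ _ => by ring

/-- The transformation law of the trace of the canonical spatial spray. -/
theorem traceG_jetTransition (hL : IsKroneckerRegular h g L) {q : JCoord p n}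
    (hφ : φ ∈ smoothCharts p T) (hφ' : φ' ∈ smoothCharts p T)
    (hψ : ψ ∈ smoothCharts n M) (hψ' : ψ' ∈ smoothCharts n M)
    (hq : q ∈ jetOverlap φ ψ φ' ψ') (k : Fin n) :
    2 * traceG h g L φ' ψ' k (jetTransition φ ψ φ' ψ' q)
      = 2 * (∑ j, coordJac ψ ψ' q.2.1 k j * traceG h g L φ ψ j q)
        - ∑ γ, ∑ β, hUp h φ' (φ' (φ.symm q.1)) γ β * hessVel φ φ' ψ ψ' q k γ β := by
  set q' := jetTransition φ ψ φ' ψ' q with hq'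
  have hmem : q' ∈ jetDomain φ' ψ' := jetTransition_mem hq
  have h2 : ∀ l, ∑ m, gUp g φ' ψ' q' k m * gLow g φ' ψ' q' m l = if k = l then 1 else 0 := fun l =>
    sum_inv_mul_apply (det_gLow_ne_zero g hψ' hmem) k l
  have e1 : ∑ m, gUp g φ' ψ' q' k m * ∑ l, gLow g φ' ψ' q' m l * traceVel h φ φ' ψ ψ' q l
      = traceVel h φ φ' ψ ψ' q k := by
    simp only [Finset.mul_sum, ← mul_assoc]
    rw [Finset.sum_comm]
    simp only [← Finset.sum_mul, h2]
    simp
  -- The covector law of `elTerm` with the index raised: the discrepancy 2 g_{ml} `traceVel` loses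
  -- its factor g.
  have e2 : ∑ j, coordJac ψ ψ' q.2.1 k j * ∑ l, gUp g φ ψ q j l * elTerm h L φ ψ q l
      = (∑ m, gUp g φ' ψ' q' k m * elTerm h L φ' ψ' q' m) + 2 * traceVel h φ φ' ψ ψ' q k := by
    have e3 : ∀ v : Fin n → ℝ, ∑ j, coordJac ψ ψ' q.2.1 k j
        * ∑ l, gUp g φ ψ q j l * ∑ m, coordJac ψ ψ' q.2.1 m l * v m
        = ∑ m, gUp g φ' ψ' q' k m * v m := by
      intro v
      simp only [hq', ← gUp_jetTransition g hφ hφ' hψ hψ' hq, Finset.sum_mul, Finset.mul_sum]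
      symm
      rw [sum_rotate]
      exact Finset.sum_congr rfl fun _ _ => Finset.sum_congr rfl fun _ _ =>
        Finset.sum_congr rfl fun _ _ => by ring
    simp only [elTerm_jetTransition hL hφ hφ' hψ hψ' hq]
    rw [e3, ← e1, Finset.mul_sum, ← Finset.sum_add_distrib]
    exact Finset.sum_congr rfl fun _ _ => by ring
  -- The time derivatives of the new velocities occur in `e4` and in `e5`. They enter 2𝒢 with
  -- opposite signs, so that only the term with `hessVel` is left.
  have e4 := trace_christoffelH_trans (h := h) hφ hφ' hψ hψ' hq k
  have e5 := traceVel_eq (h := h) hφ hφ' hψ hψ' hq k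
  have e6 : q'.1 = φ' (φ.symm q.1) := rfl
  simp only [traceG, mul_add, Finset.sum_add_distrib, mul_left_comm _ (1 / 4 : ℝ),
    mul_left_comm _ (1 / 2 : ℝ), ← Finset.mul_sum, e6]
  rw [e4, e2]
  linarith

end TraceLaw

/-! ### The spatial spray. -/

section SpatialSpray

variable {p n : ℕ} {T M : Type*} [TopologicalSpace T] [ChartedSpace (Rn p) T]
  [TopologicalSpace M] [ChartedSpace (Rn n) M]
  {h : SemiRiemannianMetric p T} {g : SpatialDMetric p n T M} {L : Jet p n T M → ℝ}
  {φ φ' : LChart p T} {ψ ψ' : LChart n M}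

/-- Freezing t and the velocities turns g_{ij} into a matrix function of x alone, to which the
Christoffel theory for charts of `M` applies. -/
theorem dX_eq_fderiv_slice {F : JCoord p n → ℝ} {q : JCoord p n} (hF : DifferentiableAt ℝ F q)
    (i : Fin n) : dX i F q = fderiv ℝ (fun x => F (q.1, x, q.2.2)) q.2.1 (stdVec i) := by
  have h1 : HasFDerivAt (fun x : Rn n => ((q.1, x, q.2.2) : JCoord p n))
      ((0 : Rn n →L[ℝ] Rn p).prod ((ContinuousLinearMap.id ℝ (Rn n)).prod 0)) q.2.1 :=
    (hasFDerivAt_const q.1 q.2.1).prodMk ((hasFDerivAt_id q.2.1).prodMk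
      (hasFDerivAt_const q.2.2 q.2.1))
  have h2 := HasFDerivAt.comp q.2.1 (g := F) hF.hasFDerivAt h1
  have h3 : fderiv ℝ (fun x => F (q.1, x, q.2.2)) q.2.1 = _ := h2.fderiv
  rw [h3]
  rfl

theorem dT_eq_fderiv_slice {F : JCoord p n → ℝ} {q : JCoord p n} (hF : DifferentiableAt ℝ F q)
    (α : Fin p) : dT α F q = fderiv ℝ (fun t => F (t, q.2.1, q.2.2)) q.1 (stdVec α) := by
  have h1 : HasFDerivAt (fun t : Rn p => ((t, q.2.1, q.2.2) : JCoord p n))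
      ((ContinuousLinearMap.id ℝ (Rn p)).prod ((0 : Rn p →L[ℝ] Rn n).prod 0)) q.1 :=
    (hasFDerivAt_id q.1).prodMk ((hasFDerivAt_const q.2.1 q.1).prodMk
      (hasFDerivAt_const q.2.2 q.1))
  have h2 := HasFDerivAt.comp q.1 (g := F) hF.hasFDerivAt h1
  have h3 : fderiv ℝ (fun t => F (t, q.2.1, q.2.2)) q.1 = _ := h2.fderiv
  rw [h3]
  rfl

theorem christoffelG_eq {q : JCoord p n} (hφ : φ ∈ smoothCharts p T)
    (hψ : ψ ∈ smoothCharts n M) (hq : q ∈ jetDomain φ ψ) :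
    christoffelG g φ ψ q = chrUp (gLow g φ ψ q)
      (dMat (fun x => gLow g φ ψ (q.1, x, q.2.2)) q.2.1) := by
  have h1 : ∀ a i j, dX a (fun r => gLow g φ ψ r i j) q
      = dMat (fun x => gLow g φ ψ (q.1, x, q.2.2)) q.2.1 a i j := fun a i j =>
    dX_eq_fderiv_slice (differentiableAt_of_contDiffOn (isOpen_jetDomain φ ψ)
      (contDiffOn_gLow g hφ hψ i j) hq) a
  funext l j k
  refine Finset.sum_congr rfl fun i _ => ?_
  simp only [h1, chrLow, gUp]
  ring

/-- For `p ≥ 2` the components `Γ^i_{jk}` transform as a linear connection. -/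
theorem christoffelG_trans (hp : 2 ≤ p) (hL : IsKroneckerRegular h g L) {q : JCoord p n}
    (hφ : φ ∈ smoothCharts p T) (hφ' : φ' ∈ smoothCharts p T)
    (hψ : ψ ∈ smoothCharts n M) (hψ' : ψ' ∈ smoothCharts n M)
    (hq : q ∈ jetOverlap φ ψ φ' ψ') (c a b : Fin n) :
    ∑ k, coordJac ψ ψ' q.2.1 c k * christoffelG g φ ψ q k a b
      = (∑ d, ∑ e, christoffelG g φ' ψ' (jetTransition φ ψ φ' ψ' q) c d e
          * coordJac ψ ψ' q.2.1 d a * coordJac ψ ψ' q.2.1 e b)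
        + coordHess ψ ψ' q.2.1 c a b := by
  obtain ⟨h1, h2⟩ := mem_jetOverlap.1 hq
  set q' := jetTransition φ ψ φ' ψ' q with hq'
  have hmem : q' ∈ jetDomain φ' ψ' := jetTransition_mem hq
  rw [christoffelG_eq hφ hψ hq.1, christoffelG_eq hφ' hψ' hmem]
  -- On the slice the new velocities stay fixed, whereas the genuine change of coordinates moves
  -- them with x. The tensor law still holds along the slice because g does not depend on
  -- velocities, which needs p ≥ 2.
  have hG : ∀ v ∈ transDom ψ ψ', ∀ a b, gLow g φ ψ (q.1, v, q.2.2) a b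
      = ∑ c, ∑ d, gLow g φ' ψ' (q'.1, ψ' (ψ.symm v), q'.2.2) c d
        * coordJac ψ ψ' v c a * coordJac ψ ψ' v d b := by
    intro v hv a b
    have hv' : ((q.1, v, q.2.2) : JCoord p n) ∈ jetOverlap φ ψ φ' ψ' :=
      mem_jetOverlap.2 ⟨h1, hv⟩
    rw [gLow_jetTransition g hφ hφ' hψ hψ' hv' a b,
      hL.gLow_zeroJet hp hφ' hψ' (jetTransition_mem hv'),
      hL.gLow_zeroJet hp hφ' hψ' (q := (q'.1, ψ' (ψ.symm v), q'.2.2))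
        ⟨hmem.1, (trans_mem hv).1⟩]
    rfl
  exact chrUp_coord_trans (G := fun x => gLow g φ ψ (q.1, x, q.2.2))
    (Gt := fun x => gLow g φ' ψ' (q'.1, x, q'.2.2)) hψ hψ' h2
    (fun a b => by
      have h3 : DifferentiableAt ℝ (fun r => gLow g φ' ψ' r a b) q' :=
        differentiableAt_of_contDiffOn (isOpen_jetDomain φ' ψ') (contDiffOn_gLow g hφ' hψ' a b) hmem
      exact DifferentiableAt.comp (ψ' (ψ.symm q.2.1)) (g := fun r => gLow g φ' ψ' r a b)
        (f := fun x : Rn n => ((q'.1, x, q'.2.2) : JCoord p n)) h3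
        ((differentiableAt_const _).prodMk (differentiableAt_id.prodMk (differentiableAt_const _))))
    (fun v a b => gLow_comm _ _ _ _ a b) (det_gLow_ne_zero g hψ' hmem) hG c a b

/-- Contract the connection law of Γ with the velocities pulled back in time. Its second-derivative
term becomes exactly the inhomogeneous term of a spatial spray, so ½ Γ^i_{jk} x^j_α x^k_β is a
spatial spray by itself. -/
theorem sum_christoffelG_trans (hp : 2 ≤ p) (hL : IsKroneckerRegular h g L) {q : JCoord p n}
    (hφ : φ ∈ smoothCharts p T) (hφ' : φ' ∈ smoothCharts p T)
    (hψ : ψ ∈ smoothCharts n M) (hψ' : ψ' ∈ smoothCharts n M)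
    (hq : q ∈ jetOverlap φ ψ φ' ψ') (k : Fin n) (γ β : Fin p) :
    ∑ d, ∑ e, christoffelG g φ' ψ' (jetTransition φ ψ φ' ψ' q) k d e
        * (jetTransition φ ψ φ' ψ' q).2.2 d γ * (jetTransition φ ψ φ' ψ' q).2.2 e β
      = (∑ j, coordJac ψ ψ' q.2.1 k j * ∑ a, ∑ b, christoffelG g φ ψ q j a b
          * pullVel φ φ' q a γ * pullVel φ φ' q b β) - hessVel φ φ' ψ ψ' q k γ β := by
  have e1 : ∑ d, ∑ e, christoffelG g φ' ψ' (jetTransition φ ψ φ' ψ' q) k d e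
        * (jetTransition φ ψ φ' ψ' q).2.2 d γ * (jetTransition φ ψ φ' ψ' q).2.2 e β
      = ∑ a, ∑ b, (∑ d, ∑ e, christoffelG g φ' ψ' (jetTransition φ ψ φ' ψ' q) k d e
          * coordJac ψ ψ' q.2.1 d a * coordJac ψ ψ' q.2.1 e b)
          * (pullVel φ φ' q a γ * pullVel φ φ' q b β) := by
    simp only [jetTransition_eq_pullVel, Finset.mul_sum, Finset.sum_mul]
    calc _ = ∑ d, ∑ b, ∑ a, ∑ e, christoffelG g φ' ψ' (jetTransition φ ψ φ' ψ' q) k d e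
          * (coordJac ψ ψ' q.2.1 d a * pullVel φ φ' q a γ)
          * (coordJac ψ ψ' q.2.1 e b * pullVel φ φ' q b β) :=
          Finset.sum_congr rfl fun _ _ => sum_rotate _
      _ = ∑ b, ∑ a, ∑ d, ∑ e, christoffelG g φ' ψ' (jetTransition φ ψ φ' ψ' q) k d e
          * (coordJac ψ ψ' q.2.1 d a * pullVel φ φ' q a γ)
          * (coordJac ψ ψ' q.2.1 e b * pullVel φ φ' q b β) := sum_rotate _
      _ = _ := by
          rw [Finset.sum_comm]
          exact Finset.sum_congr rfl fun _ _ => Finset.sum_congr rfl fun _ _ =>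
            Finset.sum_congr rfl fun _ _ => Finset.sum_congr rfl fun _ _ => by ring
  have e2 : ∀ a b, ∑ d, ∑ e, christoffelG g φ' ψ' (jetTransition φ ψ φ' ψ' q) k d e
          * coordJac ψ ψ' q.2.1 d a * coordJac ψ ψ' q.2.1 e b
      = (∑ j, coordJac ψ ψ' q.2.1 k j * christoffelG g φ ψ q j a b)
        - coordHess ψ ψ' q.2.1 k a b := fun a b => by
    rw [christoffelG_trans hp hL hφ hφ' hψ hψ' hq]; ring
  rw [e1]
  simp only [e2, sub_mul, Finset.sum_sub_distrib]
  congr 1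
  · simp only [Finset.mul_sum, Finset.sum_mul]
    rw [← sum_rotate]
    exact Finset.sum_congr rfl fun _ _ => Finset.sum_congr rfl fun _ _ =>
      Finset.sum_congr rfl fun _ _ => by ring
  · rw [hessVel, Finset.sum_comm]
    exact Finset.sum_congr rfl fun _ _ => Finset.sum_congr rfl fun _ _ => by ring

theorem sum_christoffelG_pullVel {q : JCoord p n} (j : Fin n) (γ β : Fin p) :
    ∑ a, ∑ b, christoffelG g φ ψ q j a b * pullVel φ φ' q a γ * pullVel φ φ' q b β
      = ∑ α, ∑ μ, coordJacInv φ φ' q.1 α γ * coordJacInv φ φ' q.1 μ β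
        * ∑ a, ∑ b, christoffelG g φ ψ q j a b * q.2.2 a α * q.2.2 b μ := by
  simp only [pullVel, Finset.mul_sum, Finset.sum_mul]
  calc _ = ∑ a, ∑ μ, ∑ α, ∑ b, christoffelG g φ ψ q j a b
        * (coordJacInv φ φ' q.1 α γ * q.2.2 a α) * (coordJacInv φ φ' q.1 μ β * q.2.2 b μ) :=
        Finset.sum_congr rfl fun _ _ => sum_rotate _
    _ = ∑ μ, ∑ α, ∑ a, ∑ b, christoffelG g φ ψ q j a b
        * (coordJacInv φ φ' q.1 α γ * q.2.2 a α) * (coordJacInv φ φ' q.1 μ β * q.2.2 b μ) :=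
        sum_rotate _
    _ = _ := by
        rw [Finset.sum_comm]
        exact Finset.sum_congr rfl fun _ _ => Finset.sum_congr rfl fun _ _ =>
          Finset.sum_congr rfl fun _ _ => Finset.sum_congr rfl fun _ _ => by ring

/-- For `p ≥ 2` the components `𝒯^i` form a d-vector. -/
theorem traceT_jetTransition (hp : 2 ≤ p) (hL : IsKroneckerRegular h g L) {q : JCoord p n}
    (hφ : φ ∈ smoothCharts p T) (hφ' : φ' ∈ smoothCharts p T)
    (hψ : ψ ∈ smoothCharts n M) (hψ' : ψ' ∈ smoothCharts n M)
    (hq : q ∈ jetOverlap φ ψ φ' ψ') (k : Fin n) :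
    traceT h g L φ' ψ' (jetTransition φ ψ φ' ψ' q) k
      = ∑ j, coordJac ψ ψ' q.2.1 k j * traceT h g L φ ψ q j := by
  obtain ⟨h1, h2⟩ := mem_jetOverlap.1 hq
  -- Both 𝒢 and the trace of its Γ part obey laws with the same inhomogeneous term. Subtracting them
  -- leaves a homogeneous law for 𝒯.
  have e1 := traceG_jetTransition hL hφ hφ' hψ hψ' hq k
  rw [hL.traceG_eq hp hφ' hψ' (jetTransition_mem hq)] at e1
  simp only [hL.traceG_eq hp hφ hψ hq.1, sum_christoffelG_trans hp hL hφ hφ' hψ hψ' hq,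
    sum_christoffelG_pullVel, mul_sub, mul_add, Finset.sum_sub_distrib,
    Finset.sum_add_distrib] at e1
  have e3 : (jetTransition φ ψ φ' ψ' q).1 = φ' (φ.symm q.1) := rfl
  have e2 : ∑ γ, ∑ β, hUp h φ' (φ' (φ.symm q.1)) γ β * ∑ j, coordJac ψ ψ' q.2.1 k j
        * ∑ α, ∑ μ, coordJacInv φ φ' q.1 α γ * coordJacInv φ φ' q.1 μ β
          * ∑ a, ∑ b, christoffelG g φ ψ q j a b * q.2.2 a α * q.2.2 b μ
      = ∑ j, coordJac ψ ψ' q.2.1 k j * ∑ α, ∑ μ, hUp h φ q.1 α μ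
          * ∑ a, ∑ b, christoffelG g φ ψ q j a b * q.2.2 a α * q.2.2 b μ := by
    have e4 : ∀ S : Fin p → Fin p → ℝ, ∑ γ, ∑ β, hUp h φ' (φ' (φ.symm q.1)) γ β
          * ∑ α, ∑ μ, coordJacInv φ φ' q.1 α γ * coordJacInv φ φ' q.1 μ β * S α μ
        = ∑ α, ∑ μ, hUp h φ q.1 α μ * S α μ := by
      intro S
      simp only [← hUp_coordJacInv h hφ hφ' h1, Finset.mul_sum, Finset.sum_mul]
      calc _ = ∑ γ, ∑ α, ∑ μ, ∑ β, hUp h φ' (φ' (φ.symm q.1)) γ β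
            * (coordJacInv φ φ' q.1 α γ * coordJacInv φ φ' q.1 μ β * S α μ) :=
            Finset.sum_congr rfl fun _ _ => sum_rotate _
        _ = _ := sum_rotate _
        _ = _ := Finset.sum_congr rfl fun _ _ => Finset.sum_congr rfl fun _ _ =>
          Finset.sum_congr rfl fun _ _ => Finset.sum_congr rfl fun _ _ => by ring
    simp only [← e4]
    refine (Finset.sum_congr rfl fun γ _ => Finset.sum_congr rfl fun β _ =>
      Finset.mul_sum _ _ _).trans ((sum_rotate _).symm.trans ?_)
    refine Finset.sum_congr rfl fun j _ => ?_
    rw [Finset.mul_sum]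
    refine Finset.sum_congr rfl fun γ _ => ?_
    rw [Finset.mul_sum]
    exact Finset.sum_congr rfl fun β _ => by ring
  rw [e3, e2] at e1
  simp only [mul_left_comm _ (1 / 2 : ℝ), ← Finset.mul_sum (a := (1 / 2 : ℝ))] at e1
  linarith

theorem contDiffOn_christoffelG (hφ : φ ∈ smoothCharts p T)
    (hψ : ψ ∈ smoothCharts n M) (l j k : Fin n) :
    ContDiffOn ℝ ∞ (fun q => christoffelG g φ ψ q l j k) (jetDomain φ ψ) := by
  have h1 : ∀ a i j, ContDiffOn ℝ ∞ (dX a (fun r => gLow g φ ψ r i j)) (jetDomain φ ψ) :=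
    fun a i j => contDiffOn_dX (isOpen_jetDomain φ ψ) (contDiffOn_gLow g hφ hψ i j) a
  exact ContDiffOn.sum fun i _ => ((contDiffOn_gUp g hφ hψ l i).div_const 2).mul
    (((h1 _ _ _).add (h1 _ _ _)).sub (h1 _ _ _))

omit [ChartedSpace (Rn n) M] in
theorem contDiffOn_hUp_fst (hφ : φ ∈ smoothCharts p T) (α β : Fin p) :
    ContDiffOn ℝ ∞ (fun q : JCoord p n => hUp h φ q.1 α β) (jetDomain φ ψ) :=
  ContDiffOn.comp_jet_fst (contDiffOn_hUp h hφ α β)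

omit [ChartedSpace (Rn n) M] in
theorem contDiffOn_hLow_fst (hφ : φ ∈ smoothCharts p T) (α β : Fin p) :
    ContDiffOn ℝ ∞ (fun q : JCoord p n => hLow h φ q.1 α β) (jetDomain φ ψ) :=
  ContDiffOn.comp_jet_fst (contDiffOn_hLow h hφ α β)

omit [ChartedSpace (Rn n) M] in
theorem contDiffOn_christoffelH_fst (hφ : φ ∈ smoothCharts p T) (γ α β : Fin p) :
    ContDiffOn ℝ ∞ (fun q : JCoord p n => christoffelH h φ q.1 γ α β) (jetDomain φ ψ) :=
  ContDiffOn.comp_jet_fst (contDiffOn_christoffelH h hφ γ α β)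

theorem IsKroneckerRegular.contDiffOn_curlU (hL : IsKroneckerRegular h g L)
    (hφ : φ ∈ smoothCharts p T) (hψ : ψ ∈ smoothCharts n M) (α : Fin p) (i j : Fin n) :
    ContDiffOn ℝ ∞ (fun q => curlU L φ ψ q α i j) (jetDomain φ ψ) :=
  (contDiffOn_dX (isOpen_jetDomain φ ψ) (hL.contDiffOn_potU hφ hψ α i) j).sub
    (contDiffOn_dX (isOpen_jetDomain φ ψ) (hL.contDiffOn_potU hφ hψ α j) i)

theorem IsKroneckerRegular.contDiffOn_traceT (hL : IsKroneckerRegular h g L)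
    (hφ : φ ∈ smoothCharts p T) (hψ : ψ ∈ smoothCharts n M) (l : Fin n) :
    ContDiffOn ℝ ∞ (fun q => traceT h g L φ ψ q l) (jetDomain φ ψ) := by
  have ho := isOpen_jetDomain (p := p) (n := n) φ ψ
  refine contDiffOn_const.mul (ContDiffOn.sum fun i _ =>
    ((contDiffOn_gUp g hφ hψ l i).div_const 2).mul ?_)
  refine ((((contDiffOn_const.mul ?_).add ?_).add ?_).add ?_).sub
    (contDiffOn_dX ho (hL.contDiffOn_potF hφ hψ) i)
  · exact ContDiffOn.sum fun α _ => ContDiffOn.sum fun β _ => ContDiffOn.sum fun j _ =>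
      ((contDiffOn_hUp_fst hφ α β).mul (contDiffOn_dT ho (contDiffOn_gLow g hφ hψ i j) α)).mul
        (contDiff_jet_snd_snd j β).contDiffOn
  · exact ContDiffOn.sum fun α _ => ContDiffOn.sum fun j _ =>
      (hL.contDiffOn_curlU hφ hψ α i j).mul (contDiff_jet_snd_snd j α).contDiffOn
  · exact ContDiffOn.sum fun α _ => contDiffOn_dT ho (hL.contDiffOn_potU hφ hψ α i) α
  · exact ContDiffOn.sum fun α _ => ContDiffOn.sum fun γ _ =>
      (hL.contDiffOn_potU hφ hψ α i).mul (contDiffOn_christoffelH_fst hφ γ α γ)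

theorem IsKroneckerRegular.contDiffOn_canonicalG (hL : IsKroneckerRegular h g L)
    (hφ : φ ∈ smoothCharts p T) (hψ : ψ ∈ smoothCharts n M) (i : Fin n) (α β : Fin p) :
    ContDiffOn ℝ ∞ (fun q => canonicalG h g L φ ψ q i α β) (jetDomain φ ψ) := by
  have ho := isOpen_jetDomain (p := p) (n := n) φ ψ
  have hl := hL.contDiffOn hφ hψ
  unfold canonicalG
  split_ifs with hp
  · refine ContDiffOn.sum fun k _ => (((contDiffOn_hLow_fst hφ α β).mul
      (contDiffOn_gUp g hφ hψ i k)).div_const 4).mul ?_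
    have hv := contDiffOn_dV ho hl k α
    refine ((((ContDiffOn.sum fun j _ => (contDiffOn_dX ho hv j).mul
      (contDiff_jet_snd_snd j α).contDiffOn).sub (contDiffOn_dX ho hl k)).add
      (contDiffOn_dT ho hv α)).add (hv.mul (contDiffOn_christoffelH_fst hφ α α α))).add ?_
    exact ((contDiffOn_const.mul (contDiffOn_hUp_fst hφ α α)).mul
      (contDiffOn_christoffelH_fst hφ α α α)).mul (ContDiffOn.sum fun l _ =>
        (contDiffOn_gLow g hφ hψ k l).mul (contDiff_jet_snd_snd l α).contDiffOn)
  · refine (contDiffOn_const.mul (ContDiffOn.sum fun j _ => ContDiffOn.sum fun k _ =>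
      ((contDiffOn_christoffelG hφ hψ i j k).mul (contDiff_jet_snd_snd j α).contDiffOn).mul
        (contDiff_jet_snd_snd k β).contDiffOn)).add ?_
    exact ((contDiffOn_hLow_fst hφ α β).div_const _).mul (hL.contDiffOn_traceT hφ hψ i)

omit [ChartedSpace (Rn p) T] in
theorem sum_coordJac_jetTransition {q : JCoord p n}
    (hψ : ψ ∈ smoothCharts n M) (hψ' : ψ' ∈ smoothCharts n M)
    (hq : q ∈ jetOverlap φ ψ φ' ψ') (i : Fin n) (β : Fin p) :
    ∑ j, coordJac ψ' ψ (ψ' (ψ.symm q.2.1)) i j * (jetTransition φ ψ φ' ψ' q).2.2 j β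
      = pullVel φ φ' q i β := by
  have h1 : ∀ l, ∑ j, coordJac ψ' ψ (ψ' (ψ.symm q.2.1)) i j * coordJac ψ ψ' q.2.1 j l
      = if i = l then 1 else 0 := fun l => coordJac_mul hψ hψ' (mem_jetOverlap.1 hq).2 i l
  simp only [jetTransition_eq_pullVel, Finset.mul_sum, ← mul_assoc]
  rw [Finset.sum_comm]
  simp only [← Finset.sum_mul, h1]
  simp

/-- For p = 1 the law of the trace is multiplied by the new h_{11}. For p ≥ 2 the Γ part supplies
the inhomogeneous term and h_{αβ} 𝒯^i / p is a d-tensor, since h and 𝒯 transform homogeneously. -/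
theorem IsKroneckerRegular.isSpatialSpray (hp : 1 ≤ p) (hL : IsKroneckerRegular h g L) :
    IsSpatialSpray (canonicalG h g L) := by
  refine ⟨fun φ hφ ψ hψ i α β => hL.contDiffOn_canonicalG hφ hψ i α β, ?_⟩
  intro φ hφ ψ hψ φ' hφ' ψ' hψ' q hq k γ β
  obtain ⟨h1, h2⟩ := mem_jetOverlap.1 hq
  have hmem : jetTransition φ ψ φ' ψ' q ∈ jetDomain φ' ψ' := jetTransition_mem hq
  have e1 : ∑ i, ∑ j, coordJac ψ' ψ (ψ' (ψ.symm q.2.1)) i j *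
          dX i (fun r => (jetTransition φ ψ φ' ψ' r).2.2 k γ) q *
          (jetTransition φ ψ φ' ψ' q).2.2 j β = hessVel φ φ' ψ ψ' q k γ β := by
    refine Finset.sum_congr rfl fun i _ => ?_
    rw [← Finset.sum_mul, ← dX_jetTransition_eq_pullVel hφ hφ' hψ hψ' hq,
      ← sum_coordJac_jetTransition hψ hψ' hq, Finset.mul_sum]
    exact Finset.sum_congr rfl fun j _ => by ring
  rw [e1]
  change _ = (∑ j, ∑ α, ∑ μ, 2 * canonicalG h g L φ ψ q j α μ * coordJacInv φ φ' q.1 α γ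
    * coordJacInv φ φ' q.1 μ β * coordJac ψ ψ' q.2.1 k j) - _
  have hlow : ∀ c : Fin n → ℝ, ∑ j, ∑ α, ∑ μ, 2 * (hLow h φ q.1 α μ * c j)
      * coordJacInv φ φ' q.1 α γ * coordJacInv φ φ' q.1 μ β * coordJac ψ ψ' q.2.1 k j
      = hLow h φ' (φ' (φ.symm q.1)) γ β * (2 * ∑ j, coordJac ψ ψ' q.2.1 k j * c j) := by
    intro c
    rw [← hLow_coordJacInv h hφ hφ' h1 γ β, Finset.mul_sum, Finset.mul_sum]
    refine Finset.sum_congr rfl fun j _ => ?_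
    simp only [Finset.sum_mul]
    exact Finset.sum_congr rfl fun _ _ => Finset.sum_congr rfl fun _ _ => by ring
  rcases hp.eq_or_lt with hp1 | hp2
  · simp only [canonicalG_one_eq hp1.symm hφ hψ hq.1, canonicalG_one_eq hp1.symm hφ' hψ' hmem]
    rw [hlow, mul_left_comm, traceG_jetTransition hL hφ hφ' hψ hψ' hq, mul_sub]
    congr 1
    -- With a single time index `hessVel` is constant in its time indices and leaves the trace,
    -- after which h_{11} h^{11} = 1 removes the metric.
    have : Subsingleton (Fin p) := by subst hp1; infer_instance
    have e2 : ∀ μ ν, hUp h φ' (φ' (φ.symm q.1)) μ ν * hessVel φ φ' ψ ψ' q k μ ν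
        = hUp h φ' (φ' (φ.symm q.1)) μ ν * hessVel φ φ' ψ ψ' q k γ β := fun μ ν => by
      rw [Subsingleton.elim μ γ, Subsingleton.elim ν β]
    simp only [e2, ← Finset.sum_mul]
    have e3 : hLow h φ' (φ' (φ.symm q.1)) γ β
        * ∑ μ, ∑ ν, hUp h φ' (φ' (φ.symm q.1)) μ ν = 1 := by
      have := sum_hUp_mul_hLow (h := h) hφ' hmem.1
      have hpc : (p : ℝ) = 1 := by exact_mod_cast hp1.symm
      simp only [Finset.mul_sum]
      rw [← hpc, ← this]
      refine Finset.sum_congr rfl fun μ _ => Finset.sum_congr rfl fun ν _ => ?_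
      rw [Subsingleton.elim γ μ, Subsingleton.elim β ν, mul_comm]
      rfl
    have e4 : (jetTransition φ ψ φ' ψ' q).1 = φ' (φ.symm q.1) := rfl
    rw [e4, ← mul_assoc, e3, one_mul]
  · simp only [canonicalG, if_neg (show p ≠ 1 by omega), canonicalGMulti, tensorT,
      sum_christoffelG_trans hp2 hL hφ hφ' hψ hψ' hq, traceT_jetTransition hp2 hL hφ hφ' hψ hψ' hq,
      sum_christoffelG_pullVel]
    have e3 : (jetTransition φ ψ φ' ψ' q).1 = φ' (φ.symm q.1) := rfl
    have e4 := hlow fun j => traceT h g L φ ψ q j / p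
    have e5 : ∑ j, ∑ α, ∑ μ, 2 * (1 / 2 * (∑ a, ∑ b, christoffelG g φ ψ q j a b * q.2.2 a α
          * q.2.2 b μ) + hLow h φ q.1 α μ / p * traceT h g L φ ψ q j)
          * coordJacInv φ φ' q.1 α γ * coordJacInv φ φ' q.1 μ β * coordJac ψ ψ' q.2.1 k j
        = (∑ j, coordJac ψ ψ' q.2.1 k j * ∑ α, ∑ μ, coordJacInv φ φ' q.1 α γ
          * coordJacInv φ φ' q.1 μ β * ∑ a, ∑ b, christoffelG g φ ψ q j a b * q.2.2 a α * q.2.2 b μ)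
          + ∑ j, ∑ α, ∑ μ, 2 * (hLow h φ q.1 α μ * (traceT h g L φ ψ q j / p))
            * coordJacInv φ φ' q.1 α γ * coordJacInv φ φ' q.1 μ β * coordJac ψ ψ' q.2.1 k j := by
      rw [← Finset.sum_add_distrib]
      refine Finset.sum_congr rfl fun j _ => ?_
      rw [Finset.mul_sum, ← Finset.sum_add_distrib]
      refine Finset.sum_congr rfl fun α _ => ?_
      rw [Finset.mul_sum, ← Finset.sum_add_distrib]
      exact Finset.sum_congr rfl fun μ _ => by ring
    have e6 : ∑ j, coordJac ψ ψ' q.2.1 k j * (traceT h g L φ ψ q j / p)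
        = (∑ j, coordJac ψ ψ' q.2.1 k j * traceT h g L φ ψ q j) / p := by
      rw [Finset.sum_div]
      exact Finset.sum_congr rfl fun _ _ => by ring
    rw [e5, e4, e3, e6]
    ring

end SpatialSpray

/-! ### Differentiation along lines in the velocity fibre. -/

section VelocityLine

variable {p n : ℕ}

/-- The line through `q` in the direction of `∂/∂x^i_α`. -/
def velLine (q : JCoord p n) (i : Fin n) (α : Fin p) (s : ℝ) : JCoord p n :=
  (q.1, q.2.1, q.2.2 + s • (Pi.single i (Pi.single α 1) : Fin n → Fin p → ℝ))

@[simp] theorem velLine_zero (q : JCoord p n) (i : Fin n) (α : Fin p) : velLine q i α 0 = q := by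
  simp [velLine]

theorem hasDerivAt_velLine (q : JCoord p n) (i : Fin n) (α : Fin p) (s : ℝ) :
    HasDerivAt (velLine q i α) (0, 0, Pi.single i (Pi.single α 1)) s := by
  have h2 : HasDerivAt (fun s : ℝ => q.2.2 + s • (Pi.single i (Pi.single α 1) : Fin n → Fin p → ℝ))
      (Pi.single i (Pi.single α 1)) s := by
    simpa using ((hasDerivAt_id s).smul_const
      (Pi.single i (Pi.single α 1) : Fin n → Fin p → ℝ)).const_add q.2.2
  exact (hasDerivAt_const s q.1).prodMk ((hasDerivAt_const s q.2.1).prodMk h2)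

theorem hasDerivAt_comp_velLine {F : JCoord p n → ℝ} {q : JCoord p n}
    (hF : DifferentiableAt ℝ F q) (i : Fin n) (α : Fin p) :
    HasDerivAt (fun s => F (velLine q i α s)) (dV i α F q) 0 := by
  have h1 : HasFDerivAt F (fderiv ℝ F q) (velLine q i α 0) := by
    simpa using hF.hasFDerivAt
  exact h1.comp_hasDerivAt 0 (hasDerivAt_velLine q i α 0)

theorem hasDerivAt_velLine_apply (q : JCoord p n) (i : Fin n) (α : Fin p) (k : Fin n)
    (γ : Fin p) : HasDerivAt (fun s => (velLine q i α s).2.2 k γ)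
      (if k = i then if γ = α then 1 else 0 else 0) 0 := by
  have h1 := (hasFDerivAt_jet_snd_snd (velLine q i α 0) k γ).comp_hasDerivAt 0
    (hasDerivAt_velLine q i α 0)
  refine h1.congr_deriv ?_
  change (Pi.single i (Pi.single α (1 : ℝ)) : Fin n → Fin p → ℝ) k γ = _
  by_cases hk : k = i
  · subst hk
    simp [Pi.single_apply]
  · simp [hk]

end VelocityLine

/-! ### The law of the canonical nonlinear connection. -/

section NonlinearConnection

variable {p n : ℕ} {T M : Type*} [TopologicalSpace T] [ChartedSpace (Rn p) T]
  [TopologicalSpace M] [ChartedSpace (Rn n) M]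
  {h : SemiRiemannianMetric p T} {g : SpatialDMetric p n T M} {L : Jet p n T M → ℝ}
  {φ φ' : LChart p T} {ψ ψ' : LChart n M}

theorem IsKroneckerRegular.contDiffOn_hTrace (hL : IsKroneckerRegular h g L)
    (hφ : φ ∈ smoothCharts p T) (hψ : ψ ∈ smoothCharts n M) (i : Fin n) :
    ContDiffOn ℝ ∞ (hTrace h (canonicalG h g L) φ ψ i) (jetDomain φ ψ) :=
  ContDiffOn.sum fun α _ => ContDiffOn.sum fun β _ =>
    (contDiffOn_hUp_fst hφ α β).mul (hL.contDiffOn_canonicalG hφ hψ i α β)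

theorem IsKroneckerRegular.contDiffOn_inducedN (hL : IsKroneckerRegular h g L)
    (hφ : φ ∈ smoothCharts p T) (hψ : ψ ∈ smoothCharts n M) (i : Fin n) (α : Fin p) (j : Fin n) :
    ContDiffOn ℝ ∞ (fun q => inducedN h (canonicalG h g L) φ ψ q i α j) (jetDomain φ ψ) :=
  ContDiffOn.sum fun γ _ => (contDiffOn_dV (isOpen_jetDomain φ ψ)
    (hL.contDiffOn_hTrace hφ hψ i) j γ).mul (contDiffOn_hLow_fst hφ α γ)

omit [ChartedSpace (Rn p) T] in
theorem hasDerivAt_pullVel_velLine (q : JCoord p n) (i : Fin n) (ε : Fin p) (j : Fin n)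
    (γ : Fin p) : HasDerivAt (fun s => pullVel φ φ' (velLine q i ε s) j γ)
      (if j = i then coordJacInv φ φ' q.1 ε γ else 0) 0 := by
  have h1 : HasDerivAt (fun s => ∑ α, coordJacInv φ φ' q.1 α γ * (velLine q i ε s).2.2 j α) _ 0 :=
    HasDerivAt.fun_sum fun α _ => (hasDerivAt_velLine_apply q i ε j α).const_mul _
  refine h1.congr_deriv ?_
  by_cases hj : j = i <;> simp [hj]

/-- The derivatives with respect to the velocities of the inhomogeneous term in the
transformation law of the traces of spatial sprays. -/
theorem hasDerivAt_hessVel_velLine {q : JCoord p n}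
    (hφ : φ ∈ smoothCharts p T) (hφ' : φ' ∈ smoothCharts p T)
    (hψ : ψ ∈ smoothCharts n M) (hψ' : ψ' ∈ smoothCharts n M)
    (hq : q ∈ jetOverlap φ ψ φ' ψ') (k i : Fin n) (ε : Fin p) :
    HasDerivAt (fun s => ∑ γ, ∑ β, hUp h φ' (φ' (φ.symm q.1)) γ β
        * hessVel φ φ' ψ ψ' (velLine q i ε s) k γ β)
      (2 * ∑ γ, ∑ β, hUp h φ' (φ' (φ.symm q.1)) γ β * (coordJacInv φ φ' q.1 ε β
        * dX i (fun r => (jetTransition φ ψ φ' ψ' r).2.2 k γ) q)) 0 := by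
  have h2 := (mem_jetOverlap.1 hq).2
  have h1 : HasDerivAt (fun s => ∑ γ, ∑ β, hUp h φ' (φ' (φ.symm q.1)) γ β
      * ∑ i', ∑ j', coordHess ψ ψ' q.2.1 k j' i' * pullVel φ φ' (velLine q i ε s) j' γ
        * pullVel φ φ' (velLine q i ε s) i' β) _ 0 :=
    HasDerivAt.fun_sum fun γ _ => HasDerivAt.fun_sum fun β _ => HasDerivAt.const_mul _ <|
      HasDerivAt.fun_sum fun i' _ => HasDerivAt.fun_sum fun j' _ =>
        ((hasDerivAt_pullVel_velLine q i ε j' γ).const_mul _).mul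
          (hasDerivAt_pullVel_velLine q i ε i' β)
  refine h1.congr_deriv ?_
  -- `hessVel` is quadratic in the velocities, so its derivative has two terms that differ by
  -- exchanging γ and β. Summed against the symmetric h^{γβ} they agree, which produces the factor
  -- 2.
  have e1 : ∀ γ β, ∑ i', ∑ j', (coordHess ψ ψ' q.2.1 k j' i'
        * (if j' = i then coordJacInv φ φ' q.1 ε γ else 0) * pullVel φ φ' (velLine q i ε 0) i' β
        + coordHess ψ ψ' q.2.1 k j' i' * pullVel φ φ' (velLine q i ε 0) j' γ
          * (if i' = i then coordJacInv φ φ' q.1 ε β else 0))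
      = coordJacInv φ φ' q.1 ε γ * dX i (fun r => (jetTransition φ ψ φ' ψ' r).2.2 k β) q
        + coordJacInv φ φ' q.1 ε β * dX i (fun r => (jetTransition φ ψ φ' ψ' r).2.2 k γ) q := by
    intro γ β
    rw [dX_jetTransition_eq_pullVel hφ hφ' hψ hψ' hq, dX_jetTransition_eq_pullVel hφ hφ' hψ hψ' hq]
    simp only [Finset.sum_add_distrib, velLine_zero, Finset.mul_sum]
    congr 1
    · simp only [mul_ite, ite_mul, mul_zero, zero_mul, Finset.sum_ite_eq', Finset.mem_univ, if_true]
      exact Finset.sum_congr rfl fun _ _ => by rw [coordHess_comm hψ hψ' h2]; ring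
    · rw [Finset.sum_comm]
      simp only [mul_ite, mul_zero, Finset.sum_ite_eq', Finset.mem_univ, if_true]
      exact Finset.sum_congr rfl fun _ _ => by ring
  simp only [e1]
  simp only [mul_add, Finset.sum_add_distrib, two_mul]
  congr 1
  rw [Finset.sum_comm]
  exact Finset.sum_congr rfl fun _ _ => Finset.sum_congr rfl fun _ _ => by rw [hUp_comm]

/-- The transformation law of the derivatives of the trace of the canonical spatial spray with
respect to the velocities. -/
theorem dV_hTrace_jetTransition (hp : 1 ≤ p) (hL : IsKroneckerRegular h g L) {q : JCoord p n}
    (hφ : φ ∈ smoothCharts p T) (hφ' : φ' ∈ smoothCharts p T)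
    (hψ : ψ ∈ smoothCharts n M) (hψ' : ψ' ∈ smoothCharts n M)
    (hq : q ∈ jetOverlap φ ψ φ' ψ') (k i : Fin n) (ε : Fin p) :
    ∑ m, ∑ δ, dV m δ (hTrace h (canonicalG h g L) φ' ψ' k) (jetTransition φ ψ φ' ψ' q)
        * coordJac ψ ψ' q.2.1 m i * coordJacInv φ φ' q.1 ε δ
      = (∑ j, coordJac ψ ψ' q.2.1 k j * dV i ε (hTrace h (canonicalG h g L) φ ψ j) q)
        - ∑ γ, ∑ β, hUp h φ' (φ' (φ.symm q.1)) γ β * (coordJacInv φ φ' q.1 ε β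
          * dX i (fun r => (jetTransition φ ψ φ' ψ' r).2.2 k γ) q) := by
  have hmem : jetTransition φ ψ φ' ψ' q ∈ jetDomain φ' ψ' := jetTransition_mem hq
  have hd' : DifferentiableAt ℝ (hTrace h (canonicalG h g L) φ' ψ' k)
      (jetTransition φ ψ φ' ψ' q) := differentiableAt_of_contDiffOn (isOpen_jetDomain φ' ψ')
    (hL.contDiffOn_hTrace hφ' hψ' k) hmem
  have hd := fun j => differentiableAt_of_contDiffOn (isOpen_jetDomain φ ψ)
    (hL.contDiffOn_hTrace hφ hψ j) hq.1
  have hdc : DifferentiableAt ℝ (fun r => hTrace h (canonicalG h g L) φ' ψ' k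
      (jetTransition φ ψ φ' ψ' r)) q :=
    (fderiv_comp_jetTransition hφ hφ' hψ hψ' hq hd').1
  rw [← dV_comp_jetTransition hφ hφ' hψ hψ' hq hd' i ε]
  have e1 := hasDerivAt_comp_velLine hdc i ε
  have e2 : HasDerivAt (fun s => (∑ j, coordJac ψ ψ' q.2.1 k j
      * hTrace h (canonicalG h g L) φ ψ j (velLine q i ε s))
        - 1 / 2 * ∑ γ, ∑ β, hUp h φ' (φ' (φ.symm q.1)) γ β
          * hessVel φ φ' ψ ψ' (velLine q i ε s) k γ β) _ 0 :=
    (HasDerivAt.fun_sum fun j _ => (hasDerivAt_comp_velLine (hd j) i ε).const_mul _).sub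
      ((hasDerivAt_hessVel_velLine (h := h) hφ hφ' hψ hψ' hq k i ε).const_mul _)
  -- The whole line stays in the overlap, because the velocities are unrestricted there. The law of
  -- the trace is therefore an identity of functions of `s`, and derivatives at 0 may be compared.
  have e3 : (fun s => hTrace h (canonicalG h g L) φ' ψ' k
      (jetTransition φ ψ φ' ψ' (velLine q i ε s))) = fun s => (∑ j, coordJac ψ ψ' q.2.1 k j
      * hTrace h (canonicalG h g L) φ ψ j (velLine q i ε s))
        - 1 / 2 * ∑ γ, ∑ β, hUp h φ' (φ' (φ.symm q.1)) γ β
          * hessVel φ φ' ψ ψ' (velLine q i ε s) k γ β := by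
    funext s
    have hs : velLine q i ε s ∈ jetOverlap φ ψ φ' ψ' := hq
    have e4 := traceG_jetTransition hL hφ hφ' hψ hψ' hs k
    simp only [hL.hTrace_canonicalG hp hφ hψ hs.1,
      hL.hTrace_canonicalG hp hφ' hψ' (jetTransition_mem hs)]
    change _ = (∑ j, coordJac ψ ψ' (velLine q i ε s).2.1 k j
      * traceG h g L φ ψ j (velLine q i ε s))
        - 1 / 2 * ∑ γ, ∑ β, hUp h φ' (φ' (φ.symm (velLine q i ε s).1)) γ β
          * hessVel φ φ' ψ ψ' (velLine q i ε s) k γ β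
    linarith
  rw [e3] at e1
  rw [e1.unique e2]
  ring

/-- Lower the index of the differentiated trace law with h_{αε} ∂t^α/∂t̃^σ. By the tensor law of h
the left side becomes the new N. In the inhomogeneous term the new h cancels against its inverse,
leaving ∂x̃^k_σ/∂x^i. -/
theorem inducedN_jetTransition (hp : 1 ≤ p) (hL : IsKroneckerRegular h g L) {q : JCoord p n}
    (hφ : φ ∈ smoothCharts p T) (hφ' : φ' ∈ smoothCharts p T)
    (hψ : ψ ∈ smoothCharts n M) (hψ' : ψ' ∈ smoothCharts n M)
    (hq : q ∈ jetOverlap φ ψ φ' ψ') (k i : Fin n) (σ : Fin p) :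
    ∑ m, inducedN h (canonicalG h g L) φ' ψ' (jetTransition φ ψ φ' ψ' q) k σ m
        * coordJac ψ ψ' q.2.1 m i
      = (∑ j, ∑ α, inducedN h (canonicalG h g L) φ ψ q j α i * coordJac ψ ψ' q.2.1 k j
          * coordJacInv φ φ' q.1 α σ)
        - dX i (fun r => (jetTransition φ ψ φ' ψ' r).2.2 k σ) q := by
  obtain ⟨h1, h2⟩ := mem_jetOverlap.1 hq
  have e1 := fun ε => dV_hTrace_jetTransition hp hL hφ hφ' hψ hψ' hq k i ε
  have hlow : ∀ δ, ∑ ε, (∑ α, hLow h φ q.1 α ε * coordJacInv φ φ' q.1 α σ)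
      * coordJacInv φ φ' q.1 ε δ = hLow h φ' (φ' (φ.symm q.1)) σ δ := by
    intro δ
    rw [← hLow_coordJacInv h hφ hφ' h1, Finset.sum_comm]
    simp only [Finset.sum_mul]
  have hδ : ∀ γ, ∑ β, hUp h φ' (φ' (φ.symm q.1)) γ β * hLow h φ' (φ' (φ.symm q.1)) σ β
      = if γ = σ then 1 else 0 := fun γ => by
    rw [← sum_inv_mul_apply (det_hLow_ne_zero h hφ' (jetTransition_mem hq).1) γ σ]
    exact Finset.sum_congr rfl fun β _ => by
      rw [hLow_comm]
      rfl
  have e2 := Finset.sum_congr (rfl : (Finset.univ : Finset (Fin p)) = Finset.univ) fun ε _ =>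
    congrArg ((∑ α, hLow h φ q.1 α ε * coordJacInv φ φ' q.1 α σ) * ·) (e1 ε)
  simp only [mul_sub, Finset.sum_sub_distrib] at e2
  have e3 : ∑ m, inducedN h (canonicalG h g L) φ' ψ' (jetTransition φ ψ φ' ψ' q) k σ m
        * coordJac ψ ψ' q.2.1 m i
      = ∑ ε, (∑ α, hLow h φ q.1 α ε * coordJacInv φ φ' q.1 α σ)
        * ∑ m, ∑ δ, dV m δ (hTrace h (canonicalG h g L) φ' ψ' k) (jetTransition φ ψ φ' ψ' q)
        * coordJac ψ ψ' q.2.1 m i * coordJacInv φ φ' q.1 ε δ := by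
    simp only [Finset.mul_sum]
    rw [sum_rotate]
    refine Finset.sum_congr rfl fun m _ => ?_
    rw [inducedN, Finset.sum_mul]
    refine Finset.sum_congr rfl fun δ _ => ?_
    rw [show (jetTransition φ ψ φ' ψ' q).1 = φ' (φ.symm q.1) from rfl, ← hlow δ, Finset.mul_sum,
      Finset.sum_mul]
    exact Finset.sum_congr rfl fun _ _ => by ring
  have e4 : ∑ j, ∑ α, inducedN h (canonicalG h g L) φ ψ q j α i * coordJac ψ ψ' q.2.1 k j
          * coordJacInv φ φ' q.1 α σ
      = ∑ ε, (∑ α, hLow h φ q.1 α ε * coordJacInv φ φ' q.1 α σ)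
        * ∑ j, coordJac ψ ψ' q.2.1 k j * dV i ε (hTrace h (canonicalG h g L) φ ψ j) q := by
    simp only [Finset.mul_sum, Finset.sum_mul, inducedN]
    symm
    rw [sum_rotate]
    exact Finset.sum_congr rfl fun _ _ => Finset.sum_congr rfl fun _ _ =>
      Finset.sum_congr rfl fun _ _ => by ring
  have e5 : ∑ ε, (∑ α, hLow h φ q.1 α ε * coordJacInv φ φ' q.1 α σ)
        * ∑ γ, ∑ β, hUp h φ' (φ' (φ.symm q.1)) γ β * (coordJacInv φ φ' q.1 ε β
          * dX i (fun r => (jetTransition φ ψ φ' ψ' r).2.2 k γ) q)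
      = dX i (fun r => (jetTransition φ ψ φ' ψ' r).2.2 k σ) q := by
    have e6 : ∀ γ, ∑ β, ∑ ε, (∑ α, hLow h φ q.1 α ε * coordJacInv φ φ' q.1 α σ)
          * (hUp h φ' (φ' (φ.symm q.1)) γ β * (coordJacInv φ φ' q.1 ε β
          * dX i (fun r => (jetTransition φ ψ φ' ψ' r).2.2 k γ) q))
        = (if γ = σ then 1 else 0) * dX i (fun r => (jetTransition φ ψ φ' ψ' r).2.2 k γ) q := by
      intro γ
      rw [← hδ, Finset.sum_mul]
      refine Finset.sum_congr rfl fun β _ => ?_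
      rw [← hlow β, Finset.mul_sum, Finset.sum_mul]
      exact Finset.sum_congr rfl fun _ _ => by ring
    have e7 : ∀ ε, (∑ α, hLow h φ q.1 α ε * coordJacInv φ φ' q.1 α σ)
        * ∑ γ, ∑ β, hUp h φ' (φ' (φ.symm q.1)) γ β * (coordJacInv φ φ' q.1 ε β
          * dX i (fun r => (jetTransition φ ψ φ' ψ' r).2.2 k γ) q)
        = ∑ γ, ∑ β, (∑ α, hLow h φ q.1 α ε * coordJacInv φ φ' q.1 α σ)
          * (hUp h φ' (φ' (φ.symm q.1)) γ β * (coordJacInv φ φ' q.1 ε β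
          * dX i (fun r => (jetTransition φ ψ φ' ψ' r).2.2 k γ) q)) := fun ε => by
      rw [Finset.mul_sum]
      exact Finset.sum_congr rfl fun γ _ => Finset.mul_sum _ _ _
    rw [Finset.sum_congr rfl fun ε _ => e7 ε, sum_rotate, Finset.sum_congr rfl fun γ _ => e6 γ]
    simp
  rw [e3, e4, e2, e5]

/-- The canonical nonlinear connection. -/
theorem IsKroneckerRegular.isNonlinearConnection (hp : 1 ≤ p) (hL : IsKroneckerRegular h g L) :
    IsNonlinearConnection (inducedM (canonicalH h)) (inducedN h (canonicalG h g L)) := by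
  have hH := isTemporalSpray_canonicalH (M := M) (n := n) h
  refine ⟨fun φ hφ ψ hψ => ⟨fun i α β => contDiffOn_const.mul (hH.1 φ hφ ψ hψ i α β),
    fun i α j => hL.contDiffOn_inducedN hφ hψ i α j⟩, ?_⟩
  intro φ hφ ψ hψ φ' hφ' ψ' hψ' q hq j β
  exact ⟨fun α => hH.inducedM_trans hφ hφ' hψ hψ' hq j β α,
    fun i => inducedN_jetTransition hp hL hφ hφ' hψ hψ' hq j i β⟩

end NonlinearConnection

/-! ### The explicit connection for p ≥ 2. -/

section ExplicitConnection

variable {p n : ℕ} {T M : Type*} [TopologicalSpace T] [ChartedSpace (Rn p) T]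
  [TopologicalSpace M] [ChartedSpace (Rn n) M]
  {h : SemiRiemannianMetric p T} {g : SpatialDMetric p n T M} {L : Jet p n T M → ℝ}
  {φ : LChart p T} {ψ : LChart n M}

-- Near the point, the slices at velocity y and at velocity 0 are the same function of x. Together
-- with its analogue for t, this shows that all coefficients of 𝒢 are constant on velocity fibres.
omit [ChartedSpace (Rn p) T] [ChartedSpace (Rn n) M] in
theorem dX_eq_dX_zeroJet {F : JCoord p n → ℝ} (hF : ContDiffOn ℝ ∞ F (jetDomain φ ψ))
    (h0 : ∀ r ∈ jetDomain φ ψ, F r = F (zeroJet r)) {q : JCoord p n} (hq : q ∈ jetDomain φ ψ)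
    (k : Fin n) : dX k F q = dX k F (zeroJet q) := by
  have ho := isOpen_jetDomain (p := p) (n := n) φ ψ
  rw [dX_eq_fderiv_slice (differentiableAt_of_contDiffOn ho hF hq),
    dX_eq_fderiv_slice (differentiableAt_of_contDiffOn ho hF (zeroJet_mem hq))]
  have h1 : (fun x => F (q.1, x, q.2.2)) =ᶠ[𝓝 q.2.1] fun x => F (q.1, x, 0) := by
    filter_upwards [ψ.open_target.mem_nhds hq.2] with x hx
    exact h0 (q.1, x, q.2.2) ⟨hq.1, hx⟩
  rw [h1.fderiv_eq]
  rfl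

omit [ChartedSpace (Rn p) T] [ChartedSpace (Rn n) M] in
theorem dT_eq_dT_zeroJet {F : JCoord p n → ℝ} (hF : ContDiffOn ℝ ∞ F (jetDomain φ ψ))
    (h0 : ∀ r ∈ jetDomain φ ψ, F r = F (zeroJet r)) {q : JCoord p n} (hq : q ∈ jetDomain φ ψ)
    (α : Fin p) : dT α F q = dT α F (zeroJet q) := by
  have ho := isOpen_jetDomain (p := p) (n := n) φ ψ
  rw [dT_eq_fderiv_slice (differentiableAt_of_contDiffOn ho hF hq),
    dT_eq_fderiv_slice (differentiableAt_of_contDiffOn ho hF (zeroJet_mem hq))]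
  have h1 : (fun t => F (t, q.2.1, q.2.2)) =ᶠ[𝓝 q.1] fun t => F (t, q.2.1, 0) := by
    filter_upwards [φ.open_target.mem_nhds hq.1] with t ht
    exact h0 (t, q.2.1, q.2.2) ⟨ht, hq.2⟩
  rw [h1.fderiv_eq]
  rfl

theorem IsKroneckerRegular.dX_gLow_zeroJet (hp : 2 ≤ p) (hL : IsKroneckerRegular h g L)
    (hφ : φ ∈ smoothCharts p T) (hψ : ψ ∈ smoothCharts n M) {q : JCoord p n}
    (hq : q ∈ jetDomain φ ψ) (k i j : Fin n) :
    dX k (fun r => gLow g φ ψ r i j) q = dX k (fun r => gLow g φ ψ r i j) (zeroJet q) :=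
  dX_eq_dX_zeroJet (contDiffOn_gLow g hφ hψ i j)
    (fun r hr => by rw [hL.gLow_zeroJet hp hφ hψ hr]) hq k

theorem IsKroneckerRegular.dT_gLow_zeroJet (hp : 2 ≤ p) (hL : IsKroneckerRegular h g L)
    (hφ : φ ∈ smoothCharts p T) (hψ : ψ ∈ smoothCharts n M) {q : JCoord p n}
    (hq : q ∈ jetDomain φ ψ) (α : Fin p) (i j : Fin n) :
    dT α (fun r => gLow g φ ψ r i j) q = dT α (fun r => gLow g φ ψ r i j) (zeroJet q) :=
  dT_eq_dT_zeroJet (contDiffOn_gLow g hφ hψ i j)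
    (fun r hr => by rw [hL.gLow_zeroJet hp hφ hψ hr]) hq α

theorem IsKroneckerRegular.gUp_zeroJet (hp : 2 ≤ p) (hL : IsKroneckerRegular h g L)
    (hφ : φ ∈ smoothCharts p T) (hψ : ψ ∈ smoothCharts n M) {q : JCoord p n}
    (hq : q ∈ jetDomain φ ψ) : gUp g φ ψ q = gUp g φ ψ (zeroJet q) := by
  rw [gUp, hL.gLow_zeroJet hp hφ hψ hq, gUp]

theorem IsKroneckerRegular.christoffelG_zeroJet (hp : 2 ≤ p) (hL : IsKroneckerRegular h g L)
    (hφ : φ ∈ smoothCharts p T) (hψ : ψ ∈ smoothCharts n M) {q : JCoord p n}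
    (hq : q ∈ jetDomain φ ψ) : christoffelG g φ ψ q = christoffelG g φ ψ (zeroJet q) := by
  funext l j k
  simp only [christoffelG, hL.dX_gLow_zeroJet hp hφ hψ hq, hL.gUp_zeroJet hp hφ hψ hq]

theorem IsKroneckerRegular.curlU_zeroJet (hL : IsKroneckerRegular h g L)
    (hφ : φ ∈ smoothCharts p T) (hψ : ψ ∈ smoothCharts n M) {q : JCoord p n}
    (hq : q ∈ jetDomain φ ψ) : curlU L φ ψ q = curlU L φ ψ (zeroJet q) := by
  funext α i j
  simp only [curlU]
  rw [dX_eq_dX_zeroJet (hL.contDiffOn_potU hφ hψ α i) (fun r _ => rfl) hq,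
    dX_eq_dX_zeroJet (hL.contDiffOn_potU hφ hψ α j) (fun r _ => rfl) hq]

theorem christoffelG_comm (q : JCoord p n) (i j k : Fin n) :
    christoffelG g φ ψ q i j k = christoffelG g φ ψ q i k j := by
  refine Finset.sum_congr rfl fun l _ => ?_
  simp only [gLow_comm g φ ψ _ j k]
  ring

/-- For `p ≥ 2` the trace of the canonical spatial spray is a polynomial in the velocities with
coefficients that depend on `(t,x)` only. -/
theorem IsKroneckerRegular.hTrace_velLine (hp : 2 ≤ p) (hL : IsKroneckerRegular h g L)
    (hφ : φ ∈ smoothCharts p T) (hψ : ψ ∈ smoothCharts n M) {q : JCoord p n}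
    (hq : q ∈ jetDomain φ ψ) (i j : Fin n) (ε : Fin p) (s : ℝ) :
    hTrace h (canonicalG h g L) φ ψ i (velLine q j ε s)
      = 1 / 2 * (∑ α, ∑ β, hUp h φ q.1 α β * ∑ k, ∑ l, christoffelG g φ ψ q i k l
          * (velLine q j ε s).2.2 k α * (velLine q j ε s).2.2 l β)
        + 1 / 2 * ∑ k, gUp g φ ψ q i k / 2 *
          (2 * (∑ α, ∑ β, ∑ l, hUp h φ q.1 α β * dT α (fun r => gLow g φ ψ r k l) q
              * (velLine q j ε s).2.2 l β)
            + (∑ α, ∑ l, curlU L φ ψ q α k l * (velLine q j ε s).2.2 l α)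
            + ((∑ α, dT α (potU L φ ψ α k) (zeroJet q))
            + (∑ α, ∑ γ, potU L φ ψ α k q * christoffelH h φ q.1 γ α γ)
            - dX k (potF L φ ψ) (zeroJet q))) := by
  have hs : velLine q j ε s ∈ jetDomain φ ψ := hq
  have hz : zeroJet (velLine q j ε s) = zeroJet q := rfl
  have h1 : (velLine q j ε s).1 = q.1 := rfl
  rw [hL.hTrace_canonicalG (by omega) hφ hψ hs, hL.traceG_eq hp hφ hψ hs, traceT]
  simp only [hL.christoffelG_zeroJet hp hφ hψ hs, hL.gUp_zeroJet hp hφ hψ hs,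
    hL.dT_gLow_zeroJet hp hφ hψ hs, hL.curlU_zeroJet hφ hψ hs, hz, h1,
    ← hL.christoffelG_zeroJet hp hφ hψ hq, ← hL.gUp_zeroJet hp hφ hψ hq,
    ← hL.dT_gLow_zeroJet hp hφ hψ hq, ← hL.curlU_zeroJet hφ hψ hq]
  have h2 : ∀ α k, dT α (potU L φ ψ α k) (velLine q j ε s) = dT α (potU L φ ψ α k) (zeroJet q) :=
    fun α k => dT_eq_dT_zeroJet (hL.contDiffOn_potU hφ hψ α k) (fun r _ => rfl) hs α
  have h3 : ∀ k, dX k (potF L φ ψ) (velLine q j ε s) = dX k (potF L φ ψ) (zeroJet q) :=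
    fun k => dX_eq_dX_zeroJet (hL.contDiffOn_potF hφ hψ) (fun r _ => rfl) hs k
  have h4 : ∀ α k, potU L φ ψ α k (velLine q j ε s) = potU L φ ψ α k q := fun α k => rfl
  simp only [h2, h3, h4]
  congr 2
  exact Finset.sum_congr rfl fun _ _ => by ring

/-- By `hTrace_velLine`, 𝒢 restricted to a velocity line is an explicit polynomial. Its derivative
at 0 follows from the product rule and uniqueness of derivatives. -/
theorem IsKroneckerRegular.dV_hTrace (hp : 2 ≤ p) (hL : IsKroneckerRegular h g L)
    (hφ : φ ∈ smoothCharts p T) (hψ : ψ ∈ smoothCharts n M) {q : JCoord p n}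
    (hq : q ∈ jetDomain φ ψ) (i j : Fin n) (ε : Fin p) :
    dV j ε (hTrace h (canonicalG h g L) φ ψ i) q
      = (∑ β, hUp h φ q.1 ε β * ∑ l, christoffelG g φ ψ q i j l * q.2.2 l β)
        + 1 / 2 * ∑ k, gUp g φ ψ q i k / 2 *
          (2 * (∑ α, hUp h φ q.1 α ε * dT α (fun r => gLow g φ ψ r k j) q)
            + curlU L φ ψ q ε k j) := by
  have e1 := hasDerivAt_comp_velLine (differentiableAt_of_contDiffOn (isOpen_jetDomain φ ψ)
    (hL.contDiffOn_hTrace hφ hψ i) hq) j ε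
  simp only [hL.hTrace_velLine hp hφ hψ hq] at e1
  have hv := fun k γ => hasDerivAt_velLine_apply q j ε k γ
  have e2 := ((HasDerivAt.fun_sum (u := Finset.univ) fun α _ =>
    HasDerivAt.fun_sum (u := Finset.univ) fun β _ =>
      (HasDerivAt.fun_sum (u := Finset.univ) fun k _ => HasDerivAt.fun_sum (u := Finset.univ)
        fun l _ => ((hv k α).const_mul (christoffelG g φ ψ q i k l)).fun_mul
          (hv l β)).const_mul (hUp h φ q.1 α β)).const_mul (1 / 2 : ℝ)).fun_add
    ((HasDerivAt.fun_sum (u := Finset.univ) fun k _ =>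
      ((((HasDerivAt.fun_sum (u := Finset.univ) fun α _ => HasDerivAt.fun_sum (u := Finset.univ)
        fun β _ => HasDerivAt.fun_sum (u := Finset.univ) fun l _ =>
          (hv l β).const_mul (hUp h φ q.1 α β * dT α (fun r => gLow g φ ψ r k l) q)).const_mul
            (2 : ℝ)).fun_add (HasDerivAt.fun_sum (u := Finset.univ) fun α _ =>
              HasDerivAt.fun_sum (u := Finset.univ) fun l _ =>
                (hv l α).const_mul (curlU L φ ψ q α k l))).add_const
      ((∑ α, dT α (potU L φ ψ α k) (zeroJet q))
            + (∑ α, ∑ γ, potU L φ ψ α k q * christoffelH h φ q.1 γ α γ)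
            - dX k (potF L φ ψ) (zeroJet q))).const_mul (gUp g φ ψ q i k / 2)).const_mul
              (1 / 2 : ℝ))
  rw [e1.unique e2]
  simp only [velLine_zero, mul_ite, ite_mul, mul_one, mul_zero, zero_mul, Finset.sum_add_distrib,
    mul_add, Finset.sum_ite_eq', Finset.mem_univ, if_true]
  congr 1
  -- The derivative falls on the first velocity factor here and on the second in `e4`. The symmetry
  -- of h and of Γ in its lower indices makes both sums equal, which cancels the factor ½.
  have e3 : ∑ α, ∑ β, hUp h φ q.1 α β * ∑ k, ∑ l, (if k = j then if α = ε then
        christoffelG g φ ψ q i k l * q.2.2 l β else 0 else 0)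
      = ∑ β, hUp h φ q.1 ε β * ∑ l, christoffelG g φ ψ q i j l * q.2.2 l β := by
    rw [Finset.sum_comm]
    refine Finset.sum_congr rfl fun β _ => ?_
    rw [Finset.sum_eq_single ε (fun α _ hα => by simp [hα]) (by simp)]
    congr 1
    rw [Finset.sum_eq_single j (fun k _ hk => by simp [hk]) (by simp)]
    simp
  have e4 : ∑ α, ∑ β, hUp h φ q.1 α β * ∑ k, (if β = ε then
        christoffelG g φ ψ q i k j * q.2.2 k α else 0)
      = ∑ β, hUp h φ q.1 ε β * ∑ l, christoffelG g φ ψ q i j l * q.2.2 l β := by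
    refine Finset.sum_congr rfl fun α _ => ?_
    rw [Finset.sum_eq_single ε (fun β _ hβ => by simp [hβ]) (by simp), hUp_comm]
    congr 1
    exact Finset.sum_congr rfl fun k _ => by rw [if_pos rfl, christoffelG_comm]
  rw [e3, e4]
  ring

/-- The explicit form of the canonical nonlinear connection for `p ≥ 2`. -/
theorem IsKroneckerRegular.inducedN_eq (hp : 2 ≤ p) (hL : IsKroneckerRegular h g L)
    (hφ : φ ∈ smoothCharts p T) (hψ : ψ ∈ smoothCharts n M) {q : JCoord p n}
    (hq : q ∈ jetDomain φ ψ) (i j : Fin n) (α : Fin p) :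
    inducedN h (canonicalG h g L) φ ψ q i α j =
          (∑ k, christoffelG g φ ψ q i j k * q.2.2 k α)
            + (∑ k, gUp g φ ψ q i k / 2 * dT α (fun r => gLow g φ ψ r j k) q)
            + ∑ k, ∑ γ, gUp g φ ψ q i k / 4 * hLow h φ q.1 α γ * curlU L φ ψ q γ k j := by
  -- The h_{αγ} in the definition of N undoes the h^{εβ} left over from the derivative of the trace.
  -- In the curl term no inverse metric is present, so there h remains.
  have hδ : ∀ β, ∑ ε, hUp h φ q.1 ε β * hLow h φ q.1 α ε = if β = α then 1 else 0 := fun β => by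
    rw [← sum_inv_mul_apply (det_hLow_ne_zero h hφ hq.1) β α]
    exact Finset.sum_congr rfl fun ε _ => by
      rw [hLow_comm, hUp_comm]
      rfl
  simp only [inducedN, hL.dV_hTrace hp hφ hψ hq, add_mul, Finset.sum_add_distrib]
  have e1 : ∑ ε, (∑ β, hUp h φ q.1 ε β * ∑ l, christoffelG g φ ψ q i j l * q.2.2 l β)
      * hLow h φ q.1 α ε = ∑ k, christoffelG g φ ψ q i j k * q.2.2 k α := by
    simp only [Finset.sum_mul]
    rw [Finset.sum_comm]
    simp only [mul_right_comm, ← Finset.sum_mul, hδ]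
    simp
  have e2 : ∀ k, ∑ ε, (∑ μ, hUp h φ q.1 μ ε * dT μ (fun r => gLow g φ ψ r k j) q)
      * hLow h φ q.1 α ε = dT α (fun r => gLow g φ ψ r k j) q := by
    intro k
    simp only [Finset.sum_mul]
    rw [Finset.sum_comm]
    have e4 : ∀ μ, ∑ ε, hUp h φ q.1 μ ε * dT μ (fun r => gLow g φ ψ r k j) q * hLow h φ q.1 α ε
        = (if μ = α then 1 else 0) * dT μ (fun r => gLow g φ ψ r k j) q := fun μ => by
      rw [← hδ, Finset.sum_mul]
      exact Finset.sum_congr rfl fun ε _ => by rw [hUp_comm]; ring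
    simp [e4]
  rw [e1, add_assoc]
  congr 1
  have e3 : ∀ ε, (1 / 2 * ∑ k, gUp g φ ψ q i k / 2 *
          (2 * (∑ μ, hUp h φ q.1 μ ε * dT μ (fun r => gLow g φ ψ r k j) q)
            + curlU L φ ψ q ε k j)) * hLow h φ q.1 α ε
      = ∑ k, (gUp g φ ψ q i k / 2 * ((∑ μ, hUp h φ q.1 μ ε * dT μ (fun r => gLow g φ ψ r k j) q)
          * hLow h φ q.1 α ε) + gUp g φ ψ q i k / 4 * hLow h φ q.1 α ε * curlU L φ ψ q ε k j) := by
    intro ε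
    rw [Finset.mul_sum, Finset.sum_mul]
    exact Finset.sum_congr rfl fun _ _ => by ring
  simp only [e3]
  rw [Finset.sum_comm, ← Finset.sum_add_distrib]
  refine Finset.sum_congr rfl fun k _ => ?_
  rw [Finset.sum_add_distrib, ← Finset.mul_sum, e2]
  simp only [gLow_comm g φ ψ _ j k]

end ExplicitConnection

/-! ### The volume measure in local coordinates. -/

section Volume

variable {p : ℕ} {T : Type*} [TopologicalSpace T] [ChartedSpace (Rn p) T]
  {h : SemiRiemannianMetric p T} {φ φ' : LChart p T}

omit [ChartedSpace (Rn p) T] in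
theorem det_fderiv_trans (u : Rn p) :
    (fderiv ℝ (fun v => φ' (φ.symm v)) u).det = (Matrix.of (coordJac φ φ' u)).det := by
  have h1 := LinearMap.det_toMatrix (EuclideanSpace.basisFun (Fin p) ℝ).toBasis
    (fderiv ℝ (fun v => φ' (φ.symm v)) u : Rn p →ₗ[ℝ] Rn p)
  rw [ContinuousLinearMap.det, ← h1]
  congr 1

/-- The volume density `√|det h_{αβ}|`. -/
def volDensity (h : SemiRiemannianMetric p T) (φ : LChart p T) (t : Rn p) : ℝ :=
  √|(hLow h φ t).det|

theorem volDensity_pos (hφ : φ ∈ smoothCharts p T) {t : Rn p} (ht : t ∈ φ.target) :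
    0 < volDensity h φ t :=
  Real.sqrt_pos.2 (abs_pos.2 (det_hLow_ne_zero h hφ ht))

theorem continuousOn_volDensity (hφ : φ ∈ smoothCharts p T) :
    ContinuousOn (volDensity h φ) φ.target :=
  Real.continuous_sqrt.comp_continuousOn
    (contDiffOn_det (contDiffOn_hLow h hφ)).continuousOn.abs

/-- From h = Jᵀ h̃ J the determinant acquires the square of det J. This is the Jacobian factor in
the change of variables formula. -/
theorem volDensity_trans (hφ : φ ∈ smoothCharts p T) (hφ' : φ' ∈ smoothCharts p T) {t : Rn p}
    (ht : t ∈ transDom φ φ') :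
    volDensity h φ t = |(fderiv ℝ (fun v => φ' (φ.symm v)) t).det|
      * volDensity h φ' (φ' (φ.symm t)) := by
  have h1 : hLow h φ t = (Matrix.of (coordJac φ φ' t)).transpose * hLow h φ' (φ' (φ.symm t))
      * Matrix.of (coordJac φ φ' t) := by
    ext α β
    rw [hLow_trans h hφ hφ' ht]
    simp only [Matrix.mul_apply, Matrix.transpose_apply, Matrix.of_apply, Finset.sum_mul]
    rw [Finset.sum_comm]
    exact Finset.sum_congr rfl fun _ _ => Finset.sum_congr rfl fun _ _ => by ring
  rw [det_fderiv_trans, volDensity, volDensity, h1, Matrix.det_mul, Matrix.det_mul,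
    Matrix.det_transpose, mul_right_comm, abs_mul, Real.sqrt_mul (abs_nonneg _), abs_mul,
    Real.sqrt_mul_self (abs_nonneg _)]

variable [MeasurableSpace T] [BorelSpace T]

omit [ChartedSpace (Rn p) T] in
theorem aemeasurable_symm (φ : LChart p T) (f : Rn p → ENNReal) :
    AEMeasurable φ.symm (((volume : Measure (Rn p)).restrict φ.target).withDensity f) :=
  (φ.continuousOn_symm.aemeasurable φ.open_target.measurableSet).mono_ac
    (withDensity_absolutelyContinuous _ _)

theorem chartVolume_apply {s : Set T} (hs : MeasurableSet s) :
    chartVolume h φ s = ∫⁻ t in φ.target ∩ φ.symm ⁻¹' s, ENNReal.ofReal (volDensity h φ t) := by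
  -- The inverse chart is controlled only on its target, so preimages are measurable only up to null
  -- sets of the restricted measure.
  have h1 : NullMeasurableSet (φ.symm ⁻¹' s) ((volume : Measure (Rn p)).restrict φ.target) :=
    (φ.continuousOn_symm.aemeasurable φ.open_target.measurableSet).nullMeasurable hs
  rw [chartVolume, Measure.map_apply_of_aemeasurable (aemeasurable_symm φ _) hs,
    withDensity_apply₀ _ h1, Measure.restrict_restrict₀ h1, inter_comm]
  rfl

/-- The chart measure is carried by the chart domain, since the inverse chart maps the target into
it. -/
theorem chartVolume_inter_source {s : Set T} (hs : MeasurableSet s) :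
    chartVolume h φ (s ∩ φ.source) = chartVolume h φ s := by
  rw [chartVolume_apply hs, chartVolume_apply (hs.inter φ.open_source.measurableSet)]
  congr 2
  ext t
  simp only [mem_inter_iff, mem_preimage]
  exact ⟨fun ht => ⟨ht.1, ht.2.1⟩, fun ht => ⟨ht.1, ht.2, φ.map_target ht.1⟩⟩

/-- The local measures `√|h| dt¹⋯dtᵖ` agree on overlaps. -/
theorem chartVolume_eq_of_subset (hφ : φ ∈ smoothCharts p T) (hφ' : φ' ∈ smoothCharts p T)
    {s : Set T} (hs : MeasurableSet s) (h1 : s ⊆ φ.source) (h2 : s ⊆ φ'.source) :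
    chartVolume h φ s = chartVolume h φ' s := by
  -- The change of variables formula asks for a measurable set. It is obtained from continuity of
  -- the inverse chart on the target as a subspace.
  have hm : MeasurableSet (φ.target ∩ φ.symm ⁻¹' s) := by
    have h3 : Measurable (φ.target.domRestrict φ.symm) :=
      (continuousOn_iff_continuous_domRestrict.1 φ.continuousOn_symm).measurable
    convert φ.open_target.measurableSet.subtype_image (h3 hs) using 1
    ext t
    simp [Set.domRestrict, and_comm]
  have hd : ∀ t ∈ φ.target ∩ φ.symm ⁻¹' s, t ∈ transDom φ φ' := fun t ht => ⟨ht.1, h2 ht.2⟩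
  have hinj : InjOn (fun v => φ' (φ.symm v)) (φ.target ∩ φ.symm ⁻¹' s) := fun t ht u hu htu => by
    rw [← trans_trans (hd t ht), ← trans_trans (hd u hu)]
    exact congrArg (fun w => φ (φ'.symm w)) htu
  have himg : (fun v => φ' (φ.symm v)) '' (φ.target ∩ φ.symm ⁻¹' s)
      = φ'.target ∩ φ'.symm ⁻¹' s := by
    ext u
    constructor
    · rintro ⟨t, ht, rfl⟩
      refine ⟨(trans_mem (hd t ht)).1, ?_⟩
      simp only [mem_preimage, symm_trans (hd t ht)]
      exact ht.2
    · rintro ⟨hu, hus⟩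
      have hu' : u ∈ transDom φ' φ := ⟨hu, h1 hus⟩
      refine ⟨φ (φ'.symm u), ⟨(trans_mem hu').1, ?_⟩, trans_trans hu'⟩
      simp only [mem_preimage, symm_trans hu']
      exact hus
  rw [chartVolume_apply hs, chartVolume_apply hs, ← himg,
    lintegral_image_eq_lintegral_abs_det_fderiv_mul volume hm (fun t ht =>
      ((contDiffAt_trans hφ hφ' (hd t ht)).differentiableAt (by simp)).hasFDerivAt.hasFDerivWithinAt)
      hinj]
  refine setLIntegral_congr_fun hm fun t ht => ?_
  rw [volDensity_trans hφ hφ' (hd t ht), ENNReal.ofReal_mul (abs_nonneg _)]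

/-- On the domain of φ the two measures agree wherever both charts are defined. The measure ⊤ off
the domain makes the bound trivial there, so one measure dominates all chart measures and hence
their supremum. -/
theorem chartVolume_le (hφ : φ ∈ smoothCharts p T) (hφ' : φ' ∈ smoothCharts p T) :
    chartVolume h φ' ≤ chartVolume h φ + (⊤ : Measure T).restrict φ.sourceᶜ := by
  refine Measure.le_iff.2 fun s hs => ?_
  have ho := φ.open_source.measurableSet
  rw [← measure_inter_add_sdiff s ho, Measure.add_apply, Measure.restrict_apply hs]
  refine add_le_add ?_ (Measure.le_iff'.1 le_top _)
  have h1 := hs.inter ho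
  rw [← chartVolume_inter_source h1, ← chartVolume_eq_of_subset hφ hφ'
    (h1.inter φ'.open_source.measurableSet) (fun x hx => hx.1.2) fun x hx => hx.2]
  exact measure_mono fun x hx => hx.1.1

/-- The volume measure restricts to `√|h| dt¹⋯dtᵖ` on the domain of every chart. -/
theorem volumeMeasure_restrict_source (hφ : φ ∈ smoothCharts p T) :
    (volumeMeasure h).restrict φ.source = chartVolume h φ := by
  have ho := φ.open_source.measurableSet
  have h0 : (chartVolume h φ).restrict φ.source = chartVolume h φ := by
    ext s hs
    rw [Measure.restrict_apply hs, chartVolume_inter_source hs]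
  refine le_antisymm ?_ ?_
  · have h1 : volumeMeasure h ≤ chartVolume h φ + (⊤ : Measure T).restrict φ.sourceᶜ :=
      iSup_le fun φ' => chartVolume_le hφ φ'.2
    refine (Measure.restrict_mono le_rfl h1).trans ?_
    rw [Measure.restrict_add, h0, Measure.restrict_restrict ho, inter_compl_self,
      Measure.restrict_empty, add_zero]
  · rw [← h0]
    exact Measure.restrict_mono le_rfl
      (le_iSup (fun φ : smoothCharts p T => chartVolume h (φ : LChart p T)) ⟨φ, hφ⟩)

/-- Around each point, a chart neighbourhood that corresponds to a compact part of the target has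
finite measure, because the density is continuous. Compactness of `T` does the rest. -/
instance isFiniteMeasure_volumeMeasure [CompactSpace T] [IsManifold (𝓡 p) ∞ T] :
    IsFiniteMeasure (volumeMeasure h) := by
  have : IsLocallyFiniteMeasure (volumeMeasure h) := by
    refine ⟨fun x => ?_⟩
    set φ := chartAt (Rn p) x
    have hφ : φ ∈ smoothCharts p T := IsManifold.chart_mem_maximalAtlas x
    have hx : x ∈ φ.source := mem_chart_source _ x
    obtain ⟨K, hK, hKx, hKt⟩ := exists_compact_subset φ.open_target (φ.map_source hx)
    have hN : φ.source ∩ φ ⁻¹' interior K ∈ 𝓝 x :=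
      inter_mem (φ.open_source.mem_nhds hx)
        ((φ.continuousAt hx).preimage_mem_nhds (isOpen_interior.mem_nhds hKx))
    have hNo : IsOpen (φ.source ∩ φ ⁻¹' interior K) :=
      φ.isOpen_inter_preimage isOpen_interior
    refine ⟨_, hN, ?_⟩
    have h1 : volumeMeasure h (φ.source ∩ φ ⁻¹' interior K)
        = chartVolume h φ (φ.source ∩ φ ⁻¹' interior K) := by
      rw [← volumeMeasure_restrict_source hφ, Measure.restrict_apply hNo.measurableSet,
        inter_right_comm, inter_self]
    rw [h1, chartVolume_apply hNo.measurableSet]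
    have h2 : IntegrableOn (volDensity h φ) K volume :=
      ((continuousOn_volDensity hφ).mono hKt).integrableOn_compact hK
    refine (lintegral_mono_set fun t ht => ?_).trans_lt h2.lintegral_lt_top
    have h3 := ht.2.2
    simp only [mem_preimage, φ.right_inv ht.1] at h3
    exact interior_subset h3
  infer_instance

theorem setIntegral_source (hφ : φ ∈ smoothCharts p T) {F : T → ℝ}
    (hF : AEStronglyMeasurable F (volumeMeasure h)) :
    ∫ x in φ.source, F x ∂(volumeMeasure h) = ∫ t in φ.target, volDensity h φ t * F (φ.symm t) := by
  have h1 := volumeMeasure_restrict_source (h := h) hφ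
  have h2 : AEStronglyMeasurable F (chartVolume h φ) := h1 ▸ hF.restrict
  rw [h1]
  rw [chartVolume, integral_map (aemeasurable_symm φ _) h2]
  have h3 : AEMeasurable (fun t => Real.toNNReal (volDensity h φ t))
      ((volume : Measure (Rn p)).restrict φ.target) :=
    ((continuousOn_volDensity hφ).aemeasurable φ.open_target.measurableSet).real_toNNReal
  have h4 := integral_withDensity_eq_integral_smul₀ h3 (fun t => F (φ.symm t))
  refine h4.trans ?_
  refine setIntegral_congr_fun φ.open_target.measurableSet fun t ht => ?_
  simp only [NNReal.smul_def, smul_eq_mul, Real.coe_toNNReal _ (volDensity_pos hφ ht).le]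

end Volume

/-! ### Differentiation under the integral sign. -/

section ParametricIntegral

variable {E : Type*} [TopologicalSpace E] [T2Space E] [MeasurableSpace E] [BorelSpace E]

/-- Differentiation under the integral over a compact set. -/
theorem hasDerivAt_setIntegral_of_isCompact {μ : Measure E} [IsFiniteMeasureOnCompacts μ]
    {K : Set E} (hK : IsCompact K) {Ω : Set (ℝ × E)} (hΩ : IsOpen Ω)
    (hKΩ : ∀ t ∈ K, ((0 : ℝ), t) ∈ Ω) {G G' : ℝ → E → ℝ}
    (hG : ContinuousOn (fun z : ℝ × E => G z.1 z.2) Ω)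
    (hG' : ContinuousOn (fun z : ℝ × E => G' z.1 z.2) Ω)
    (hd : ∀ z ∈ Ω, HasDerivAt (fun s => G s z.2) (G' z.1 z.2) z.1) :
    HasDerivAt (fun s => ∫ t in K, G s t ∂μ) (∫ t in K, G' 0 t ∂μ) 0 := by
  -- The tube lemma gives one interval of parameters that works for all points of `K`. On a smaller
  -- closed interval times `K` the derivative is bounded by compactness, and this constant is the
  -- dominating function.
  obtain ⟨U, V, hU, hV, h0U, hKV, hUV⟩ := generalized_tube_lemma (isCompact_singleton (x := (0 : ℝ)))
    hK hΩ (by rintro ⟨s, t⟩ ⟨hs, ht⟩; obtain rfl : s = 0 := hs; exact hKΩ t ht)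
  obtain ⟨ε, hε, hεU⟩ := Metric.isOpen_iff.1 hU 0 (h0U rfl)
  have hsub : ∀ s ∈ Metric.ball (0 : ℝ) ε, ∀ t ∈ K, (s, t) ∈ Ω := fun s hs t ht =>
    hUV ⟨hεU hs, hKV ht⟩
  have hslice : ∀ F : ℝ × E → ℝ, ContinuousOn F Ω → ∀ s ∈ Metric.ball (0 : ℝ) ε,
      ContinuousOn (fun t => F (s, t)) K := fun F hF s hs =>
    hF.comp (by fun_prop) fun t ht => hsub s hs t ht
  obtain ⟨C, hC⟩ := ((isCompact_closedBall (0 : ℝ) (ε / 2)).prod hK).exists_bound_of_continuousOn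
    (hG'.mono fun z hz => hsub z.1 (Metric.closedBall_subset_ball (by linarith) hz.1) z.2 hz.2)
  have h0 : (0 : ℝ) ∈ Metric.ball (0 : ℝ) ε := Metric.mem_ball_self hε
  refine (hasDerivAt_integral_of_dominated_loc_of_deriv_le (bound := fun _ => C)
    (Metric.ball_mem_nhds (0 : ℝ) (half_pos hε)) ?_ ?_ ?_ ?_ ?_ ?_).2
  · filter_upwards [Metric.ball_mem_nhds (0 : ℝ) hε] with s hs
    exact ((hslice _ hG s hs).integrableOn_compact hK).aestronglyMeasurable
  · exact (hslice _ hG 0 h0).integrableOn_compact hK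
  · exact ((hslice _ hG' 0 h0).integrableOn_compact hK).aestronglyMeasurable
  · refine (ae_restrict_iff' hK.measurableSet).2 (ae_of_all _ fun t ht s hs => ?_)
    exact hC (s, t) ⟨Metric.ball_subset_closedBall hs, ht⟩
  · exact integrableOn_const hK.measure_lt_top.ne
  · refine (ae_restrict_iff' hK.measurableSet).2 (ae_of_all _ fun t ht s hs => ?_)
    exact hd (s, t) (hsub s (Metric.ball_subset_ball (by linarith) hs) t ht)

end ParametricIntegral

/-! ### The first variation and the Euler–Lagrange equations in coordinates. -/

section Variation

variable {p n : ℕ}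

/-- The `1`-jet of a map `ℝᵖ → ℝⁿ`. -/
def curveJet (u : Rn p → Rn n) (t : Rn p) : JCoord p n :=
  (t, u t, fun i α => fderiv ℝ (fun s => u s i) t (stdVec α))

/-- The derivative of the `1`-jet of a map in the direction of the variation `χ e_k`. -/
def dirJet (χ : Rn p → ℝ) (k : Fin n) (t : Rn p) : JCoord p n :=
  (0, χ t • stdVec k, Pi.single k fun α => fderiv ℝ χ t (stdVec α))

/-- Taking jets is linear in the map, so a variation linear in the parameter moves the jet along a
straight line. The first variation is then a directional derivative of ℓ. -/
theorem curveJet_add {u : Rn p → Rn n} {χ : Rn p → ℝ} {t : Rn p} (hu : DifferentiableAt ℝ u t)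
    (hχ : DifferentiableAt ℝ χ t) (k : Fin n) (σ : ℝ) :
    curveJet (fun s => u s + (σ * χ s) • stdVec k) t = curveJet u t + σ • dirJet χ k t := by
  have hui : ∀ i, DifferentiableAt ℝ (fun s => u s i) t := fun i =>
    (EuclideanSpace.proj i : Rn n →L[ℝ] ℝ).differentiableAt.comp t hu
  refine Prod.ext (by simp [curveJet, dirJet]) (Prod.ext ?_ ?_)
  · simp [curveJet, dirJet, mul_smul]
  · funext i α
    change fderiv ℝ (fun s => u s i + (σ * χ s) * (stdVec k : Rn n) i) t (stdVec α) = _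
    have h1 := (hui i).hasFDerivAt.fun_add
      ((hχ.hasFDerivAt.const_mul σ).mul_const ((stdVec k : Rn n) i))
    rw [h1.fderiv]
    by_cases hik : i = k
    · subst hik
      simp [curveJet, dirJet]
    · simp [curveJet, dirJet, hik]

theorem fderiv_dirJet (F : JCoord p n → ℝ) (q : JCoord p n) (χ : Rn p → ℝ) (k : Fin n)
    (t : Rn p) : fderiv ℝ F q (dirJet χ k t)
      = χ t * dX k F q + ∑ α, fderiv ℝ χ t (stdVec α) * dV k α F q := by
  rw [fderiv_eq_sum]
  have h1 : ∑ i, ∑ γ, (Pi.single k (fun α => fderiv ℝ χ t (stdVec α)) : Fin n → Fin p → ℝ) i γ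
      * dV i γ F q = ∑ α, fderiv ℝ χ t (stdVec α) * dV k α F q := by
    rw [Finset.sum_eq_single k (fun i _ hi => by simp [hi]) (by simp)]
    simp
  simp [dirJet, h1]

theorem continuous_dirJet {χ : Rn p → ℝ} (hχ : ContDiff ℝ ∞ χ) (k : Fin n) :
    Continuous (dirJet (n := n) χ k) := by
  refine continuous_const.prodMk ((hχ.continuous.smul continuous_const).prodMk ?_)
  refine continuous_pi fun i => continuous_pi fun α => ?_
  by_cases hik : i = k
  · subst hik
    simpa using (hχ.continuous_fderiv (by simp)).clm_apply continuous_const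
  · simp [hik, continuous_const]

theorem contDiffOn_curveJet {u : Rn p → Rn n} {W : Set (Rn p)} (hW : IsOpen W)
    (hu : ContDiffOn ℝ ∞ u W) : ContDiffOn ℝ ∞ (curveJet u) W :=
  contDiffOn_id.prodMk (hu.prodMk (contDiffOn_pi.2 fun i => contDiffOn_pi.2 fun _ =>
    contDiffOn_fderiv_apply hW
      ((EuclideanSpace.proj i : Rn n →L[ℝ] ℝ).contDiff.comp_contDiffOn hu) _))

/-- The first variation of an integral `∫ ρ ℓ(t, x, x_α) dt`. -/
theorem hasDerivAt_integral_variation {ℓ : JCoord p n → ℝ} {D : Set (JCoord p n)} (hD : IsOpen D)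
    (hℓ : ContDiffOn ℝ ∞ ℓ D) {W : Set (Rn p)} (hW : IsOpen W) {u : Rn p → Rn n}
    (hu : ContDiffOn ℝ ∞ u W) (hm : ∀ t ∈ W, curveJet u t ∈ D) {ρ : Rn p → ℝ}
    (hρ : ContinuousOn ρ W) {χ : Rn p → ℝ} (hχ : ContDiff ℝ ∞ χ) (hχc : HasCompactSupport χ)
    (hχW : tsupport χ ⊆ W) (k : Fin n) :
    HasDerivAt (fun σ : ℝ => ∫ t in tsupport χ, ρ t * ℓ (curveJet u t + σ • dirJet χ k t))
      (∫ t in tsupport χ, ρ t * fderiv ℝ ℓ (curveJet u t) (dirJet χ k t)) 0 := by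
  set Ψ : ℝ × Rn p → JCoord p n := fun z => curveJet u z.2 + z.1 • dirJet χ k z.2
  have hΨ : ContinuousOn Ψ (univ ×ˢ W) := by
    have h1 : ContinuousOn (fun z : ℝ × Rn p => curveJet u z.2) (univ ×ˢ W) :=
      (contDiffOn_curveJet hW hu).continuousOn.comp continuousOn_snd fun z hz => hz.2
    have h2 : Continuous fun z : ℝ × Rn p => z.1 • dirJet (n := n) χ k z.2 :=
      continuous_fst.smul ((continuous_dirJet hχ k).comp continuous_snd)
    exact h1.add h2.continuousOn
  have hΩ : IsOpen ((univ ×ˢ W) ∩ Ψ ⁻¹' D) := hΨ.isOpen_inter_preimage (isOpen_univ.prod hW) hD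
  have hρz : ContinuousOn (fun z : ℝ × Rn p => ρ z.2) ((univ ×ˢ W) ∩ Ψ ⁻¹' D) :=
    hρ.comp continuousOn_snd fun z hz => hz.1.2
  have h0 : ∀ t, curveJet u t + (0 : ℝ) • dirJet χ k t = curveJet u t := by simp
  have key := hasDerivAt_setIntegral_of_isCompact (μ := (volume : Measure (Rn p))) hχc.isCompact hΩ
    (fun t ht => ⟨⟨mem_univ _, hχW ht⟩, by simpa [Ψ] using hm t (hχW ht)⟩)
    (G := fun s t => ρ t * ℓ (Ψ (s, t)))
    (G' := fun s t => ρ t * fderiv ℝ ℓ (Ψ (s, t)) (dirJet χ k t))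
    (hρz.mul (hℓ.continuousOn.comp (hΨ.mono inter_subset_left) fun z hz => hz.2))
    (hρz.mul ((((hℓ.continuousOn_fderiv_of_isOpen hD (by simp)).comp
      (hΨ.mono inter_subset_left) fun z hz => hz.2)).clm_apply
        ((continuous_dirJet hχ k).comp continuous_snd).continuousOn))
    (fun z hz => by
      have h1 : HasDerivAt (fun s : ℝ => Ψ (s, z.2)) (dirJet χ k z.2) z.1 := by
        exact (((hasDerivAt_id z.1).smul_const (dirJet χ k z.2)).const_add
          (curveJet u z.2)).congr_deriv (one_smul ℝ _)
      have h2 := (differentiableAt_of_contDiffOn hD hℓ hz.2).hasFDerivAt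
      exact (h2.comp_hasDerivAt z.1 h1).const_mul _)
  simpa only [Ψ, h0] using key

/-- `B` is arbitrary outside `W`, but the product vanishes on a neighbourhood of every point off the
support of χ. It is thus continuous with compact support. -/
theorem integrable_mul_of_tsupport {χ B : Rn p → ℝ} {W : Set (Rn p)} (hW : IsOpen W)
    (hχ : Continuous χ) (hχc : HasCompactSupport χ) (hχW : tsupport χ ⊆ W)
    (hB : ContinuousOn B W) : Integrable (fun t => χ t * B t) := by
  have hs : tsupport (fun t => χ t * B t) ⊆ tsupport χ := tsupport_mul_subset_left
  have hc : Continuous fun t => χ t * B t := by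
    refine continuous_iff_continuousAt.2 fun t => ?_
    by_cases ht : t ∈ tsupport χ
    · exact hχ.continuousAt.mul (hB.continuousAt (hW.mem_nhds (hχW ht)))
    · have h1 : (fun t => χ t * B t) =ᶠ[𝓝 t] fun _ => 0 := by
        filter_upwards [(isClosed_tsupport χ).isOpen_compl.mem_nhds ht] with s hs
        rw [image_eq_zero_of_notMem_tsupport hs, zero_mul]
      exact continuousAt_const.congr h1.symm
  exact hc.integrable_of_hasCompactSupport hχc.mul_right

/-- The Euler–Lagrange equations of an integral `∫ ρ ℓ(t, x, x_α) dt`. -/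
theorem euler_lagrange {ℓ : JCoord p n → ℝ} {D : Set (JCoord p n)} (hD : IsOpen D)
    (hℓ : ContDiffOn ℝ ∞ ℓ D) {W : Set (Rn p)} (hW : IsOpen W) {u : Rn p → Rn n}
    (hu : ContDiffOn ℝ ∞ u W) (hm : ∀ t ∈ W, curveJet u t ∈ D) {ρ : Rn p → ℝ}
    (hρ : ContDiffOn ℝ ∞ ρ W) (k : Fin n)
    (H : ∀ χ : Rn p → ℝ, ContDiff ℝ ∞ χ → HasCompactSupport χ → tsupport χ ⊆ W →
      ∫ t in tsupport χ, ρ t * fderiv ℝ ℓ (curveJet u t) (dirJet χ k t) = 0) {t : Rn p}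
    (ht : t ∈ W) :
    ∑ α, fderiv ℝ (fun s => ρ s * dV k α ℓ (curveJet u s)) t (stdVec α)
      = ρ t * dX k ℓ (curveJet u t) := by
  have hJ := contDiffOn_curveJet hW hu
  set A : Rn p → ℝ := fun s => ρ s * dX k ℓ (curveJet u s) with hA
  set B : Fin p → Rn p → ℝ := fun α s => ρ s * dV k α ℓ (curveJet u s) with hB
  have hAs : ContDiffOn ℝ ∞ A W := hρ.mul ((contDiffOn_dX hD hℓ k).comp hJ hm)
  have hBs : ∀ α, ContDiffOn ℝ ∞ (B α) W := fun α =>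
    hρ.mul ((contDiffOn_dV hD hℓ k α).comp hJ hm)
  have hdB : ∀ α, ContinuousOn (fun s => fderiv ℝ (B α) s (stdVec α)) W := fun α =>
    (contDiffOn_fderiv_apply hW (hBs α) _).continuousOn
  set e : Rn p → ℝ := fun s => A s - ∑ α, fderiv ℝ (B α) s (stdVec α)
  have he : ContinuousOn e W := hAs.continuousOn.sub (continuousOn_finsetSum _ fun α _ => hdB α)
  -- The fundamental lemma of the calculus of variations, applied to the difference of the two
  -- sides.
  have hae : ∀ᵐ s ∂(volume : Measure (Rn p)), s ∈ W → e s = 0 := by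
    refine hW.ae_eq_zero_of_integral_contDiff_smul_eq_zero
      (he.locallyIntegrableOn hW.measurableSet) fun χ hχ hχc hχW => ?_
    have i1 : ∀ α, Integrable (fun s => χ s * fderiv ℝ (B α) s (stdVec α)) := fun α =>
      integrable_mul_of_tsupport hW hχ.continuous hχc hχW (hdB α)
    have i2 : ∀ α, Integrable (fun s => fderiv ℝ χ s (stdVec α) * B α s) := fun α =>
      integrable_mul_of_tsupport hW ((hχ.continuous_fderiv (by simp)).clm_apply continuous_const)
        (hχc.fderiv_apply ℝ _) ((tsupport_fderiv_apply_subset ℝ _).trans hχW) (hBs α).continuousOn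
    have i3 : Integrable (fun s => χ s * A s) :=
      integrable_mul_of_tsupport hW hχ.continuous hχc hχW hAs.continuousOn
    have i4 : ∀ α, Integrable (fun s => χ s * B α s) := fun α =>
      integrable_mul_of_tsupport hW hχ.continuous hχc hχW (hBs α).continuousOn
    -- Integration by parts in direction α. There is no boundary term since χ has compact support,
    -- and `B α` needs to be differentiable only on that support.
    have h1 : ∀ α, ∫ s, χ s * fderiv ℝ (B α) s (stdVec α)
        = -∫ s, fderiv ℝ χ s (stdVec α) * B α s := by
      intro α
      have := integral_mul_fderiv_eq_neg_fderiv_mul_of_integrable (μ := (volume : Measure (Rn p)))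
        (f := B α) (g := χ) (v := stdVec α)
        (by simpa only [mul_comm] using i1 α) (by simpa only [mul_comm] using i2 α)
        (by simpa only [mul_comm] using i4 α)
        (fun s hs => differentiableAt_of_contDiffOn hW (hBs α) (hχW hs))
        (fun s _ => hχ.differentiable (by simp) s)
      simp only [mul_comm (B α _), mul_comm (fderiv ℝ (B α) _ _)] at this
      linarith
    have h2 : ∫ s, χ s • e s = ∫ s, (χ s * A s + ∑ α, fderiv ℝ χ s (stdVec α) * B α s) := by
      simp only [e, smul_eq_mul, mul_sub, Finset.mul_sum]
      rw [integral_sub i3 (integrable_finsetSum _ fun α _ => i1 α),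
        integral_add i3 (integrable_finsetSum _ fun α _ => i2 α),
        integral_finsetSum _ fun α _ => i1 α, integral_finsetSum _ fun α _ => i2 α]
      simp [h1]
    rw [h2, ← H χ hχ hχc hχW, ← setIntegral_eq_integral_of_forall_compl_eq_zero (s := tsupport χ)]
    · refine setIntegral_congr_fun (isClosed_tsupport χ).measurableSet fun s _ => ?_
      simp only [fderiv_dirJet, hA, hB, mul_add, Finset.mul_sum]
      congr 1
      · ring
      · exact Finset.sum_congr rfl fun _ _ => by ring
    · intro s hs
      have h3 : ∀ α, fderiv ℝ χ s (stdVec α) = 0 := fun α =>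
        image_eq_zero_of_notMem_tsupport (f := fun s => fderiv ℝ χ s (stdVec α))
          fun h => hs (tsupport_fderiv_apply_subset ℝ _ h)
      simp [image_eq_zero_of_notMem_tsupport hs, h3]
  -- Both functions are continuous on the open set `W`, so equality almost everywhere holds at every
  -- point.
  have h4 : EqOn e (fun _ => 0) W := Measure.eqOn_open_of_ae_eq
    ((ae_restrict_iff' hW.measurableSet).2 hae) hW he continuousOn_const
  have h5 := h4 ht
  simp only [e] at h5
  linarith

end Variation

/-! ### Maps `T → M` and their jets in coordinates. -/

section LocalRepresentative

variable {p n : ℕ} {T M : Type*} [TopologicalSpace T] [ChartedSpace (Rn p) T]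
  [TopologicalSpace M] [ChartedSpace (Rn n) M]
  {h : SemiRiemannianMetric p T} {L : Jet p n T M → ℝ}
  {φ : LChart p T} {ψ : LChart n M} {f : T → M}

/-- The domain of the local expression of `f`. -/
def mapDom (φ : LChart p T) (ψ : LChart n M) (f : T → M) : Set (Rn p) :=
  φ.target ∩ φ.symm ⁻¹' (f ⁻¹' ψ.source)

/-- The local expression of `f`. -/
def locRep (φ : LChart p T) (ψ : LChart n M) (f : T → M) (t : Rn p) : Rn n := ψ (f (φ.symm t))

omit [ChartedSpace (Rn p) T] [ChartedSpace (Rn n) M] in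
theorem isOpen_mapDom (hf : Continuous f) : IsOpen (mapDom φ ψ f) :=
  φ.isOpen_inter_preimage_symm (ψ.open_source.preimage hf)

theorem contDiffOn_locRep (hφ : φ ∈ smoothCharts p T) (hψ : ψ ∈ smoothCharts n M)
    (hf : ContMDiff (𝓡 p) (𝓡 n) ∞ f) : ContDiffOn ℝ ∞ (locRep φ ψ f) (mapDom φ ψ f) := by
  have h1 : ContMDiffOn (𝓡 p) (𝓡 n) ∞ (f ∘ φ.symm) (mapDom φ ψ f) :=
    hf.comp_contMDiffOn ((contMDiffOn_symm_of_mem_maximalAtlas hφ).mono inter_subset_left)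
  exact ((contMDiffOn_of_mem_maximalAtlas hψ).comp h1 fun t ht => ht.2).contDiffOn

omit [ChartedSpace (Rn p) T] [ChartedSpace (Rn n) M] in
theorem curveJet_locRep_mem {t : Rn p} (ht : t ∈ mapDom φ ψ f) :
    curveJet (locRep φ ψ f) t ∈ jetDomain φ ψ := ⟨ht.1, ψ.map_source ht.2⟩

theorem fderiv_locRep (hφ : φ ∈ smoothCharts p T) (hψ : ψ ∈ smoothCharts n M)
    (hf : ContMDiff (𝓡 p) (𝓡 n) ∞ f) {t : Rn p} (ht : t ∈ mapDom φ ψ f) :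
    fderiv ℝ (locRep φ ψ f) t = (dchart ψ (f (φ.symm t))).comp
      ((mfderiv (𝓡 p) (𝓡 n) f (φ.symm t) : Rn p →L[ℝ] Rn n).comp (dsymm φ t)) := by
  have h1 : MDifferentiableAt (𝓡 p) (𝓡 p) φ.symm t :=
    (mdifferentiable_of_mem_smoothCharts hφ).symm.mdifferentiableAt ht.1
  have h2 : MDifferentiableAt (𝓡 p) (𝓡 n) f (φ.symm t) := hf.mdifferentiable (by simp) _
  have h3 : MDifferentiableAt (𝓡 n) (𝓡 n) ψ (f (φ.symm t)) :=
    (mdifferentiable_of_mem_smoothCharts hψ).mdifferentiableAt ht.2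
  have h4 := mfderiv_comp t h2 h1
  have h5 := mfderiv_comp (f := f ∘ φ.symm) t h3 (h2.comp t h1)
  rw [h4] at h5
  rw [← mfderiv_eq_fderiv]
  exact h5

theorem Jet.ext_of_eq {t t' : T} {x x' : M} {A A' : Rn p →L[ℝ] Rn n} (ht : t = t') (hx : x = x')
    (hA : A = A') : (⟨t, x, A⟩ : Jet p n T M) = ⟨t', x', A'⟩ := by
  subst ht hx hA
  rfl

/-- The coordinates of the `1`-jet of `f`. -/
theorem jetOfCoord_curveJet (hφ : φ ∈ smoothCharts p T) (hψ : ψ ∈ smoothCharts n M)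
    (hf : ContMDiff (𝓡 p) (𝓡 n) ∞ f) {t : Rn p} (ht : t ∈ mapDom φ ψ f) :
    jetOfCoord φ ψ (curveJet (locRep φ ψ f) t) = jetProlong p n f (φ.symm t) := by
  have hx : ψ.symm (locRep φ ψ f t) = f (φ.symm t) := ψ.left_inv ht.2
  refine Jet.ext_of_eq (A := ((dsymm ψ (locRep φ ψ f t)).comp
    (matLin (curveJet (locRep φ ψ f) t).2.2)).comp (dchart φ (φ.symm t))) rfl hx ?_
  have hd : DifferentiableAt ℝ (locRep φ ψ f) t :=
    ((contDiffOn_locRep hφ hψ hf).contDiffAt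
      ((isOpen_mapDom hf.continuous).mem_nhds ht)).differentiableAt (by simp)
  have h1 : matLin (curveJet (locRep φ ψ f) t).2.2 = fderiv ℝ (locRep φ ψ f) t := by
    ext v k
    rw [matLin_apply]
    have h2 : HasFDerivAt (fun s => locRep φ ψ f s k)
        ((EuclideanSpace.proj k : Rn n →L[ℝ] ℝ).comp (fderiv ℝ (locRep φ ψ f) t)) t :=
      (EuclideanSpace.proj k : Rn n →L[ℝ] ℝ).hasFDerivAt.comp t hd.hasFDerivAt
    have h3 : fderiv ℝ (locRep φ ψ f) t v k
        = fderiv ℝ (fun s => locRep φ ψ f s k) t v := by rw [h2.fderiv]; rfl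
    rw [h3, map_eq_sum_stdVec]
    simp [curveJet, mul_comm]
  have h4 := dsymm_dchart hψ (ψ.map_source ht.2)
  rw [ψ.left_inv ht.2] at h4
  have h5 := dsymm_dchart hφ ht.1
  rw [h1, fderiv_locRep hφ hψ hf ht]
  calc _ = ((dsymm ψ (ψ (f (φ.symm t)))).comp (dchart ψ (f (φ.symm t)))).comp
        ((mfderiv (𝓡 p) (𝓡 n) f (φ.symm t) : Rn p →L[ℝ] Rn n).comp
          ((dsymm φ t).comp (dchart φ (φ.symm t)))) := rfl
    _ = _ := by rw [h4, h5]; rfl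

theorem lagrangian_symm (hφ : φ ∈ smoothCharts p T) (hψ : ψ ∈ smoothCharts n M)
    (hf : ContMDiff (𝓡 p) (𝓡 n) ∞ f) {t : Rn p} (ht : t ∈ mapDom φ ψ f) :
    L (jetProlong p n f (φ.symm t)) = locL L φ ψ (curveJet (locRep φ ψ f) t) := by
  rw [locL, jetOfCoord_curveJet hφ hψ hf ht]

theorem jetProlong_congr {f' : T → M} {x : T} (hff : f' =ᶠ[𝓝 x] f) :
    jetProlong p n f' x = jetProlong p n f x :=
  Jet.ext_of_eq (A := (mfderiv (𝓡 p) (𝓡 n) f' x : Rn p →L[ℝ] Rn n)) rfl hff.eq_of_nhds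
    hff.mfderiv_eq

/-- Makes the energy integrand integrable on the compact `T`, so that the difference of two energies
is the integral of a difference. -/
theorem continuous_lagrangian [IsManifold (𝓡 p) ∞ T] [IsManifold (𝓡 n) ∞ M]
    (hL : IsSmoothOnJets L) (hf : ContMDiff (𝓡 p) (𝓡 n) ∞ f) :
    Continuous fun x => L (jetProlong p n f x) := by
  refine continuous_iff_continuousAt.2 fun x => ?_
  set φ := chartAt (Rn p) x
  set ψ := chartAt (Rn n) (f x)
  have hφ : φ ∈ smoothCharts p T := IsManifold.chart_mem_maximalAtlas x
  have hψ : ψ ∈ smoothCharts n M := IsManifold.chart_mem_maximalAtlas (f x)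
  have hx : x ∈ φ.source := mem_chart_source _ x
  have hxW : φ x ∈ mapDom φ ψ f := by
    refine ⟨φ.map_source hx, ?_⟩
    simp only [mem_preimage, φ.left_inv hx]
    exact mem_chart_source _ (f x)
  have hW := isOpen_mapDom (φ := φ) (ψ := ψ) hf.continuous
  have h1 : ContinuousAt (fun t => locL L φ ψ (curveJet (locRep φ ψ f) t)) (φ x) :=
    (((hL φ hφ ψ hψ).continuousOn.comp
      (contDiffOn_curveJet hW (contDiffOn_locRep hφ hψ hf)).continuousOn
        fun t ht => curveJet_locRep_mem ht)).continuousAt (hW.mem_nhds hxW)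
  refine (ContinuousAt.comp (f := φ) h1 (φ.continuousAt hx)).congr ?_
  filter_upwards [φ.open_source.mem_nhds hx,
    (φ.continuousAt hx).preimage_mem_nhds (hW.mem_nhds hxW)] with y hy hyW
  rw [Function.comp_apply, ← lagrangian_symm hφ hψ hf hyW, φ.left_inv hy]

end LocalRepresentative

/-! ### Global variations supported in one pair of charts. -/

section LocalVariation

variable {p n : ℕ} {T M : Type*} [TopologicalSpace T] [ChartedSpace (Rn p) T]
  [TopologicalSpace M] [ChartedSpace (Rn n) M]
  {h : SemiRiemannianMetric p T} {L : Jet p n T M → ℝ}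
  {φ : LChart p T} {ψ : LChart n M} {f : T → M}

open Classical in
/-- The variation of `f` that is `x^k ↦ x^k + θ(s) χ(t)` in local coordinates. -/
def localVariation (φ : LChart p T) (ψ : LChart n M) (f : T → M) (χ : Rn p → ℝ) (k : Fin n)
    (θ : ℝ → ℝ) (z : ℝ × T) : M :=
  if z.2 ∈ φ.symm '' tsupport χ then
    ψ.symm (ψ (f z.2) + (θ z.1 * χ (φ z.2)) • stdVec k) else f z.2

variable {χ : Rn p → ℝ} {k : Fin n} {θ : ℝ → ℝ}

omit [ChartedSpace (Rn p) T] [ChartedSpace (Rn n) M] in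
theorem localVariation_of_notMem {z : ℝ × T} (hz : z.2 ∉ φ.symm '' tsupport χ) :
    localVariation φ ψ f χ k θ z = f z.2 := if_neg hz

-- Off the support χ vanishes, so the coordinate formula returns `f` there. The formula is therefore
-- valid on an open set around the support, which gives smoothness across its boundary.
omit [ChartedSpace (Rn p) T] [ChartedSpace (Rn n) M] in
theorem localVariation_of_mem {z : ℝ × T} (hz : z.2 ∈ φ.source) (hz' : φ z.2 ∈ mapDom φ ψ f) :
    localVariation φ ψ f χ k θ z = ψ.symm (ψ (f z.2) + (θ z.1 * χ (φ z.2)) • stdVec k) := by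
  by_cases h1 : z.2 ∈ φ.symm '' tsupport χ
  · exact if_pos h1
  · have h2 : φ z.2 ∉ tsupport χ := fun h2 => h1 ⟨_, h2, φ.left_inv hz⟩
    have h3 : f z.2 ∈ ψ.source := by
      have := hz'.2
      simpa only [mem_preimage, φ.left_inv hz] using this
    rw [localVariation_of_notMem h1, image_eq_zero_of_notMem_tsupport h2]
    simp [ψ.left_inv h3]

omit [ChartedSpace (Rn p) T] [ChartedSpace (Rn n) M] in
theorem locRep_add_mem (hθ : ∀ s, ∀ t ∈ tsupport χ,
      locRep φ ψ f t + (θ s * χ t) • stdVec k ∈ ψ.target) (s : ℝ) {t : Rn p}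
    (ht : t ∈ mapDom φ ψ f) : locRep φ ψ f t + (θ s * χ t) • stdVec k ∈ ψ.target := by
  by_cases h1 : t ∈ tsupport χ
  · exact hθ s t h1
  · rw [image_eq_zero_of_notMem_tsupport h1]
    simpa [locRep] using ψ.map_source ht.2

/-- The image of the support is compact, hence closed in the Hausdorff space `T`. Off it the
variation is `f` near each point, and near its points the coordinate formula holds. -/
theorem contMDiff_localVariation [T2Space T] (hφ : φ ∈ smoothCharts p T)
    (hψ : ψ ∈ smoothCharts n M) (hf : ContMDiff (𝓡 p) (𝓡 n) ∞ f) (hχ : ContDiff ℝ ∞ χ)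
    (hχc : HasCompactSupport χ) (hχW : tsupport χ ⊆ mapDom φ ψ f) (hθc : ContDiff ℝ ∞ θ)
    (hθ : ∀ s, ∀ t ∈ tsupport χ, locRep φ ψ f t + (θ s * χ t) • stdVec k ∈ ψ.target) :
    ContMDiff (𝓘(ℝ).prod (𝓡 p)) (𝓡 n) ∞ (localVariation φ ψ f χ k θ) := by
  have hK : IsClosed (φ.symm '' tsupport χ) :=
    (hχc.isCompact.image_of_continuousOn
      (φ.continuousOn_symm.mono fun t ht => (hχW ht).1)).isClosed
  have hW := isOpen_mapDom (φ := φ) (ψ := ψ) hf.continuous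
  intro z
  by_cases hz : z.2 ∈ φ.symm '' tsupport χ
  · obtain ⟨t, ht, htz⟩ := hz
    have hzs : z.2 ∈ φ.source := htz ▸ φ.map_target (hχW ht).1
    have hφz : φ z.2 = t := by rw [← htz, φ.right_inv (hχW ht).1]
    have hzW : φ z.2 ∈ mapDom φ ψ f := hφz ▸ hχW ht
    have hfz : f z.2 ∈ ψ.source := htz ▸ (hχW ht).2
    have h1 : ContMDiffAt (𝓘(ℝ).prod (𝓡 p)) (𝓡 n) ∞ (fun z : ℝ × T => ψ (f z.2)) z :=
      ((contMDiffOn_of_mem_maximalAtlas hψ).contMDiffAt (ψ.open_source.mem_nhds hfz)).comp z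
        ((hf.comp contMDiff_snd) z)
    have h2 : ContMDiffAt (𝓘(ℝ).prod (𝓡 p)) 𝓘(ℝ) ∞ (fun z : ℝ × T => θ z.1) z :=
      (hθc.contMDiff.comp contMDiff_fst) z
    have h3 : ContMDiffAt (𝓘(ℝ).prod (𝓡 p)) 𝓘(ℝ) ∞ (fun z : ℝ × T => χ (φ z.2)) z :=
      (hχ.contMDiff _).comp z (((contMDiffOn_of_mem_maximalAtlas hφ).contMDiffAt
        (φ.open_source.mem_nhds hzs)).comp z (contMDiff_snd z))
    have h4 : ContMDiffAt (𝓘(ℝ).prod (𝓡 p)) (𝓡 n) ∞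
        (fun z : ℝ × T => ψ (f z.2) + (θ z.1 * χ (φ z.2)) • stdVec k) z :=
      h1.add ((h2.smul h3).smul contMDiffAt_const)
    have h5 : ψ (f z.2) + (θ z.1 * χ (φ z.2)) • stdVec k ∈ ψ.target := by
      have := hθ z.1 t ht
      rwa [locRep, htz, ← hφz] at this
    have h6 := ((contMDiffOn_symm_of_mem_maximalAtlas hψ).contMDiffAt
      (ψ.open_target.mem_nhds h5)).comp z h4
    refine h6.congr_of_eventuallyEq ?_
    have h7 : ContinuousAt (fun z : ℝ × T => φ z.2) z :=
      ContinuousAt.comp (f := Prod.snd) (φ.continuousAt hzs) continuousAt_snd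
    filter_upwards [continuousAt_snd.preimage_mem_nhds (φ.open_source.mem_nhds hzs),
      h7.preimage_mem_nhds (hW.mem_nhds hzW)] with w hw hw'
    exact localVariation_of_mem hw hw'
  · refine ((hf.comp contMDiff_snd) z).congr_of_eventuallyEq ?_
    filter_upwards [continuousAt_snd.preimage_mem_nhds (hK.isOpen_compl.mem_nhds hz)] with w hw
    exact localVariation_of_notMem hw

theorem curveJet_localVariation (hφ : φ ∈ smoothCharts p T) (hψ : ψ ∈ smoothCharts n M)
    (hf : ContMDiff (𝓡 p) (𝓡 n) ∞ f) (hχ : ContDiff ℝ ∞ χ)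
    (hθ : ∀ s, ∀ t ∈ tsupport χ, locRep φ ψ f t + (θ s * χ t) • stdVec k ∈ ψ.target) (s : ℝ)
    {t : Rn p} (ht : t ∈ mapDom φ ψ f) :
    t ∈ mapDom φ ψ (fun x => localVariation φ ψ f χ k θ (s, x)) ∧
    curveJet (locRep φ ψ fun x => localVariation φ ψ f χ k θ (s, x)) t
      = curveJet (locRep φ ψ f) t + θ s • dirJet χ k t := by
  have hW := isOpen_mapDom (φ := φ) (ψ := ψ) hf.continuous
  have h0 : ∀ t ∈ mapDom φ ψ f, localVariation φ ψ f χ k θ (s, φ.symm t)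
      = ψ.symm (locRep φ ψ f t + (θ s * χ t) • stdVec k) := fun t ht => by
    have h1 : φ (φ.symm t) = t := φ.right_inv ht.1
    rw [localVariation_of_mem (φ.map_target ht.1) (by rwa [h1]), h1, locRep]
  have h1 : locRep φ ψ (fun x => localVariation φ ψ f χ k θ (s, x))
      =ᶠ[𝓝 t] fun t => locRep φ ψ f t + (θ s * χ t) • stdVec k := by
    filter_upwards [hW.mem_nhds ht] with t' ht'
    rw [locRep, h0 t' ht', ψ.right_inv (locRep_add_mem hθ s ht')]
  refine ⟨⟨ht.1, ?_⟩, ?_⟩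
  · simp only [mem_preimage, h0 t ht]
    exact ψ.map_target (locRep_add_mem hθ s ht)
  · rw [← curveJet_add (((contDiffOn_locRep hφ hψ hf).contDiffAt
      (hW.mem_nhds ht)).differentiableAt (by simp)) (hχ.differentiable (by simp) t)]
    refine Prod.ext rfl (Prod.ext h1.eq_of_nhds ?_)
    funext i α
    have h2 : (fun t => locRep φ ψ (fun x => localVariation φ ψ f χ k θ (s, x)) t i)
        =ᶠ[𝓝 t] fun t => (locRep φ ψ f t + (θ s * χ t) • stdVec k) i := by
      filter_upwards [h1] with t' ht'
      rw [ht']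
    change fderiv ℝ _ t _ = fderiv ℝ _ t _
    rw [h2.fderiv_eq]

end LocalVariation

/-! ### Extremals are harmonic maps. -/

section FirstVariation

variable {p n : ℕ} {T M : Type*} [TopologicalSpace T] [ChartedSpace (Rn p) T]
  [TopologicalSpace M] [ChartedSpace (Rn n) M]
  {h : SemiRiemannianMetric p T} {g : SpatialDMetric p n T M} {L : Jet p n T M → ℝ}
  {φ : LChart p T} {ψ : LChart n M} {f : T → M}
  {χ : Rn p → ℝ} {k : Fin n} {θ : ℝ → ℝ}

/-- Off the image of the support both maps have the same jets, so the difference of the energies is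
an integral over the chart domain that reduces to the support. Only this difference is written in
coordinates. -/
theorem energy_localVariation [T2Space T] [CompactSpace T] [IsManifold (𝓡 p) ∞ T]
    [MeasurableSpace T] [BorelSpace T] [IsManifold (𝓡 n) ∞ M]
    (hL : IsSmoothOnJets L) (hφ : φ ∈ smoothCharts p T)
    (hψ : ψ ∈ smoothCharts n M) (hf : ContMDiff (𝓡 p) (𝓡 n) ∞ f) (hχ : ContDiff ℝ ∞ χ)
    (hχc : HasCompactSupport χ) (hχW : tsupport χ ⊆ mapDom φ ψ f) (hθc : ContDiff ℝ ∞ θ)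
    (hθ : ∀ s, ∀ t ∈ tsupport χ, locRep φ ψ f t + (θ s * χ t) • stdVec k ∈ ψ.target) (s : ℝ) :
    energy h L (fun x => localVariation φ ψ f χ k θ (s, x))
      = energy h L f + ((∫ t in tsupport χ, volDensity h φ t
          * locL L φ ψ (curveJet (locRep φ ψ f) t + θ s • dirJet χ k t))
        - ∫ t in tsupport χ, volDensity h φ t * locL L φ ψ (curveJet (locRep φ ψ f) t)) := by
  set f' : T → M := fun x => localVariation φ ψ f χ k θ (s, x)
  have hf' : ContMDiff (𝓡 p) (𝓡 n) ∞ f' :=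
    (contMDiff_localVariation hφ hψ hf hχ hχc hχW hθc hθ).comp
      (contMDiff_const.prodMk contMDiff_id)
  have hc := continuous_lagrangian hL hf
  have hc' := continuous_lagrangian hL hf'
  have hint : ∀ {F : T → ℝ}, Continuous F → Integrable F (volumeMeasure h) := fun {F} hF => by
    rw [← integrableOn_univ]
    exact hF.continuousOn.integrableOn_compact isCompact_univ
  have hcj := fun {t : Rn p} (ht : t ∈ mapDom φ ψ f) =>
    curveJet_localVariation hφ hψ hf hχ hθ s ht
  have hK : IsClosed (φ.symm '' tsupport χ) :=
    (hχc.isCompact.image_of_continuousOn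
      (φ.continuousOn_symm.mono fun t ht => (hχW ht).1)).isClosed
  have h0 : ∀ x, x ∉ φ.symm '' tsupport χ →
      L (jetProlong p n f' x) - L (jetProlong p n f x) = 0 := by
    intro x hx
    have : f' =ᶠ[𝓝 x] f := by
      filter_upwards [hK.isOpen_compl.mem_nhds hx] with y hy
      exact localVariation_of_notMem (z := (s, y)) hy
    rw [jetProlong_congr this, sub_self]
  have hρ : ContinuousOn (volDensity h φ) (tsupport χ) :=
    (continuousOn_volDensity hφ).mono fun t ht => (hχW ht).1
  have hW := isOpen_mapDom (φ := φ) (ψ := ψ) hf.continuous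
  have hJ : ContinuousOn (curveJet (locRep φ ψ f)) (tsupport χ) :=
    (contDiffOn_curveJet hW (contDiffOn_locRep hφ hψ hf)).continuousOn.mono hχW
  have hl := (hL φ hφ ψ hψ).continuousOn
  have i1 : IntegrableOn (fun t => volDensity h φ t
      * locL L φ ψ (curveJet (locRep φ ψ f) t + θ s • dirJet χ k t)) (tsupport χ) := by
    refine ContinuousOn.integrableOn_compact hχc.isCompact (hρ.mul (hl.comp
      (hJ.add ((continuous_dirJet hχ k).const_smul (θ s)).continuousOn) fun t ht => ?_))
    rw [← (hcj (hχW ht)).2]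
    exact curveJet_locRep_mem (hcj (hχW ht)).1
  have i2 : IntegrableOn (fun t => volDensity h φ t
      * locL L φ ψ (curveJet (locRep φ ψ f) t)) (tsupport χ) :=
    ContinuousOn.integrableOn_compact hχc.isCompact (hρ.mul (hl.comp hJ fun t ht =>
      curveJet_locRep_mem (hχW ht)))
  have h1 : energy h L f' - energy h L f = ∫ x in φ.source,
      (L (jetProlong p n f' x) - L (jetProlong p n f x)) ∂(volumeMeasure h) := by
    rw [energy, energy, ← integral_sub (hint hc') (hint hc)]
    refine (setIntegral_eq_integral_of_forall_compl_eq_zero fun x hx => h0 x ?_).symm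
    rintro ⟨t, ht, rfl⟩
    exact hx (φ.map_target (hχW ht).1)
  rw [setIntegral_source hφ (F := fun x => L (jetProlong p n f' x) - L (jetProlong p n f x))
    (hc'.sub hc).aestronglyMeasurable] at h1
  have h2 : ∫ t in φ.target, volDensity h φ t * (L (jetProlong p n f' (φ.symm t))
        - L (jetProlong p n f (φ.symm t)))
      = ∫ t in tsupport χ, volDensity h φ t * (L (jetProlong p n f' (φ.symm t))
        - L (jetProlong p n f (φ.symm t))) := by
    refine setIntegral_eq_of_subset_of_forall_sdiff_eq_zero φ.open_target.measurableSet
      (fun t ht => (hχW ht).1) fun t ht => ?_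
    rw [h0, mul_zero]
    rintro ⟨t', ht', htt⟩
    have := congrArg φ htt
    rw [φ.right_inv (hχW ht').1, φ.right_inv ht.1] at this
    exact ht.2 (this ▸ ht')
  have h3 : ∫ t in tsupport χ, volDensity h φ t * (L (jetProlong p n f' (φ.symm t))
        - L (jetProlong p n f (φ.symm t)))
      = ∫ t in tsupport χ, (volDensity h φ t
          * locL L φ ψ (curveJet (locRep φ ψ f) t + θ s • dirJet χ k t)
        - volDensity h φ t * locL L φ ψ (curveJet (locRep φ ψ f) t)) := by
    refine setIntegral_congr_fun (isClosed_tsupport χ).measurableSet fun t ht => ?_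
    have h4 := lagrangian_symm (L := L) hφ hψ hf' (hcj (hχW ht)).1
    rw [(hcj (hχW ht)).2] at h4
    simp only [h4, lagrangian_symm hφ hψ hf (hχW ht), mul_sub]
  rw [h2, h3, integral_sub i1 i2] at h1
  linarith

/-- At σ = 0 the perturbed values lie in the open target, and the support is compact. The tube lemma
makes the admissible range of σ uniform. -/
theorem exists_pos_locRep_add_mem (hφ : φ ∈ smoothCharts p T) (hψ : ψ ∈ smoothCharts n M)
    (hf : ContMDiff (𝓡 p) (𝓡 n) ∞ f) (hχ : ContDiff ℝ ∞ χ)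
    (hχc : HasCompactSupport χ) (hχW : tsupport χ ⊆ mapDom φ ψ f) (k : Fin n) :
    ∃ δ > 0, ∀ σ : ℝ, |σ| ≤ δ → ∀ t ∈ tsupport χ,
      locRep φ ψ f t + (σ * χ t) • stdVec k ∈ ψ.target := by
  have hW := isOpen_mapDom (φ := φ) (ψ := ψ) hf.continuous
  have hc : ContinuousOn (fun z : ℝ × Rn p => locRep φ ψ f z.2 + (z.1 * χ z.2) • stdVec k)
      (univ ×ˢ mapDom φ ψ f) := by
    refine ((contDiffOn_locRep hφ hψ hf).continuousOn.comp continuousOn_snd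
      fun z hz => hz.2).add ?_
    exact ((continuous_fst.mul (hχ.continuous.comp continuous_snd)).smul
      continuous_const).continuousOn
  obtain ⟨U, V, hU, -, h0U, hKV, hUV⟩ := generalized_tube_lemma
    (isCompact_singleton (x := (0 : ℝ))) hχc.isCompact
    (hc.isOpen_inter_preimage (isOpen_univ.prod hW) ψ.open_target) (by
      rintro ⟨s, t⟩ ⟨hs, ht⟩
      obtain rfl : s = 0 := hs
      exact ⟨⟨mem_univ _, hχW ht⟩, by simpa [locRep] using ψ.map_source (hχW ht).2⟩)
  obtain ⟨ε, hε, hεU⟩ := Metric.isOpen_iff.1 hU 0 (h0U rfl)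
  refine ⟨ε / 2, half_pos hε, fun σ hσ t ht => ?_⟩
  have h1 : σ ∈ Metric.ball (0 : ℝ) ε := by
    rw [mem_ball_zero_iff, Real.norm_eq_abs]
    linarith
  exact (hUV (show (σ, t) ∈ U ×ˢ V from ⟨hεU h1, hKV ht⟩)).2

/-- The first variation of the energy of an extremal vanishes in local coordinates. -/
theorem IsExtremal.integral_eq_zero [T2Space T] [CompactSpace T] [IsManifold (𝓡 p) ∞ T]
    [MeasurableSpace T] [BorelSpace T] [IsManifold (𝓡 n) ∞ M]
    (hf : IsExtremal h L f) (hL : IsSmoothOnJets L) (hφ : φ ∈ smoothCharts p T)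
    (hψ : ψ ∈ smoothCharts n M) (hχ : ContDiff ℝ ∞ χ)
    (hχc : HasCompactSupport χ) (hχW : tsupport χ ⊆ mapDom φ ψ f) (k : Fin n) :
    ∫ t in tsupport χ, volDensity h φ t
      * fderiv ℝ (locL L φ ψ) (curveJet (locRep φ ψ f) t) (dirJet χ k t) = 0 := by
  obtain ⟨δ, hδ, hδt⟩ := exists_pos_locRep_add_mem hφ hψ hf.1 hχ hχc hχW k
  -- An extremal is tested against variations defined for every real s. The function δ sin s stays
  -- within the admissible range |σ| ≤ δ and has nonzero derivative δ at 0.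
  set θ : ℝ → ℝ := fun s => δ * Real.sin s with hθd
  have hθ : ∀ s, ∀ t ∈ tsupport χ, locRep φ ψ f t + (θ s * χ t) • stdVec k ∈ ψ.target :=
    fun s t ht => hδt _ (by
      rw [hθd, abs_mul, abs_of_pos hδ]
      exact mul_le_of_le_one_right hδ.le (Real.abs_sin_le_one s)) t ht
  have hθc : ContDiff ℝ ∞ θ := contDiff_const.mul Real.contDiff_sin
  have hθ' : HasDerivAt θ δ 0 := by
    simpa using (Real.hasDerivAt_sin 0).const_mul δ
  have hθ0 : θ 0 = 0 := by simp [hθd]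
  have h1 := hf.2 (localVariation φ ψ f χ k θ)
    (contMDiff_localVariation hφ hψ hf.1 hχ hχc hχW hθc hθ) (fun x => by
      by_cases hx : x ∈ φ.symm '' tsupport χ
      · obtain ⟨t, ht, rfl⟩ := hx
        have h2 : φ (φ.symm t) = t := φ.right_inv (hχW ht).1
        rw [localVariation_of_mem (φ.map_target (hχW ht).1) (by rw [h2]; exact hχW ht)]
        simp only [hθ0, zero_mul, zero_smul, add_zero]
        exact ψ.left_inv (hχW ht).2
      · exact localVariation_of_notMem hx)
  have hW := isOpen_mapDom (φ := φ) (ψ := ψ) hf.1.continuous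
  have h3 := hasDerivAt_integral_variation (isOpen_jetDomain φ ψ) (hL φ hφ ψ hψ) hW
    (contDiffOn_locRep hφ hψ hf.1) (fun t ht => curveJet_locRep_mem ht)
    ((continuousOn_volDensity (h := h) hφ).mono inter_subset_left) hχ hχc hχW k
  have h4 := ((HasDerivAt.comp_of_eq (0 : ℝ) h3 hθ' hθ0.symm).sub_const
    (∫ t in tsupport χ, volDensity h φ t
      * locL L φ ψ (curveJet (locRep φ ψ f) t))).const_add (energy h L f)
  have h5 : (fun s => energy h L fun x => localVariation φ ψ f χ k θ (s, x))
      = fun s => energy h L f + ((∫ t in tsupport χ, volDensity h φ t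
          * locL L φ ψ (curveJet (locRep φ ψ f) t + θ s • dirJet χ k t))
        - ∫ t in tsupport χ, volDensity h φ t * locL L φ ψ (curveJet (locRep φ ψ f) t)) :=
    funext fun s => energy_localVariation hL hφ hψ hf.1 hχ hχc hχW hθc hθ s
  rw [h5] at h1
  have h6 := h1.unique h4
  -- By the chain rule the derivative of the energy at s = 0 is the first variation times θ'(0) = δ,
  -- which is positive.
  rcases mul_eq_zero.1 h6.symm with h7 | h7
  · exact h7
  · exact absurd h7 hδ.ne'

theorem contDiffOn_volDensity (hφ : φ ∈ smoothCharts p T) :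
    ContDiffOn ℝ ∞ (volDensity h φ) φ.target := by
  intro t ht
  have h1 : ContDiffAt ℝ ∞ (fun t => (hLow h φ t).det) t :=
    (contDiffOn_det (contDiffOn_hLow h hφ)).contDiffAt (φ.open_target.mem_nhds ht)
  have h2 := det_hLow_ne_zero h hφ ht
  exact ((h1.abs h2).sqrt (abs_ne_zero.2 h2)).contDiffWithinAt

/-- The velocity of the jet of a map is the total vector D_α at that jet plus the vertical vector of
second derivatives. This separates the second-order part of the Euler–Lagrange equations from
`elTerm`. -/
theorem fderiv_comp_curveJet {F : JCoord p n → ℝ} {u : Rn p → Rn n} {W : Set (Rn p)}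
    (hW : IsOpen W) (hu : ContDiffOn ℝ ∞ u W) {t : Rn p} (ht : t ∈ W)
    (hF : DifferentiableAt ℝ F (curveJet u t)) (α : Fin p) :
    DifferentiableAt ℝ (fun s => F (curveJet u s)) t ∧
    fderiv ℝ (fun s => F (curveJet u s)) t (stdVec α)
      = fderiv ℝ F (curveJet u t) (totalVec (curveJet u t) α)
        + ∑ j, ∑ β, fderiv ℝ (fun r => fderiv ℝ (fun s => u s j) r (stdVec β)) t (stdVec α)
          * dV j β F (curveJet u t) := by
  have hui : ∀ i, ContDiffOn ℝ ∞ (fun s => u s i) W := fun i =>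
    (EuclideanSpace.proj i : Rn n →L[ℝ] ℝ).contDiff.comp_contDiffOn hu
  have h1 : HasFDerivAt u (fderiv ℝ u t) t :=
    ((hu.contDiffAt (hW.mem_nhds ht)).differentiableAt (by simp)).hasFDerivAt
  have h2 : HasFDerivAt (curveJet u) ((ContinuousLinearMap.id ℝ (Rn p)).prod
      ((fderiv ℝ u t).prod (ContinuousLinearMap.pi fun i => ContinuousLinearMap.pi fun β =>
        fderiv ℝ (fun r => fderiv ℝ (fun s => u s i) r (stdVec β)) t))) t :=
    (hasFDerivAt_id t).prodMk (h1.prodMk (hasFDerivAt_pi.2 fun i => hasFDerivAt_pi.2 fun β =>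
      (differentiableAt_of_contDiffOn hW (contDiffOn_fderiv_apply hW (hui i) _) ht).hasFDerivAt))
  have h3 := hF.hasFDerivAt.comp t h2
  refine ⟨h3.differentiableAt, ?_⟩
  have h4 : fderiv ℝ (fun s => F (curveJet u s)) t = _ := h3.fderiv
  have h5 : ∀ j, fderiv ℝ u t (stdVec α) j = fderiv ℝ (fun s => u s j) t (stdVec α) := fun j => by
    have h6 : HasFDerivAt (fun s => u s j)
        ((EuclideanSpace.proj j : Rn n →L[ℝ] ℝ).comp (fderiv ℝ u t)) t :=
      (EuclideanSpace.proj j : Rn n →L[ℝ] ℝ).hasFDerivAt.comp t h1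
    rw [h6.fderiv]
    rfl
  rw [h4, ContinuousLinearMap.comp_apply, fderiv_eq_sum, fderiv_totalVec]
  simp [h5, curveJet]

/-- The Euler–Lagrange equations of an extremal. -/
theorem IsExtremal.elTerm_eq [T2Space T] [CompactSpace T] [IsManifold (𝓡 p) ∞ T]
    [MeasurableSpace T] [BorelSpace T] [IsManifold (𝓡 n) ∞ M]
    (hf : IsExtremal h L f) (hL : IsKroneckerRegular h g L) (hφ : φ ∈ smoothCharts p T)
    (hψ : ψ ∈ smoothCharts n M) {t : Rn p} (ht : t ∈ mapDom φ ψ f) (k : Fin n) :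
    elTerm h L φ ψ (locJet φ ψ f t) k
      = -(2 * ∑ j, gLow g φ ψ (locJet φ ψ f t) k j
        * ∑ α, ∑ β, hUp h φ t α β * locMap2 φ ψ f j α β t) := by
  have ho := isOpen_jetDomain (p := p) (n := n) φ ψ
  have hW := isOpen_mapDom (φ := φ) (ψ := ψ) hf.1.continuous
  have hu := contDiffOn_locRep hφ hψ hf.1
  have hl := hL.contDiffOn hφ hψ
  have hJ : locJet φ ψ f t = curveJet (locRep φ ψ f) t := rfl
  have hmem : curveJet (locRep φ ψ f) t ∈ jetDomain φ ψ := curveJet_locRep_mem ht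
  have h1 := euler_lagrange ho hl hW hu (fun t ht => curveJet_locRep_mem ht)
    ((contDiffOn_volDensity (h := h) hφ).mono inter_subset_left) k
    (fun χ hχ hχc hχW => hf.integral_eq_zero hL.smooth hφ hψ hχ hχc hχW k) ht
  -- Product rule: the density contributes the Christoffel trace, and the momenta contribute their
  -- derivative along D_α and the velocity Hessian of L applied to the second derivatives of the
  -- map.
  have h2 : ∀ α, fderiv ℝ (fun s => volDensity h φ s
        * dV k α (locL L φ ψ) (curveJet (locRep φ ψ f) s)) t (stdVec α)
      = volDensity h φ t * (fderiv ℝ (dV k α (locL L φ ψ)) (curveJet (locRep φ ψ f) t)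
          (totalVec (curveJet (locRep φ ψ f) t) α)
        + (∑ j, ∑ β, locMap2 φ ψ f j α β t
          * (2 * hUp h φ t β α * gLow g φ ψ (curveJet (locRep φ ψ f) t) j k))
        + ∑ γ, dV k α (locL L φ ψ) (curveJet (locRep φ ψ f) t) * christoffelH h φ t γ α γ) := by
    intro α
    obtain ⟨h3, h4⟩ := fderiv_comp_curveJet hW hu ht
      (differentiableAt_of_contDiffOn ho (contDiffOn_dV ho hl k α) hmem) α
    obtain ⟨h5, h6⟩ := fderiv_volumeDensity h hφ ht.1 α
    have h7 := (show HasFDerivAt (volDensity h φ) _ t from h5.hasFDerivAt).fun_mul h3.hasFDerivAt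
    rw [h7.fderiv, add_apply, smul_apply, smul_apply, h4, h6]
    simp only [hL.dV_dV hφ hψ hmem, smul_eq_mul, mul_add, volDensity, ← Finset.mul_sum]
    have h8 : ∀ j β, fderiv ℝ (fun r => fderiv ℝ (fun s => locRep φ ψ f s j) r (stdVec β)) t
        (stdVec α) = locMap2 φ ψ f j α β t := fun _ _ => rfl
    have h9 : (curveJet (locRep φ ψ f) t).1 = t := rfl
    simp only [h8, h9]
    ring
  simp only [h2] at h1
  rw [← Finset.mul_sum] at h1
  have h3 := mul_left_cancel₀ (volDensity_pos (h := h) hφ ht.1).ne' h1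
  have h4 : 2 * ∑ j, gLow g φ ψ (curveJet (locRep φ ψ f) t) k j
        * ∑ α, ∑ β, hUp h φ t α β * locMap2 φ ψ f j α β t
      = ∑ α, ∑ j, ∑ β, locMap2 φ ψ f j α β t
          * (2 * hUp h φ t β α * gLow g φ ψ (curveJet (locRep φ ψ f) t) j k) := by
    rw [Finset.sum_comm, Finset.mul_sum]
    refine Finset.sum_congr rfl fun j _ => ?_
    rw [Finset.mul_sum, Finset.mul_sum]
    refine Finset.sum_congr rfl fun α _ => ?_
    rw [Finset.mul_sum, Finset.mul_sum]
    refine Finset.sum_congr rfl fun β _ => ?_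
    rw [hUp_comm h φ t β α, gLow_comm g φ ψ _ j k]
    ring
  rw [hJ, h4, elTerm]
  have h9 : (curveJet (locRep φ ψ f) t).1 = t := rfl
  simp only [Finset.sum_add_distrib, h9] at h3 ⊢
  linarith

/-- The extremals of the energy functional are harmonic maps of the canonical spray. -/
theorem IsExtremal.isHarmonicMapOfSpray [T2Space T] [CompactSpace T] [IsManifold (𝓡 p) ∞ T]
    [MeasurableSpace T] [BorelSpace T] [IsManifold (𝓡 n) ∞ M] (hp : 1 ≤ p)
    (hf : IsExtremal h L f) (hL : IsKroneckerRegular h g L) :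
    IsHarmonicMapOfSpray h (canonicalH h) (canonicalG h g L) f := by
  refine ⟨hf.1, fun φ hφ ψ hψ t ht hft i => ?_⟩
  have htW : t ∈ mapDom φ ψ f := ⟨ht, hft⟩
  have hq : locJet φ ψ f t ∈ jetDomain φ ψ := curveJet_locRep_mem htW
  have h1 := hL.hTrace_canonicalG hp hφ hψ hq i
  have hδ : ∀ l, ∑ k, gUp g φ ψ (locJet φ ψ f t) i k * gLow g φ ψ (locJet φ ψ f t) k l
      = if i = l then 1 else 0 := fun l => sum_inv_mul_apply (det_gLow_ne_zero g hψ hq) i l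
  have h2 : ∑ k, gUp g φ ψ (locJet φ ψ f t) i k * elTerm h L φ ψ (locJet φ ψ f t) k
      = -(2 * ∑ α, ∑ β, hUp h φ t α β * locMap2 φ ψ f i α β t) := by
    simp only [hf.elTerm_eq hL hφ hψ htW, mul_neg, Finset.sum_neg_distrib, mul_left_comm _ (2 : ℝ),
      ← Finset.mul_sum]
    congr 2
    have h3 : ∀ v : Fin n → ℝ, ∑ k, gUp g φ ψ (locJet φ ψ f t) i k
        * ∑ j, gLow g φ ψ (locJet φ ψ f t) k j * v j = v i := by
      intro v
      simp only [Finset.mul_sum, ← mul_assoc]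
      rw [Finset.sum_comm]
      simp only [← Finset.sum_mul, hδ]
      simp
    exact h3 _
  have h4 : (locJet φ ψ f t).1 = t := rfl
  -- On an extremal this reads 2𝒢^i = −h^{αβ} x^i_{αβ} + h^{αβ} H^γ_{αβ} x^i_γ. The last term is the
  -- negative of the trace of 2H^{(i)}_{(α)β}, so the harmonic map equation follows.
  simp only [hTrace, traceG, h2, h4] at h1
  have h5 : ∑ α, ∑ β, hUp h φ t α β * canonicalH h φ ψ (locJet φ ψ f t) i α β
      = -(1 / 2) * ∑ α, ∑ β, ∑ γ, hUp h φ t α β * christoffelH h φ t γ α β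
        * (locJet φ ψ f t).2.2 i γ := by
    simp only [canonicalH, Finset.mul_sum, h4]
    exact Finset.sum_congr rfl fun _ _ => Finset.sum_congr rfl fun _ _ =>
      Finset.sum_congr rfl fun _ _ => by ring
  simp only [mul_add, Finset.sum_add_distrib, mul_left_comm _ (2 : ℝ), ← Finset.mul_sum]
  linarith

end FirstVariation

end MultiTime

end

theorem mainTheorem3 {p n : ℕ} (hp : 1 ≤ p)
    {T M : Type*}
    [TopologicalSpace T] [T2Space T] [CompactSpace T] [ChartedSpace (Rn p) T]
    [IsManifold (𝓡 p) ∞ T] [MeasurableSpace T] [BorelSpace T]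
    [TopologicalSpace M] [T2Space M] [SecondCountableTopology M] [ChartedSpace (Rn n) M]
    [IsManifold (𝓡 n) ∞ M]
    (h : SemiRiemannianMetric p T) (g : SpatialDMetric p n T M) (L : Jet p n T M → ℝ)
    (hL : IsKroneckerRegular h g L) :
    -- for `p ≥ 2`: `L = h^{αβ}(t) g_{ij}(t,x) x^i_α x^j_β + U^{(α)}_{(i)}(t,x) x^i_α + F(t,x)`
    (2 ≤ p → ∀ φ ∈ smoothCharts p T, ∀ ψ ∈ smoothCharts n M, ∀ q ∈ jetDomain φ ψ,
      gLow g φ ψ q = gLow g φ ψ (zeroJet q) ∧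
      locL L φ ψ q =
        (∑ α, ∑ β, ∑ i, ∑ j, hUp h φ q.1 α β * gLow g φ ψ q i j * q.2.2 i α * q.2.2 j β)
          + (∑ α, ∑ i, potU L φ ψ α i q * q.2.2 i α) + potF L φ ψ q) ∧
    -- `(H,G)` is a spray
    IsTemporalSpray (canonicalH h : LocalTT p n T M) ∧
    IsSpatialSpray (canonicalG h g L) ∧
    -- the extremals of the energy functional are harmonic maps of `(H,G)`
    (∀ f : T → M, IsExtremal h L f →
      IsHarmonicMapOfSpray h (canonicalH h) (canonicalG h g L) f) ∧
    -- the spray induces the canonical nonlinear connection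
    IsNonlinearConnection (inducedM (canonicalH h)) (inducedN h (canonicalG h g L)) ∧
    (2 ≤ p → ∀ φ ∈ smoothCharts p T, ∀ ψ ∈ smoothCharts n M, ∀ q ∈ jetDomain φ ψ,
      ∀ (i j : Fin n) (α : Fin p),
        inducedN h (canonicalG h g L) φ ψ q i α j =
          (∑ k, christoffelG g φ ψ q i j k * q.2.2 k α)
            + (∑ k, gUp g φ ψ q i k / 2 * dT α (fun r => gLow g φ ψ r j k) q)
            + ∑ k, ∑ γ, gUp g φ ψ q i k / 4 * hLow h φ q.1 α γ * curlU L φ ψ q γ k j) := by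
  refine ⟨fun hp2 φ hφ ψ hψ q hq => ⟨hL.gLow_zeroJet hp2 hφ hψ hq, hL.locL_eq hp2 hφ hψ hq⟩,
    isTemporalSpray_canonicalH h, hL.isSpatialSpray hp, fun f hf => hf.isHarmonicMapOfSpray hp hL,
    hL.isNonlinearConnection hp,
    fun hp2 φ hφ ψ hψ q hq i j α => hL.inducedN_eq hp2 hφ hψ hq i j α⟩
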